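/- **Setting.** Let $G$ and $H$ be second countable locally compact Hausdorff groupoids with Haar systems $\{\lambda_G^u\}$ and $\{\lambda_H^v\}$. All bundles are upper semicontinuous Banach bundles with enough continuous sections, and $\Gamma_c(X;\mathscr A)$ denotes the continuous compactly supported sections of $\mathscr A\to X$ with the inductive limit topology (the finest locally convex topology for which the inclusions of the spaces of sections vanishing off a fixed compact set, with the supremum norm, are continuous). A *Fell bundle* $p:\mathscr B\to G$ is such a bundle, with $\Gamma_0(G;\mathscr B)$ separable, together with a continuous bilinear associative multiplication covering that of $G$ and a continuous conjugate linear involution covering $x\mapsto x^{-1}$ with $(ab)^*=b^*a^*$, such that $B(u)$ is a $C^*$-algebra for each unit $u$ and each $B(x)$ is a $B(r(x))$–$B(s(x))$-imprimitivity bimodule with inner products $ab^*$ and $a^*b$. On $\Gamma_c(G;\mathscr B)$ put $$f*g(x)=\int_G f(y)g(y^{-1}x)\,d\lambda_G^{r(x)}(y),\qquad f^*(x)=f(x^{-1})^*.$$ Let $T$ be a $(G,H)$-equivalence: a locally compact Hausdorff space with commuting free and proper actions of $G$ on the left and $H$ on the right, whose continuous open moment maps $r:T\to G^{(0)}$ and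 $s:T\to H^{(0)}$ induce bijections $T/H\to G^{(0)}$ and $G\backslash T\to H^{(0)}$. For $s(t)=s(t')$ let $[t,t']_G$ be the $x\in G$ with $x\cdot t'=t$; for $r(t)=r(t')$ let $[t,t']_H$ be the $h\in H$ with $t\cdot h=t'$. For Fell bundles $\mathscr B\to G$ and $\mathscr C\to H$, a *$\mathscr B$–$\mathscr C$-equivalence* $q:\mathscr E\to T$ is an upper semicontinuous Banach bundle with commuting continuous actions of $\mathscr B$ (left) and $\mathscr C$ (right) covering those on $T$, with $\|b\cdot e\|\le\|b\|\|e\|$ and $\|e\cdot c\|\le\|e\|\|c\|$, and with continuous sesquilinear maps $(e,f)\mapsto{}_{\mathscr B}\langle e,f\rangle$, defined when $s(q(e))=s(q(f))$ and lying over $[q(e),q(f)]_G$, and $(e,f)\mapsto\langle e,f\rangle_{\mathscr C}$, defined when $r(q(e))=r(q(f))$ and lying over $[q(e),q(f)]_H$, such that ${}_{\mathscr B}\langle e,f\rangle^*={}_{\mathscr B}\langle f,e\rangle$, $\langle e,f\rangle_{\mathscr C}^*=\langle f,e\rangle_{\mathscr C}$, ${}_{\mathscr B}\langle b\cdot e,f\rangle=b\,{}_{\mathscr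 B}\langle e,f\rangle$, $\langle e,f\cdot c\rangle_{\mathscr C}=\langle e,f\rangle_{\mathscr C}\,c$, ${}_{\mathscr B}\langle e,f\rangle\cdot g=e\cdot\langle f,g\rangle_{\mathscr C}$, and such that each fibre $E(t)$ is with these operations a $B(r(t))$–$C(s(t))$-imprimitivity bimodule. For $f\in\Gamma_c(G;\mathscr B)$ and $\xi,\eta\in\Gamma_c(T;\mathscr E)$ put $$f\cdot\xi(t)=\int_G f(x)\cdot\xi(x^{-1}\cdot t)\,d\lambda_G^{r(t)}(x),\qquad \langle\!\langle\xi,\eta\rangle\!\rangle(x)=\int_H{}_{\mathscr B}\langle\xi(x\cdot t\cdot h),\eta(t\cdot h)\rangle\,d\lambda_H^{s(t)}(h),$$ where $t\in T$ is any point with $r(t)=s(x)$. **Proposition.** (1) If $q:\mathscr E\to T$ is a $\mathscr B$–$\mathscr C$-equivalence, then there is a net $\{e_\lambda\}$ in $\Gamma_c(G;\mathscr B)$ of elements of the form $$e_\lambda=\sum_{i=1}^{n_\lambda}\langle\!\langle\xi_i^\lambda,\xi_i^\lambda\rangle\!\rangle,\qquad \xi_i^\lambda\in\Gamma_c(T;\mathscr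 E),$$ such that $e_\lambda*f\to f$ for every $f\in\Gamma_c(G;\mathscr B)$ and $e_\lambda\cdot\eta\to\eta$ for every $\eta\in\Gamma_c(T;\mathscr E)$, in the inductive limit topologies. (2) In particular, for every Fell bundle $\mathscr B\to G$ there is a net $\{e_\lambda\}$ in $\Gamma_c(G;\mathscr B)$ with $e_\lambda^*=e_\lambda$ such that $e_\lambda*f\to f$ and $f*e_\lambda\to f$ in the inductive limit topology for every $f\in\Gamma_c(G;\mathscr B)$. -/

import Mathlib

open Filter Topology MeasureTheory

universe uG uB uH uC uT uE

/-! ### Locally compact groupoids, Haar systems, equivalences of groupoids -/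

/-- A topological groupoid `G` with unit space `unitSet ⊆ G` (carrying the subspace topology),
range map `rng` and source map `src`.  The product `x * y` is meaningful only when
`src x = rng y`; its values at other pairs are never used. -/
class TopGroupoid (G : Type*) [TopologicalSpace G] extends Mul G, Inv G where
  unitSet : Set G
  rng : G → unitSet
  src : G → unitSet
  rng_unit : ∀ u : unitSet, rng (u : G) = u
  src_unit : ∀ u : unitSet, src (u : G) = u
  rng_mul : ∀ {x y : G}, src x = rng y → rng (x * y) = rng x
  src_mul : ∀ {x y : G}, src x = rng y → src (x * y) = src y
  mul_assoc' : ∀ {x y z : G}, src x = rng y → src y = rng z → x * y * z = x * (y * z)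
  rng_mul_self : ∀ x : G, (rng x : G) * x = x
  self_mul_src : ∀ x : G, x * (src x : G) = x
  rng_inv : ∀ x : G, rng x⁻¹ = src x
  src_inv : ∀ x : G, src x⁻¹ = rng x
  mul_inv_self : ∀ x : G, x * x⁻¹ = (rng x : G)
  inv_mul_self : ∀ x : G, x⁻¹ * x = (src x : G)
  continuous_rng : Continuous rng
  continuous_src : Continuous src
  continuous_inv' : Continuous fun x : G => x⁻¹
  continuous_mul' : Continuous fun p : {p : G × G // src p.1 = rng p.2} => p.1.1 * p.1.2

namespace TopGroupoid

/-- The unit space `G⁰ ⊆ G`. -/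
abbrev unitSpace (G : Type*) [TopologicalSpace G] [TopGroupoid G] : Set G := unitSet

variable {G : Type*} [TopologicalSpace G] [TopGroupoid G]

theorem unit_mul_unit (u : unitSpace G) : (u : G) * (u : G) = u := by
  have h := rng_mul_self (u : G)
  rwa [rng_unit] at h

theorem inv_eq_of {x y : G} (h : src x = rng y) (hxy : x * y = (rng x : G)) : x⁻¹ = y := by
  have h1 : x⁻¹ * (x * y) = x⁻¹ * x * y := (mul_assoc' (src_inv x) h).symm
  have h2 : x⁻¹ * (rng x : G) = x⁻¹ := by rw [← src_inv x]; exact self_mul_src _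
  rw [hxy, h2, inv_mul_self, h, rng_mul_self] at h1
  exact h1

theorem unit_inv (u : unitSpace G) : (u : G)⁻¹ = u :=
  inv_eq_of (by rw [src_unit, rng_unit]) (by rw [unit_mul_unit, rng_unit])

theorem inv_inv' (x : G) : x⁻¹⁻¹ = x :=
  inv_eq_of (src_inv x) (by rw [inv_mul_self, rng_inv])

theorem src_unit_eq_rng (u : unitSpace G) : src (u : G) = rng (u : G) := by
  rw [src_unit, rng_unit]

/-- If `rng y = rng x`, then `y (y⁻¹ x)` is defined. -/
theorem comp_inv_mul {x y : G} (h : rng y = rng x) : src y = rng (y⁻¹ * x) := by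
  rw [rng_mul (by rw [src_inv, h]), rng_inv]

theorem mul_inv_mul {x y : G} (h : rng y = rng x) : y * (y⁻¹ * x) = x := by
  rw [← mul_assoc' (rng_inv y).symm (by rw [src_inv, h]), mul_inv_self, h, rng_mul_self]

end TopGroupoid

open TopGroupoid

/-- A (left) Haar system on `G`: for each unit `u` a measure `meas u`, finite on compact sets
(hence Radon, as `G` will be second countable and locally compact), whose support is `G^u`,
continuous in `u` and left invariant. -/
structure HaarSystem (G : Type*) [TopologicalSpace G] [TopGroupoid G] [MeasurableSpace G] where
  meas : unitSpace G → Measure G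
  lt_top : ∀ (u : unitSpace G) (K : Set G), IsCompact K → meas u K < ⊤
  null_compl : ∀ u : unitSpace G, meas u {x : G | rng x ≠ u} = 0
  pos : ∀ (u : unitSpace G) (U : Set G), IsOpen U → (∃ x ∈ U, rng x = u) → 0 < meas u U
  continuous_integral : ∀ f : G → ℝ, Continuous f → HasCompactSupport f →
    Continuous fun u : unitSpace G => ∫ x, f x ∂(meas u)
  left_invariant : ∀ f : G → ℝ, Continuous f → HasCompactSupport f → ∀ x : G,
    ∫ y, f (x * y) ∂(meas (src x)) = ∫ y, f y ∂(meas (rng x))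

/-- A `(G, H)`-equivalence `T`: a space with commuting free and proper actions of `G` (left) and
`H` (right), whose moment maps `rng`, `src` are continuous and open and induce bijections
`T / H → G⁰` and `G \ T → H⁰`.  The values `lact x t` with `src x ≠ rng t` and `ract t h` with
`src t ≠ rng h` are never used. -/
structure GroupoidEquivalence (G H T : Type*) [TopologicalSpace G] [TopGroupoid G]
    [TopologicalSpace H] [TopGroupoid H] [TopologicalSpace T] where
  rng : T → unitSpace G
  src : T → unitSpace H
  lact : G → T → T
  ract : T → H → T
  continuous_rng : Continuous rng
  isOpenMap_rng : IsOpenMap rng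
  continuous_src : Continuous src
  isOpenMap_src : IsOpenMap src
  -- the left action of `G`
  rng_lact : ∀ {x : G} {t : T}, TopGroupoid.src x = rng t →
    rng (lact x t) = TopGroupoid.rng x
  mul_lact : ∀ {x y : G} {t : T}, TopGroupoid.src x = TopGroupoid.rng y →
    TopGroupoid.src y = rng t → lact (x * y) t = lact x (lact y t)
  unit_lact : ∀ t : T, lact (rng t : G) t = t
  continuous_lact : Continuous
    fun p : {p : G × T // TopGroupoid.src p.1 = rng p.2} => lact p.1.1 p.1.2
  free_lact : ∀ {x : G} {t : T}, TopGroupoid.src x = rng t → lact x t = t → x = (rng t : G)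
  proper_lact : IsProperMap
    fun p : {p : G × T // TopGroupoid.src p.1 = rng p.2} => (lact p.1.1 p.1.2, p.1.2)
  -- the right action of `H`
  src_ract : ∀ {t : T} {h : H}, src t = TopGroupoid.rng h →
    src (ract t h) = TopGroupoid.src h
  ract_mul : ∀ {t : T} {h k : H}, src t = TopGroupoid.rng h →
    TopGroupoid.src h = TopGroupoid.rng k → ract t (h * k) = ract (ract t h) k
  ract_unit : ∀ t : T, ract t (src t : H) = t
  continuous_ract : Continuous
    fun p : {p : T × H // src p.1 = TopGroupoid.rng p.2} => ract p.1.1 p.1.2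
  free_ract : ∀ {t : T} {h : H}, src t = TopGroupoid.rng h → ract t h = t → h = (src t : H)
  proper_ract : IsProperMap
    fun p : {p : T × H // src p.1 = TopGroupoid.rng p.2} => (p.1.1, ract p.1.1 p.1.2)
  -- the actions commute
  src_lact : ∀ {x : G} {t : T}, TopGroupoid.src x = rng t → src (lact x t) = src t
  rng_ract : ∀ {t : T} {h : H}, src t = TopGroupoid.rng h → rng (ract t h) = rng t
  lact_ract : ∀ {x : G} {t : T} {h : H}, TopGroupoid.src x = rng t →
    src t = TopGroupoid.rng h → lact x (ract t h) = ract (lact x t) h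
  -- the orbit spaces
  surjective_rng : Function.Surjective rng
  exists_ract : ∀ {t t' : T}, rng t = rng t' →
    ∃ h : H, src t = TopGroupoid.rng h ∧ ract t h = t'
  surjective_src : Function.Surjective src
  exists_lact : ∀ {t t' : T}, src t = src t' →
    ∃ x : G, TopGroupoid.src x = rng t' ∧ lact x t' = t

namespace GroupoidEquivalence

variable {G H T : Type*} [TopologicalSpace G] [TopGroupoid G]
  [TopologicalSpace H] [TopGroupoid H] [TopologicalSpace T] (Z : GroupoidEquivalence G H T)

/-- `[t, t']_G`: the (unique) `x ∈ G` with `x · t' = t`, where `s(t) = s(t')`. -/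
noncomputable def leftBracket {t t' : T} (h : Z.src t = Z.src t') : G :=
  Classical.choose (Z.exists_lact h)

theorem leftBracket_spec {t t' : T} (h : Z.src t = Z.src t') :
    TopGroupoid.src (Z.leftBracket h) = Z.rng t' ∧ Z.lact (Z.leftBracket h) t' = t :=
  Classical.choose_spec (Z.exists_lact h)

/-- `[t, t']_H`: the (unique) `h ∈ H` with `t · h = t'`, where `r(t) = r(t')`. -/
noncomputable def rightBracket {t t' : T} (h : Z.rng t = Z.rng t') : H :=
  Classical.choose (Z.exists_ract h)

theorem rightBracket_spec {t t' : T} (h : Z.rng t = Z.rng t') :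
    Z.src t = TopGroupoid.rng (Z.rightBracket h) ∧ Z.ract t (Z.rightBracket h) = t' :=
  Classical.choose_spec (Z.exists_ract h)

theorem comp_inv_lact {x : G} {t : T} (h : TopGroupoid.rng x = Z.rng t) :
    TopGroupoid.src x = Z.rng (Z.lact x⁻¹ t) := by
  rw [Z.rng_lact (by rw [TopGroupoid.src_inv, h]), TopGroupoid.rng_inv]

theorem lact_inv_lact {x : G} {t : T} (h : TopGroupoid.rng x = Z.rng t) :
    Z.lact x (Z.lact x⁻¹ t) = t := by
  rw [← Z.mul_lact (TopGroupoid.rng_inv x).symm (by rw [TopGroupoid.src_inv, h]),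
    TopGroupoid.mul_inv_self, h, Z.unit_lact]

theorem src_eq_rng_ract {x : G} {t : T} {h : H} (hxt : TopGroupoid.src x = Z.rng t)
    (hth : Z.src t = TopGroupoid.rng h) : TopGroupoid.src x = Z.rng (Z.ract t h) := by
  rw [Z.rng_ract hth, hxt]

end GroupoidEquivalence

/-! ### Upper semicontinuous Banach bundles and their sections -/

/-- The total space of a family of fibres `A x`, `x : X`; its topology is part of the data of a
bundle and is unrelated to any disjoint union topology. -/
structure Tot {X : Type*} (A : X → Type*) where
  base : X
  val : A base

/-- An upper semicontinuous Banach bundle over `X`, with enough sections. -/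
class UscBanachBundle {X : Type*} [TopologicalSpace X] (A : X → Type*)
    [∀ x, NormedAddCommGroup (A x)] [∀ x, NormedSpace ℂ (A x)] [∀ x, CompleteSpace (A x)]
    [TopologicalSpace (Tot A)] : Prop where
  continuous_base : Continuous (Tot.base : Tot A → X)
  isOpenMap_base : IsOpenMap (Tot.base : Tot A → X)
  isClosed_le_norm : ∀ ε : ℝ, 0 < ε → IsClosed {a : Tot A | ε ≤ ‖a.val‖}
  continuous_add : Continuous fun p : {p : Tot A × Tot A // p.1.base = p.2.base} =>
    (⟨p.1.2.base, (p.2 ▸ p.1.1.val) + p.1.2.val⟩ : Tot A)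
  continuous_smul : ∀ c : ℂ, Continuous fun a : Tot A => (⟨a.base, c • a.val⟩ : Tot A)
  tendsto_zero : ∀ (x : X) (l : Filter (Tot A)), Tendsto Tot.base l (𝓝 x) →
    Tendsto (fun a : Tot A => ‖a.val‖) l (𝓝 0) → l ≤ 𝓝 (⟨x, 0⟩ : Tot A)
  enough_sections : ∀ (x : X) (a : A x), ∃ f : ∀ y, A y,
    Continuous (fun y => (⟨y, f y⟩ : Tot A)) ∧ f x = a

section Sections

variable {X : Type*} [TopologicalSpace X] (A : X → Type*)
  [∀ x, NormedAddCommGroup (A x)] [∀ x, NormedSpace ℂ (A x)] [∀ x, CompleteSpace (A x)]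
  [TopologicalSpace (Tot A)]

/-- `f` is a continuous section vanishing at infinity. -/
def IsC0Section (f : ∀ x, A x) : Prop :=
  Continuous (fun x => (⟨x, f x⟩ : Tot A)) ∧ ∀ ε : ℝ, 0 < ε → IsCompact {x | ε ≤ ‖f x‖}

/-- The Banach space `Γ₀(X; A)` (with the supremum norm) is separable. -/
def SeparableSections : Prop :=
  ∃ d : ℕ → ∀ x, A x, (∀ n, IsC0Section A (d n)) ∧
    ∀ f : ∀ x, A x, IsC0Section A f → ∀ ε : ℝ, 0 < ε → ∃ n, ∀ x, ‖f x - d n x‖ ≤ ε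

/-- `Γ_c(X; A)`, the vector space of continuous compactly supported sections. -/
def SectionsCc [UscBanachBundle A] : Submodule ℂ (∀ x, A x) where
  carrier := {f | Continuous (fun x => (⟨x, f x⟩ : Tot A)) ∧ IsCompact (closure {x | f x ≠ 0})}
  zero_mem' := by
    refine ⟨continuous_iff_continuousAt.2 fun x => ?_, by simp⟩
    refine UscBanachBundle.tendsto_zero x _ ?_ ?_
    · exact tendsto_map'_iff.2 tendsto_id
    · refine tendsto_map'_iff.2 ?_
      have : ((fun a : Tot A => ‖a.val‖) ∘ fun x => (⟨x, (0 : ∀ x, A x) x⟩ : Tot A))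
          = fun _ => (0 : ℝ) := by
        funext y; simp
      rw [this]; exact tendsto_const_nhds
  add_mem' := by
    rintro f g ⟨hf, hf'⟩ ⟨hg, hg'⟩
    refine ⟨?_, ?_⟩
    · exact (UscBanachBundle.continuous_add (A := A)).comp
        (Continuous.subtype_mk (hf.prodMk hg) fun _ => rfl)
    · refine (hf'.union hg').of_isClosed_subset isClosed_closure ?_
      rw [← closure_union]
      refine closure_mono fun x hx => ?_
      by_contra h
      simp only [Set.mem_union, Set.mem_ofPred_eq, not_or, not_not] at h
      exact hx (by simp [h.1, h.2])
  smul_mem' := by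
    rintro c f ⟨hf, hf'⟩
    refine ⟨(UscBanachBundle.continuous_smul (A := A) c).comp hf, ?_⟩
    refine hf'.of_isClosed_subset isClosed_closure (closure_mono fun x hx h => hx ?_)
    simp [h]

/-- The inductive limit topology on `Γ_c(X; A)`: the finest locally convex vector space topology
for which all the inclusions of the normed spaces `Γ_K(X; A)` are continuous, where `Γ_K(X; A)` is
the space of the sections that vanish off the compact set `K`, with the supremum norm.  (Continuity
of a linear map is expressed as continuity at `0`.) -/
@[reducible]
def inductiveLimitTopology [UscBanachBundle A] : TopologicalSpace (SectionsCc A) :=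
  sInf {τ | @IsTopologicalAddGroup (SectionsCc A) τ _ ∧
    @ContinuousSMul ℂ (SectionsCc A) _ _ τ ∧
    @LocallyConvexSpace ℝ (SectionsCc A) _ _ _ _ τ ∧
    ∀ K : Set X, IsCompact K → ∀ V ∈ @nhds (SectionsCc A) τ 0, ∃ ε : ℝ, 0 < ε ∧
      ∀ f : SectionsCc A, (∀ x, x ∉ K → f.1 x = 0) → (∀ x, ‖f.1 x‖ ≤ ε) → f ∈ V}

variable {A}

/-- The functions `F i` are sections in `Γ_c(X; A)`, and they converge to `f ∈ Γ_c(X; A)` along `l`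
in the inductive limit topology. -/
def TendstoILT [UscBanachBundle A] {ι : Type*} (l : Filter ι) (F : ι → ∀ x, A x)
    (f : SectionsCc A) : Prop :=
  ∃ g : ι → SectionsCc A, (∀ i x, (g i).1 x = F i x) ∧
    Tendsto g l (@nhds (SectionsCc A) (inductiveLimitTopology A) f)

end Sections

/-! ### Imprimitivity bimodules and Fell bundles -/

/-- `X`, with the given actions and inner products, is an `A`–`C`-imprimitivity bimodule for the
`C*`-algebras `A` and `C`; the norm of the Banach space `X` is that of the Hilbert modules. -/
structure IsImprimitivityBimodule {A X C : Type*} [NonUnitalCStarAlgebra A]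
    [NonUnitalCStarAlgebra C] [NormedAddCommGroup X] [NormedSpace ℂ X]
    (actL : A → X → X) (actR : X → C → X) (ipL : X → X → A) (ipR : X → X → C) : Prop where
  -- `X` is an `A`–`C`-bimodule
  actL_add : ∀ a x y, actL a (x + y) = actL a x + actL a y
  add_actL : ∀ a b x, actL (a + b) x = actL a x + actL b x
  actL_smul : ∀ (k : ℂ) a x, actL a (k • x) = k • actL a x
  smul_actL : ∀ (k : ℂ) a x, actL (k • a) x = k • actL a x
  mul_actL : ∀ a b x, actL (a * b) x = actL a (actL b x)
  add_actR : ∀ x y c, actR (x + y) c = actR x c + actR y c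
  actR_add : ∀ x c d, actR x (c + d) = actR x c + actR x d
  smul_actR : ∀ (k : ℂ) x c, actR (k • x) c = k • actR x c
  actR_smul : ∀ (k : ℂ) x c, actR x (k • c) = k • actR x c
  actR_mul : ∀ x c d, actR x (c * d) = actR (actR x c) d
  actL_actR : ∀ a x c, actR (actL a x) c = actL a (actR x c)
  -- `X` is a full left Hilbert `A`-module
  ipL_add : ∀ x y z, ipL (x + y) z = ipL x z + ipL y z
  ipL_smul : ∀ (k : ℂ) x y, ipL (k • x) y = k • ipL x y
  ipL_actL : ∀ a x y, ipL (actL a x) y = a * ipL x y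
  ipL_star : ∀ x y, star (ipL x y) = ipL y x
  ipL_pos : ∀ x, ∃ a : A, ipL x x = star a * a
  ipL_norm : ∀ x, ‖ipL x x‖ = ‖x‖ ^ 2
  ipL_full : Dense (Submodule.span ℂ {a : A | ∃ x y, ipL x y = a} : Set A)
  -- `X` is a full right Hilbert `C`-module
  ipR_add : ∀ x y z, ipR x (y + z) = ipR x y + ipR x z
  ipR_smul : ∀ (k : ℂ) x y, ipR x (k • y) = k • ipR x y
  ipR_actR : ∀ x y c, ipR x (actR y c) = ipR x y * c
  ipR_star : ∀ x y, star (ipR x y) = ipR y x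
  ipR_pos : ∀ x, ∃ c : C, ipR x x = star c * c
  ipR_norm : ∀ x, ‖ipR x x‖ = ‖x‖ ^ 2
  ipR_full : Dense (Submodule.span ℂ {c : C | ∃ x y, ipR x y = c} : Set C)
  -- compatibility
  ipR_actL : ∀ a x y, ipR (actL a x) y = ipR x (actL (star a) y)
  ipL_actR : ∀ c x y, ipL (actR x c) y = ipL x (actR y (star c))
  ipL_ipR : ∀ x y z, actL (ipL x y) z = actR x (ipR y z)

section Fell

variable {G : Type*} [TopologicalSpace G] [TopGroupoid G]

/-- The multiplication and the involution of a Fell bundle, with the `C*`-algebras over the units;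
the imprimitivity bimodule axiom is added in `FellBundle`.  Instead of a map on composable pairs
covering the multiplication of `G`, the multiplication is given by bilinear maps
`B x × B y → B z`, one for each composable pair `(x, y)` with `x y = z`; similarly the involution
is given by the conjugate linear maps `B x → B z` with `x⁻¹ = z`. -/
class FellStructure (B : G → Type*)
    [∀ x, NormedAddCommGroup (B x)] [∀ x, NormedSpace ℂ (B x)] [∀ x, CompleteSpace (B x)]
    [TopologicalSpace (Tot B)] extends UscBanachBundle B where
  bmul : ∀ {x y z : G}, src x = rng y → x * y = z → B x →ₗ[ℂ] B y →ₗ[ℂ] B z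
  bstar : ∀ {x z : G}, x⁻¹ = z → B x →ₗ⋆[ℂ] B z
  continuous_bmul : Continuous fun p : {p : Tot B × Tot B // src p.1.base = rng p.2.base} =>
    (⟨p.1.1.base * p.1.2.base, bmul p.2 rfl p.1.1.val p.1.2.val⟩ : Tot B)
  continuous_bstar : Continuous fun b : Tot B => (⟨b.base⁻¹, bstar rfl b.val⟩ : Tot B)
  bmul_assoc : ∀ {x y z xy yz w : G} (h₁ : src x = rng y) (h₁' : x * y = xy)
    (h₂ : src y = rng z) (h₂' : y * z = yz) (h₃ : src xy = rng z) (h₃' : xy * z = w)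
    (h₄ : src x = rng yz) (h₄' : x * yz = w) (a : B x) (b : B y) (c : B z),
    bmul h₃ h₃' (bmul h₁ h₁' a b) c = bmul h₄ h₄' a (bmul h₂ h₂' b c)
  bstar_bstar : ∀ {x z : G} (h : x⁻¹ = z) (h' : z⁻¹ = x) (a : B x), bstar h' (bstar h a) = a
  bstar_bmul : ∀ {x y z x' y' z' : G} (h : src x = rng y) (h' : x * y = z)
    (hx : x⁻¹ = x') (hy : y⁻¹ = y') (hz : z⁻¹ = z') (k : src y' = rng x') (k' : y' * x' = z')
    (a : B x) (b : B y),
    bstar hz (bmul h h' a b) = bmul k k' (bstar hy b) (bstar hx a)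
  norm_bmul_le : ∀ (u : unitSpace G) (a b : B (u : G)),
    ‖bmul (src_unit_eq_rng u) (unit_mul_unit u) a b‖ ≤ ‖a‖ * ‖b‖
  norm_bstar_bmul_self : ∀ (u : unitSpace G) (a : B (u : G)),
    ‖bmul (src_unit_eq_rng u) (unit_mul_unit u) (bstar (unit_inv u) a) a‖ = ‖a‖ * ‖a‖

variable (B : G → Type*)
    [∀ x, NormedAddCommGroup (B x)] [∀ x, NormedSpace ℂ (B x)] [∀ x, CompleteSpace (B x)]
    [TopologicalSpace (Tot B)]

/-- The `C*`-algebra `B(u)` over a unit `u`. -/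
@[reducible]
def FellStructure.cstarAlgebra [FellStructure B] (u : unitSpace G) :
    NonUnitalCStarAlgebra (B (u : G)) where
  toAddCommGroup := (inferInstance : NormedAddCommGroup (B (u : G))).toAddCommGroup
  toNorm := (inferInstance : NormedAddCommGroup (B (u : G))).toNorm
  toMetricSpace := (inferInstance : NormedAddCommGroup (B (u : G))).toMetricSpace
  dist_eq := (inferInstance : NormedAddCommGroup (B (u : G))).dist_eq
  toModule := (inferInstance : NormedSpace ℂ (B (u : G))).toModule
  norm_smul_le := NormedSpace.norm_smul_le
  complete := CompleteSpace.complete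
  mul a b := bmul (src_unit_eq_rng u) (unit_mul_unit u) a b
  left_distrib a b c := map_add _ _ _
  right_distrib a b c := by
    change bmul _ _ (a + b) c = bmul _ _ a c + bmul _ _ b c
    rw [map_add, LinearMap.add_apply]
  zero_mul a := by
    change bmul _ _ (0 : B (u : G)) a = 0
    rw [map_zero, LinearMap.zero_apply]
  mul_zero a := map_zero _
  mul_assoc a b c := bmul_assoc _ _ _ _ _ _ _ _ a b c
  norm_mul_le a b := norm_bmul_le u a b
  star a := bstar (unit_inv u) a
  star_involutive a := bstar_bstar _ _ a
  star_mul a b := bstar_bmul _ _ _ _ _ _ _ a b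
  star_add a b := map_add _ _ _
  norm_mul_self_le a := (norm_bstar_bmul_self u a).ge
  smul_assoc k a b := by
    change bmul _ _ (k • a) b = k • bmul _ _ a b
    rw [map_smul, LinearMap.smul_apply]
  smul_comm k a b := by
    change k • bmul _ _ a b = bmul _ _ a (k • b)
    rw [map_smul]
  star_smul k a := by
    change bstar _ (k • a) = star k • bstar _ a
    rw [LinearMap.map_smulₛₗ]; rfl

/-- A (separable) Fell bundle over `G`. -/
class FellBundle extends FellStructure B where
  separable : SeparableSections B
  imprimitivity : ∀ x : G,
    letI := FellStructure.cstarAlgebra B (rng x)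
    letI := FellStructure.cstarAlgebra B (src x)
    IsImprimitivityBimodule (A := B (rng x : G)) (X := B x) (C := B (src x : G))
      (fun a b => bmul (src_unit (rng x)) (rng_mul_self x) a b)
      (fun b c => bmul (rng_unit (src x)).symm (self_mul_src x) b c)
      (fun a b => bmul (rng_inv x).symm (mul_inv_self x) a (bstar rfl b))
      (fun a b => bmul (src_inv x) (inv_mul_self x) (bstar rfl a) b)

end Fell

/-! ### Equivalences of Fell bundles -/

section Equivalence

variable {G H T : Type*} [TopologicalSpace G] [TopGroupoid G]
  [TopologicalSpace H] [TopGroupoid H] [TopologicalSpace T] (Z : GroupoidEquivalence G H T)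
  (B : G → Type*) [∀ x, NormedAddCommGroup (B x)] [∀ x, NormedSpace ℂ (B x)]
  [∀ x, CompleteSpace (B x)] [TopologicalSpace (Tot B)] [FellBundle B]
  (C : H → Type*) [∀ h, NormedAddCommGroup (C h)] [∀ h, NormedSpace ℂ (C h)]
  [∀ h, CompleteSpace (C h)] [TopologicalSpace (Tot C)] [FellBundle C]
  (E : T → Type*) [∀ t, NormedAddCommGroup (E t)] [∀ t, NormedSpace ℂ (E t)]
  [∀ t, CompleteSpace (E t)] [TopologicalSpace (Tot E)] [UscBanachBundle E]

/-- `E → T` is a `B`–`C`-equivalence, where `T` is a `(G, H)`-equivalence.  As in `FellStructure`,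
the actions and the inner products are given fibre by fibre: `lact` is `B x × E t → E (x t)`,
`ract` is `E t × C h → E (t h)`, `lip` is `E t × E t' → B x` with `x = [t, t']_G`, that is
`x t' = t`, and `rip` is `E t × E t' → C h` with `h = [t, t']_H`, that is `t h = t'`. -/
structure FellEquivalence where
  lact : ∀ {x : G} {t t' : T}, src x = Z.rng t → Z.lact x t = t' →
    B x →ₗ[ℂ] E t →ₗ[ℂ] E t'
  ract : ∀ {t t' : T} {h : H}, Z.src t = rng h → Z.ract t h = t' →
    E t →ₗ[ℂ] C h →ₗ[ℂ] E t'
  lip : ∀ {t t' : T} {x : G}, src x = Z.rng t' → Z.lact x t' = t →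
    E t →ₗ[ℂ] E t' →ₗ⋆[ℂ] B x
  rip : ∀ {t t' : T} {h : H}, Z.src t = rng h → Z.ract t h = t' →
    E t →ₗ⋆[ℂ] E t' →ₗ[ℂ] C h
  -- continuity
  continuous_lact : Continuous
    fun p : {p : Tot B × Tot E // src p.1.base = Z.rng p.2.base} =>
      (⟨Z.lact p.1.1.base p.1.2.base, lact p.2 rfl p.1.1.val p.1.2.val⟩ : Tot E)
  continuous_ract : Continuous
    fun p : {p : Tot E × Tot C // Z.src p.1.base = rng p.2.base} =>
      (⟨Z.ract p.1.1.base p.1.2.base, ract p.2 rfl p.1.1.val p.1.2.val⟩ : Tot E)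
  continuous_lip : Continuous
    fun p : {p : Tot E × Tot E // Z.src p.1.base = Z.src p.2.base} =>
      (⟨Z.leftBracket p.2, lip (Z.leftBracket_spec p.2).1 (Z.leftBracket_spec p.2).2
        p.1.1.val p.1.2.val⟩ : Tot B)
  continuous_rip : Continuous
    fun p : {p : Tot E × Tot E // Z.rng p.1.base = Z.rng p.2.base} =>
      (⟨Z.rightBracket p.2, rip (Z.rightBracket_spec p.2).1 (Z.rightBracket_spec p.2).2
        p.1.1.val p.1.2.val⟩ : Tot C)
  -- actions
  lact_lact : ∀ {x y xy : G} {t t' t'' : T} (h₁ : src y = Z.rng t) (h₁' : Z.lact y t = t')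
    (h₂ : src x = Z.rng t') (h₂' : Z.lact x t' = t'') (h₃ : src x = rng y) (h₃' : x * y = xy)
    (h₄ : src xy = Z.rng t) (h₄' : Z.lact xy t = t'') (a : B x) (b : B y) (e : E t),
    lact h₂ h₂' a (lact h₁ h₁' b e) = lact h₄ h₄' (FellStructure.bmul h₃ h₃' a b) e
  norm_lact_le : ∀ {x : G} {t t' : T} (h : src x = Z.rng t) (h' : Z.lact x t = t')
    (b : B x) (e : E t), ‖lact h h' b e‖ ≤ ‖b‖ * ‖e‖
  ract_ract : ∀ {h k hk : H} {t t' t'' : T} (h₁ : Z.src t = rng h) (h₁' : Z.ract t h = t')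
    (h₂ : Z.src t' = rng k) (h₂' : Z.ract t' k = t'') (h₃ : src h = rng k) (h₃' : h * k = hk)
    (h₄ : Z.src t = rng hk) (h₄' : Z.ract t hk = t'') (e : E t) (c : C h) (d : C k),
    ract h₂ h₂' (ract h₁ h₁' e c) d = ract h₄ h₄' e (FellStructure.bmul h₃ h₃' c d)
  norm_ract_le : ∀ {t t' : T} {h : H} (k : Z.src t = rng h) (k' : Z.ract t h = t')
    (e : E t) (c : C h), ‖ract k k' e c‖ ≤ ‖e‖ * ‖c‖
  lact_ract : ∀ {x : G} {t xt th w : T} {h : H} (h₁ : Z.src t = rng h) (h₁' : Z.ract t h = th)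
    (h₂ : src x = Z.rng th) (h₂' : Z.lact x th = w) (h₃ : src x = Z.rng t)
    (h₃' : Z.lact x t = xt) (h₄ : Z.src xt = rng h) (h₄' : Z.ract xt h = w)
    (b : B x) (e : E t) (c : C h),
    lact h₂ h₂' b (ract h₁ h₁' e c) = ract h₄ h₄' (lact h₃ h₃' b e) c
  -- inner products
  bstar_lip : ∀ {t t' : T} {x y : G} (h : src x = Z.rng t') (h' : Z.lact x t' = t)
    (k : src y = Z.rng t) (k' : Z.lact y t = t') (hxy : x⁻¹ = y) (e : E t) (f : E t'),
    FellStructure.bstar hxy (lip h h' e f) = lip k k' f e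
  bstar_rip : ∀ {t t' : T} {h k : H} (h₁ : Z.src t = rng h) (h₁' : Z.ract t h = t')
    (h₂ : Z.src t' = rng k) (h₂' : Z.ract t' k = t) (hk : h⁻¹ = k) (e : E t) (f : E t'),
    FellStructure.bstar hk (rip h₁ h₁' e f) = rip h₂ h₂' f e
  lip_lact : ∀ {x y z : G} {t t' xt : T} (h₁ : src x = Z.rng t) (h₁' : Z.lact x t = xt)
    (h₂ : src y = Z.rng t') (h₂' : Z.lact y t' = t) (h₃ : src z = Z.rng t')
    (h₃' : Z.lact z t' = xt) (h₄ : src x = rng y) (h₄' : x * y = z)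
    (b : B x) (e : E t) (f : E t'),
    lip h₃ h₃' (lact h₁ h₁' b e) f = FellStructure.bmul h₄ h₄' b (lip h₂ h₂' e f)
  rip_ract : ∀ {t t' t'' : T} {h k hk : H} (h₁ : Z.src t = rng h) (h₁' : Z.ract t h = t')
    (h₂ : Z.src t' = rng k) (h₂' : Z.ract t' k = t'') (h₃ : Z.src t = rng hk)
    (h₃' : Z.ract t hk = t'') (h₄ : src h = rng k) (h₄' : h * k = hk)
    (e : E t) (f : E t') (c : C k),
    rip h₃ h₃' e (ract h₂ h₂' f c) = FellStructure.bmul h₄ h₄' (rip h₁ h₁' e f) c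
  lip_lact_eq_ract_rip : ∀ {t t' t'' w : T} {x : G} {h : H} (h₁ : src x = Z.rng t')
    (h₁' : Z.lact x t' = t) (h₂ : src x = Z.rng t'') (h₂' : Z.lact x t'' = w)
    (h₃ : Z.src t' = rng h) (h₃' : Z.ract t' h = t'') (h₄ : Z.src t = rng h)
    (h₄' : Z.ract t h = w) (e : E t) (f : E t') (g : E t''),
    lact h₂ h₂' (lip h₁ h₁' e f) g = ract h₄ h₄' e (rip h₃ h₃' f g)
  -- the fibres
  imprimitivity : ∀ t : T,
    letI := FellStructure.cstarAlgebra B (Z.rng t)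
    letI := FellStructure.cstarAlgebra C (Z.src t)
    IsImprimitivityBimodule (A := B (Z.rng t : G)) (X := E t) (C := C (Z.src t : H))
      (fun b e => lact (src_unit (Z.rng t)) (Z.unit_lact t) b e)
      (fun e c => ract (rng_unit (Z.src t)).symm (Z.ract_unit t) e c)
      (fun e f => lip (src_unit (Z.rng t)) (Z.unit_lact t) e f)
      (fun e f => rip (rng_unit (Z.src t)).symm (Z.ract_unit t) e f)

end Equivalence

/-! ### The operations on sections -/

section Operations

open Classical in
/-- Convolution: `(f * g)(x) = ∫ f(y) g(y⁻¹ x) dλ^{r(x)}(y)`; note that `λ^{r(x)}` is concentrated on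
the `y` with `r(y) = r(x)`. -/
noncomputable def fellConvolution {G : Type*} [TopologicalSpace G] [TopGroupoid G]
    [MeasurableSpace G] (μ : HaarSystem G) {B : G → Type*} [∀ x, NormedAddCommGroup (B x)]
    [∀ x, NormedSpace ℂ (B x)] [∀ x, CompleteSpace (B x)] [TopologicalSpace (Tot B)]
    [FellBundle B] (f g : ∀ x, B x) (x : G) : B x :=
  ∫ y, (if h : rng y = rng x then
      FellStructure.bmul (comp_inv_mul h) (mul_inv_mul h) (f y) (g (y⁻¹ * x))
    else 0) ∂(μ.meas (rng x))

variable {G H T : Type*} [TopologicalSpace G] [TopGroupoid G]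
  [TopologicalSpace H] [TopGroupoid H] [TopologicalSpace T] {Z : GroupoidEquivalence G H T}
  {B : G → Type*} [∀ x, NormedAddCommGroup (B x)] [∀ x, NormedSpace ℂ (B x)]
  [∀ x, CompleteSpace (B x)] [TopologicalSpace (Tot B)] [FellBundle B]
  {C : H → Type*} [∀ h, NormedAddCommGroup (C h)] [∀ h, NormedSpace ℂ (C h)]
  [∀ h, CompleteSpace (C h)] [TopologicalSpace (Tot C)] [FellBundle C]
  {E : T → Type*} [∀ t, NormedAddCommGroup (E t)] [∀ t, NormedSpace ℂ (E t)]
  [∀ t, CompleteSpace (E t)] [TopologicalSpace (Tot E)] [UscBanachBundle E]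

namespace FellEquivalence

open Classical in
/-- The left action `(f · ξ)(t) = ∫ f(x) · ξ(x⁻¹ t) dλ_G^{r(t)}(x)`. -/
noncomputable def sectionAction (X : FellEquivalence Z B C E) [MeasurableSpace G]
    (μ : HaarSystem G) (f : ∀ x, B x) (ξ : ∀ t, E t) (t : T) : E t :=
  ∫ x, (if h : rng x = Z.rng t then
      X.lact (Z.comp_inv_lact h) (Z.lact_inv_lact h) (f x) (ξ (Z.lact x⁻¹ t))
    else 0) ∂(μ.meas (Z.rng t))

open Classical in
/-- The inner product `⟪ξ, η⟫(x) = ∫ ⟨ξ(x t h), η(t h)⟩_B dλ_H^{s(t)}(h)`, computed with a point `t`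
such that `r(t) = s(x)`. -/
noncomputable def sectionInner (X : FellEquivalence Z B C E) [MeasurableSpace H]
    (ν : HaarSystem H) (ξ η : ∀ t, E t) (x : G) (t : T) (hxt : src x = Z.rng t) : B x :=
  ∫ h, (if hth : Z.src t = rng h then
      X.lip (Z.src_eq_rng_ract hxt hth) rfl (ξ (Z.lact x (Z.ract t h))) (η (Z.ract t h))
    else 0) ∂(ν.meas (Z.src t))

end FellEquivalence

end Operations

set_option linter.unusedSectionVars false

/-! ### Convergence in upper semicontinuous Banach bundles -/

namespace UscBanachBundle

variable {X : Type*} [TopologicalSpace X] {A : X → Type*}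
  [∀ x, NormedAddCommGroup (A x)] [∀ x, NormedSpace ℂ (A x)] [∀ x, CompleteSpace (A x)]
  [TopologicalSpace (Tot A)] [UscBanachBundle A] {Y : Type*} {l : Filter Y} {q : Y → X} {x₀ : X}

/-! Let r(τ) = r(t). The action of ⟪ξ, ξ⟫ on a section η at t is the double integral over x ∈ G and
h ∈ H of ⟨ξ(τh), ξ(x⁻¹τh)⟩ · η(x⁻¹t). The approximate identity is a finite sum of such elements with
ξ = w_i ζ_ij, where the scalar w_i is supported near a point t_i and the ζ_ij are continuous
sections. Then e · η integrates the kernel w_i(τh) w_i(x⁻¹τh) against the vectors Σ_j ⟨ζ_ij(τh),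
ζ_ij(x⁻¹τh)⟩ · η(x⁻¹t), and two independent tasks remain.

Vectors. In the imprimitivity bimodule E(t₀), functional calculus gives sums Σ_j ⟨ζ_j, ζ_j⟩ of norm
at most 1 that almost fix any finite subset of B(r(t₀))
(`IsImprimitivityBimodule.exists_approx_unit`). For a suitable finite subset, such contractions
almost fix all values of a given η over that unit, because the support of η meets this fibre in a
compact set (`exists_finset_norm_sub_lact_le`). After the ζ_j are extended to continuous sections,
upper semicontinuity of the norm, together with freeness and properness of the action, shows that
Σ_j ⟨ζ_j(xτ), ζ_j(τ)⟩ almost carries η(t) to η(xt) whenever τ and xτ are close to t₀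
(`exists_nhds_norm_sub_lact_lt`).

Scalars. The kernel Σ_i w_i(τh) w_i(x⁻¹τh) must have total mass almost 1 over the supports in
question, while each w_i lives in a prescribed neighbourhood (`exists_kernel`). It is built from a
cut-off ρ with ∫ ρ(τh)² = 1 along H-orbits, a fine partition of unity φ_i, and a division by the
square root of the almost G-orbital mass of φ_i.

Together these bound the error by a small multiple of the mass (`norm_sectionAction_sub_le`,
`exists_approx`). Convolution e * f is the action of e in the equivalence of B with itself over T' =
G. The estimates are therefore stated for the action on a second equivalence E' over T', so that one
e serves both kinds of sections. The net is indexed by finite sets of sections and a tolerance. For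
the two-sided statement one takes E = B: the elements ⟪ξ, ξ⟫ are self-adjoint, and f * e = (e *
f^*)^*. -/

theorem tendsto_base {f : ∀ y, A (q y)} {a : A x₀}
    (hf : Tendsto (fun y => (⟨q y, f y⟩ : Tot A)) l (𝓝 ⟨x₀, a⟩)) : Tendsto q l (𝓝 x₀) :=
  (continuous_base (A := A)).continuousAt.tendsto.comp hf

theorem tendsto_add {f g : ∀ y, A (q y)} {a b : A x₀}
    (hf : Tendsto (fun y => (⟨q y, f y⟩ : Tot A)) l (𝓝 ⟨x₀, a⟩))
    (hg : Tendsto (fun y => (⟨q y, g y⟩ : Tot A)) l (𝓝 ⟨x₀, b⟩)) :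
    Tendsto (fun y => (⟨q y, f y + g y⟩ : Tot A)) l (𝓝 ⟨x₀, a + b⟩) := by
  have h := (continuous_add (A := A)).continuousAt (x := ⟨(⟨x₀, a⟩, ⟨x₀, b⟩), rfl⟩)
  refine h.tendsto.comp (f := fun y => ⟨((⟨q y, f y⟩ : Tot A), (⟨q y, g y⟩ : Tot A)), rfl⟩) ?_
  exact tendsto_subtype_rng.2 (hf.prodMk_nhds hg)

theorem tendsto_const_smul (c : ℂ) {f : ∀ y, A (q y)} {a : A x₀}
    (hf : Tendsto (fun y => (⟨q y, f y⟩ : Tot A)) l (𝓝 ⟨x₀, a⟩)) :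
    Tendsto (fun y => (⟨q y, c • f y⟩ : Tot A)) l (𝓝 ⟨x₀, c • a⟩) :=
  (continuous_smul (A := A) c).continuousAt.tendsto.comp hf

theorem tendsto_sub {f g : ∀ y, A (q y)} {a b : A x₀}
    (hf : Tendsto (fun y => (⟨q y, f y⟩ : Tot A)) l (𝓝 ⟨x₀, a⟩))
    (hg : Tendsto (fun y => (⟨q y, g y⟩ : Tot A)) l (𝓝 ⟨x₀, b⟩)) :
    Tendsto (fun y => (⟨q y, f y - g y⟩ : Tot A)) l (𝓝 ⟨x₀, a - b⟩) := by
  have := tendsto_add hf (tendsto_const_smul (-1) hg)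
  simpa [sub_eq_add_neg] using this

theorem tendsto_zero' (hq : Tendsto q l (𝓝 x₀)) {f : ∀ y, A (q y)}
    (hf : Tendsto (fun y => ‖f y‖) l (𝓝 0)) :
    Tendsto (fun y => (⟨q y, f y⟩ : Tot A)) l (𝓝 ⟨x₀, 0⟩) :=
  tendsto_zero (A := A) x₀ _ (tendsto_map'_iff.2 hq) (tendsto_map'_iff.2 hf)

theorem tendsto_sum {ι : Type*} (s : Finset ι) (hq : Tendsto q l (𝓝 x₀))
    {f : ι → ∀ y, A (q y)} {a : ι → A x₀}
    (hf : ∀ i ∈ s, Tendsto (fun y => (⟨q y, f i y⟩ : Tot A)) l (𝓝 ⟨x₀, a i⟩)) :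
    Tendsto (fun y => (⟨q y, ∑ i ∈ s, f i y⟩ : Tot A)) l (𝓝 ⟨x₀, ∑ i ∈ s, a i⟩) := by
  classical
  induction s using Finset.induction_on with
  | empty => simpa using tendsto_zero' (A := A) hq (f := fun _ => 0) (by simpa using tendsto_const_nhds)
  | insert i s hi ih =>
    simp only [Finset.sum_insert hi]
    exact tendsto_add (hf i (Finset.mem_insert_self _ _))
      (ih fun j hj => hf j (Finset.mem_insert_of_mem hj))

theorem eventually_norm_lt {f : ∀ y, A (q y)} {a : A x₀} {ε : ℝ}
    (hf : Tendsto (fun y => (⟨q y, f y⟩ : Tot A)) l (𝓝 ⟨x₀, a⟩)) (ha : ‖a‖ < ε) :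
    ∀ᶠ y in l, ‖f y‖ < ε := by
  have hε : 0 < ε := (norm_nonneg a).trans_lt ha
  have := (isClosed_le_norm (A := A) ε hε).isOpen_compl.mem_nhds
    (x := ⟨x₀, a⟩) (by simpa using ha)
  filter_upwards [hf this] with y hy
  simpa using hy

theorem tendsto_norm_zero {f : ∀ y, A (q y)}
    (hf : Tendsto (fun y => (⟨q y, f y⟩ : Tot A)) l (𝓝 ⟨x₀, 0⟩)) :
    Tendsto (fun y => ‖f y‖) l (𝓝 0) := by
  rw [Metric.tendsto_nhds]
  intro ε hε
  filter_upwards [eventually_norm_lt hf (by simpa using hε)] with y hy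
  simpa using hy

theorem tendsto_of_tendsto_norm_sub {f g : ∀ y, A (q y)} {a : A x₀}
    (hg : Tendsto (fun y => (⟨q y, g y⟩ : Tot A)) l (𝓝 ⟨x₀, a⟩))
    (h : Tendsto (fun y => ‖f y - g y‖) l (𝓝 0)) :
    Tendsto (fun y => (⟨q y, f y⟩ : Tot A)) l (𝓝 ⟨x₀, a⟩) := by
  simpa using tendsto_add (tendsto_zero' (tendsto_base hg) h) hg

/-- Vectors in different fibres cannot be subtracted; a continuous section through the limit
supplies the term of comparison in each fibre. -/
theorem exists_tendsto_section (hq : Tendsto q l (𝓝 x₀)) (a : A x₀) :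
    ∃ s : ∀ x, A x, s x₀ = a ∧ Continuous (fun x => (⟨x, s x⟩ : Tot A)) ∧
      Tendsto (fun y => (⟨q y, s (q y)⟩ : Tot A)) l (𝓝 ⟨x₀, a⟩) := by
  obtain ⟨s, hs, rfl⟩ := enough_sections x₀ a
  exact ⟨s, rfl, hs, hs.continuousAt.tendsto.comp hq⟩

/-- A family that is locally uniformly approximated by convergent ones converges. -/
theorem tendsto_of_approx (hq : Tendsto q l (𝓝 x₀)) {f : ∀ y, A (q y)} {a : A x₀}
    (h : ∀ δ : ℝ, 0 < δ → ∃ (g : ∀ y, A (q y)) (b : A x₀),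
      Tendsto (fun y => (⟨q y, g y⟩ : Tot A)) l (𝓝 ⟨x₀, b⟩) ∧ ‖b - a‖ ≤ δ ∧
      ∀ᶠ y in l, ‖f y - g y‖ ≤ δ) :
    Tendsto (fun y => (⟨q y, f y⟩ : Tot A)) l (𝓝 ⟨x₀, a⟩) := by
  obtain ⟨s, hs, -, hsl⟩ := exists_tendsto_section hq a
  refine tendsto_of_tendsto_norm_sub hsl ?_
  rw [Metric.tendsto_nhds]
  intro ε hε
  -- At the limit ‖b − a‖ ≤ ε/4 < ε/2, and upper semicontinuity carries the strict bound to ‖g − s‖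
  -- < ε/2 nearby; ‖f − g‖ ≤ ε/4 is added to it.
  obtain ⟨g, b, hg, hb, hfg⟩ := h (ε / 4) (by positivity)
  have := eventually_norm_lt (tendsto_sub hg hsl) (ε := ε / 2) (by linarith)
  filter_upwards [this, hfg] with y h1 h2
  have : ‖f y - s (q y)‖ ≤ ‖f y - g y‖ + ‖g y - s (q y)‖ := norm_sub_le_norm_sub_add_norm_sub _ _ _
  simp only [dist_zero_right, norm_norm]
  linarith

/-- The bundle axioms only provide scaling by a fixed scalar. The remainder (c − c₀) f tends to 0
because ‖f‖ is eventually below ‖a‖ + 1. -/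
theorem tendsto_smul {c : Y → ℂ} {c₀ : ℂ} {f : ∀ y, A (q y)} {a : A x₀}
    (hc : Tendsto c l (𝓝 c₀))
    (hf : Tendsto (fun y => (⟨q y, f y⟩ : Tot A)) l (𝓝 ⟨x₀, a⟩)) :
    Tendsto (fun y => (⟨q y, c y • f y⟩ : Tot A)) l (𝓝 ⟨x₀, c₀ • a⟩) := by
  refine tendsto_of_tendsto_norm_sub (tendsto_const_smul c₀ hf) ?_
  have h1 : Tendsto (fun y => ‖c y - c₀‖ * (‖a‖ + 1)) l (𝓝 0) := by
    have := (tendsto_iff_norm_sub_tendsto_zero.1 hc).mul_const (‖a‖ + 1)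
    simpa using this
  refine squeeze_zero' (.of_forall fun _ => norm_nonneg _) ?_ h1
  filter_upwards [eventually_norm_lt hf (lt_add_one ‖a‖)] with y hy
  rw [← sub_smul, norm_smul]
  gcongr

/-- On a fibre, the topology of the total space is the norm topology. -/
theorem tendsto_fibre_iff {f : Y → A x₀} {a : A x₀} :
    Tendsto (fun y => (⟨x₀, f y⟩ : Tot A)) l (𝓝 ⟨x₀, a⟩) ↔ Tendsto f l (𝓝 a) := by
  obtain ⟨s, hs, -, hsl⟩ := exists_tendsto_section (l := l) (q := fun _ : Y => x₀)
    tendsto_const_nhds a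
  simp only [hs] at hsl
  rw [tendsto_iff_norm_sub_tendsto_zero]
  refine ⟨fun h => ?_, fun h => tendsto_of_tendsto_norm_sub (f := f) hsl h⟩
  have := tendsto_sub (f := f) h hsl
  simp only [sub_self] at this
  exact tendsto_norm_zero this

variable [TopologicalSpace Y]

theorem continuous_fibre_iff {f : Y → A x₀} :
    Continuous (fun y => (⟨x₀, f y⟩ : Tot A)) ↔ Continuous f := by
  simp only [continuous_iff_continuousAt, ContinuousAt, tendsto_fibre_iff]

theorem continuous_smul' {c : Y → ℂ} {f : ∀ y, A (q y)} (hc : Continuous c)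
    (hf : Continuous fun y => (⟨q y, f y⟩ : Tot A)) :
    Continuous fun y => (⟨q y, c y • f y⟩ : Tot A) :=
  continuous_iff_continuousAt.2 fun y =>
    tendsto_smul (hc.continuousAt (x := y)) (hf.continuousAt (x := y))

theorem continuous_sub' {f g : ∀ y, A (q y)}
    (hf : Continuous fun y => (⟨q y, f y⟩ : Tot A))
    (hg : Continuous fun y => (⟨q y, g y⟩ : Tot A)) :
    Continuous fun y => (⟨q y, f y - g y⟩ : Tot A) :=
  continuous_iff_continuousAt.2 fun y =>
    tendsto_sub (hf.continuousAt (x := y)) (hg.continuousAt (x := y))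

/-- An upper semicontinuous norm is locally bounded, though it need not be continuous, and the
support is compact. -/
theorem exists_bound (f : SectionsCc A) : ∃ M : ℝ, 0 ≤ M ∧ ∀ x, ‖f.1 x‖ ≤ M := by
  have key : ∀ x ∈ closure {x | f.1 x ≠ 0}, ∃ t ∈ 𝓝[closure {x | f.1 x ≠ 0}] x,
      ∃ M : ℝ, ∀ y ∈ t, ‖f.1 y‖ ≤ M := by
    intro x _
    have := eventually_norm_lt (q := id) (f.2.1.continuousAt (x := x)) (lt_add_one ‖f.1 x‖)
    exact ⟨_, mem_nhdsWithin_of_mem_nhds this, ‖f.1 x‖ + 1, fun y hy => le_of_lt hy⟩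
  obtain ⟨M, hM⟩ := f.2.2.induction_on (p := fun t => ∃ M : ℝ, ∀ y ∈ t, ‖f.1 y‖ ≤ M)
    ⟨0, by simp⟩ (fun s t hst ⟨M, h⟩ => ⟨M, fun y hy => h y (hst hy)⟩)
    (fun s t ⟨M, h⟩ ⟨N, k⟩ => ⟨max M N, fun y hy => hy.elim (fun hy => (h y hy).trans
      (le_max_left _ _)) (fun hy => (k y hy).trans (le_max_right _ _))⟩) key
  refine ⟨max M 0, le_max_right _ _, fun x => ?_⟩
  by_cases hx : f.1 x = 0
  · simp [hx]
  · exact (hM x (subset_closure hx)).trans (le_max_left _ _)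

/-- A criterion for convergence in the inductive limit topology. -/
theorem tendstoILT_of_uniform {ι : Type*} {l : Filter ι} {F : ι → ∀ x, A x} {f : SectionsCc A}
    (hF : ∀ i, F i ∈ SectionsCc A) (K : Set X) (hK : IsCompact K)
    (hFK : ∀ᶠ i in l, ∀ x, x ∉ K → F i x = 0) (hfK : ∀ x, x ∉ K → f.1 x = 0)
    (h : ∀ ε : ℝ, 0 < ε → ∀ᶠ i in l, ∀ x, ‖F i x - f.1 x‖ ≤ ε) :
    TendstoILT l F f := by
  refine ⟨fun i => ⟨F i, hF i⟩, fun _ _ => rfl, ?_⟩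
  -- In the order on topologies the finest one is the infimum, and convergence for an infimum means
  -- convergence for each member. Every member is a group topology, so neighbourhoods of 0 suffice.
  rw [inductiveLimitTopology, nhds_sInf]
  simp only [tendsto_iInf]
  rintro τ ⟨h1, -, -, h4⟩
  let := τ
  have := h1
  rw [← tendsto_sub_nhds_zero_iff]
  intro V hV
  obtain ⟨ε, hε, hV⟩ := h4 K hK V hV
  rw [mem_map]
  filter_upwards [hFK, h ε hε] with i hi1 hi2
  refine hV _ (fun x hx => ?_) hi2
  change F i x - f.1 x = 0
  rw [hi1 x hx, hfK x hx, sub_zero]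

end UscBanachBundle

/-! ### Haar systems: integration along the fibres -/

/-- A finite partition of unity on a compact set, subordinate to given neighbourhoods. -/
theorem exists_finite_partition {X : Type*} [TopologicalSpace X] [LocallyCompactSpace X] [T2Space X]
    {K : Set X} (hK : IsCompact K) (V : X → Set X) (hV : ∀ x ∈ K, V x ∈ 𝓝 x) :
    ∃ (s : Finset X) (φ : s → X → ℝ), (s : Set X) ⊆ K ∧ (∀ i, Continuous (φ i)) ∧
      (∀ i, HasCompactSupport (φ i)) ∧ (∀ i x, 0 ≤ φ i x) ∧ (∀ i x, φ i x ≠ 0 → x ∈ V i) ∧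
      (∀ x ∈ K, ∑ i, φ i x = 1) ∧ ∀ x, ∑ i, φ i x ≤ 1 := by
  obtain ⟨s, hsK⟩ := hK.elim_nhds_subcover' (fun x _ => interior (V x))
    (fun x hx => interior_mem_nhds.2 (hV x hx))
  classical
  refine ⟨s.image Subtype.val, ?_⟩
  obtain ⟨f, hf, hfc⟩ := PartitionOfUnity.exists_isSubordinate_of_locallyFinite_t2space hK
    (fun i : s.image (Subtype.val : K → X) => interior (V i)) (fun _ => isOpen_interior)
    (locallyFinite_of_finite _) (by
      intro x hx
      obtain ⟨y, hy, hxy⟩ := Set.mem_iUnion₂.1 (hsK hx)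
      exact Set.mem_iUnion.2 ⟨⟨y, Finset.mem_image_of_mem _ hy⟩, hxy⟩)
  refine ⟨fun i => f i, ?_, fun i => (f i).continuous, hfc, fun i => f.nonneg i, ?_, ?_, ?_⟩
  · intro x hx
    obtain ⟨y, -, rfl⟩ := Finset.mem_image.1 hx
    exact y.2
  · intro i x hx
    exact interior_subset (hf i (subset_closure hx))
  · intro x hx
    rw [← finsum_eq_sum_of_fintype]
    exact f.sum_eq_one hx
  · intro x
    rw [← finsum_eq_sum_of_fintype]
    exact f.sum_le_one x

namespace HaarSystem

theorem _root_.TopGroupoid.isClosed_fibre {H : Type*} [TopologicalSpace H] [TopGroupoid H]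
    [T2Space H] (u : unitSpace H) : IsClosed {h : H | rng h = u} :=
  isClosed_singleton.preimage continuous_rng

theorem _root_.TopGroupoid.continuousOn_mul_left {H : Type*} [TopologicalSpace H] [TopGroupoid H]
    (k : H) : ContinuousOn (fun h => k * h) {h : H | rng h = src k} := by
  rw [continuousOn_iff_continuous_domRestrict]
  exact (continuous_mul' (G := H)).comp
    (f := fun h : {h : H | rng h = src k} => ⟨(k, h.1), h.2.symm⟩) (by fun_prop)

theorem _root_.TopGroupoid.isCompact_mul_left_preimage {H : Type*} [TopologicalSpace H]
    [TopGroupoid H] [T2Space H] (k : H) {K : Set H} (hK : IsCompact K) :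
    IsCompact {h : H | rng h = src k ∧ k * h ∈ K} := by
  have : {h : H | rng h = src k ∧ k * h ∈ K} =
      (fun h => k⁻¹ * h) '' (K ∩ {h | rng h = src k⁻¹}) := by
    ext h
    simp only [Set.mem_ofPred_eq, Set.mem_image, Set.mem_inter_iff, src_inv]
    constructor
    · rintro ⟨h1, h2⟩
      refine ⟨k * h, ⟨h2, rng_mul h1.symm⟩, ?_⟩
      have := mul_inv_mul (x := h) (y := k⁻¹) (by rw [rng_inv, h1])
      rwa [inv_inv'] at this
    · rintro ⟨g, ⟨h1, h2⟩, rfl⟩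
      exact ⟨by rw [rng_mul (by rw [src_inv, h2]), rng_inv], by rwa [mul_inv_mul h2.symm]⟩
  rw [this]
  exact (hK.inter_right (isClosed_fibre _)).image_of_continuousOn
    ((continuousOn_mul_left k⁻¹).mono Set.inter_subset_right)

variable {H : Type*} [TopologicalSpace H] [TopGroupoid H] [MeasurableSpace H] (ν : HaarSystem H)

instance (u : unitSpace H) : IsFiniteMeasureOnCompacts (ν.meas u) := ⟨fun K hK => ν.lt_top u K hK⟩

theorem ae_rng (u : unitSpace H) : ∀ᵐ h ∂ν.meas u, rng h = u := by
  rw [ae_iff]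
  exact ν.null_compl u

theorem restrict_fibre (u : unitSpace H) : (ν.meas u).restrict {h | rng h = u} = ν.meas u :=
  Measure.restrict_eq_self_of_ae_mem (ν.ae_rng u)

variable [T2Space H] [BorelSpace H]

theorem aestronglyMeasurable [SecondCountableTopology H] {V : Type*} [NormedAddCommGroup V]
    {u : unitSpace H} {F : H → V} (hF : ContinuousOn F {h | rng h = u}) :
    AEStronglyMeasurable F (ν.meas u) := by
  rw [← ν.restrict_fibre u]
  exact hF.aestronglyMeasurable (isClosed_fibre u).measurableSet

theorem integrable [SecondCountableTopology H] {V : Type*} [NormedAddCommGroup V]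
    {u : unitSpace H} {F : H → V} (hF : ContinuousOn F {h | rng h = u}) {K : Set H}
    (hK : IsCompact K) (hFK : ∀ h, rng h = u → h ∉ K → F h = 0) :
    Integrable F (ν.meas u) := by
  have hc : IsCompact (K ∩ {h | rng h = u}) := hK.inter_right (isClosed_fibre u)
  have h1 : IntegrableOn F (K ∩ {h | rng h = u}) (ν.meas u) :=
    (hF.mono Set.inter_subset_right).integrableOn_compact hc
  refine IntegrableOn.integrable_of_ae_notMem_eq_zero h1 ?_
  filter_upwards [ν.ae_rng u] with h hh hn
  exact hFK h hh fun hk => hn ⟨hk, hh⟩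

theorem aemeasurable_mul_left (k : H) : AEMeasurable (fun h => k * h) (ν.meas (src k)) := by
  rw [← ν.restrict_fibre (src k)]
  exact (continuousOn_mul_left k).aemeasurable (isClosed_fibre _).measurableSet

variable [LocallyCompactSpace H] [SecondCountableTopology H]

/-- Left invariance says that the two measures integrate continuous compactly supported functions
alike; both are finite on compact sets, hence equal. Equality of measures makes invariance available
for vector-valued integrands that are continuous on a fibre only. -/
theorem map_mul_left (k : H) :
    (ν.meas (src k)).map (fun h => k * h) = ν.meas (rng k) := by
  have : IsFiniteMeasureOnCompacts ((ν.meas (src k)).map (fun h => k * h)) := ⟨fun K hK => by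
    rw [Measure.map_apply_of_aemeasurable (ν.aemeasurable_mul_left k) hK.measurableSet]
    refine lt_of_le_of_lt ?_ (ν.lt_top (src k) _ (isCompact_mul_left_preimage k hK))
    refine measure_mono_ae ?_
    filter_upwards [ν.ae_rng (src k)] with h hh hk
    exact ⟨hh, hk⟩⟩
  refine Measure.ext_of_integral_eq_on_compactlySupported fun f => ?_
  refine (integral_map (ν.aemeasurable_mul_left k) f.continuous.aestronglyMeasurable).trans ?_
  exact ν.left_invariant f f.continuous f.hasCompactSupport k

theorem integral_mul_left {V : Type*} [NormedAddCommGroup V] [NormedSpace ℝ V] (k : H) {F : H → V}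
    (hF : ContinuousOn F {h | rng h = rng k}) :
    ∫ h, F (k * h) ∂ν.meas (src k) = ∫ h, F h ∂ν.meas (rng k) := by
  rw [← ν.map_mul_left k, integral_map (ν.aemeasurable_mul_left k)]
  rw [ν.map_mul_left k]
  exact ν.aestronglyMeasurable hF

/-- Integration along the fibres of a continuous family of sections of a bundle is continuous. -/
theorem continuous_integral_bundle {X Y : Type*} [TopologicalSpace X] [TopologicalSpace Y]
    {A : X → Type*} [∀ x, NormedAddCommGroup (A x)] [∀ x, NormedSpace ℂ (A x)]
    [∀ x, CompleteSpace (A x)] [TopologicalSpace (Tot A)] [UscBanachBundle A]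
    {p : Y → unitSpace H} (hp : Continuous p) {q : Y → X} (hq : Continuous q)
    {F : ∀ y, H → A (q y)}
    (hF : Continuous fun z : {z : Y × H // p z.1 = rng z.2} =>
      (⟨q z.1.1, F z.1.1 z.1.2⟩ : Tot A))
    (hs : ∀ y₀, ∃ N ∈ 𝓝 y₀, ∃ K : Set H, IsCompact K ∧
      ∀ y ∈ N, ∀ h, p y = rng h → h ∉ K → F y h = 0) :
    Continuous fun y => (⟨q y, ∫ h, F y h ∂ν.meas (p y)⟩ : Tot A) := by
  refine continuous_iff_continuousAt.2 fun y₀ => ?_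
  obtain ⟨N, hN, K, hK, hNK⟩ := hs y₀
  refine UscBanachBundle.tendsto_of_approx hq.continuousAt fun δ hδ => ?_
  -- The approximant is Σ (∫ φ_i) s_i, with φ_i a partition of unity on K and s_i a continuous
  -- section close to F near the i-th point. The φ_i vanish off K', where χ = 1, so ∫ χ controls the
  -- mass of Σ φ_i for all y near y₀.
  obtain ⟨K', hK', hKK'⟩ := exists_compact_superset hK
  obtain ⟨χ, hχ1, -, hχc, hχ0⟩ := exists_continuous_one_zero_of_isCompact hK' isClosed_empty
    (Set.disjoint_empty K')
  set c : ℝ := ∫ h, χ h ∂ν.meas (p y₀) with hc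
  have hc0 : 0 ≤ c := integral_nonneg fun h => (hχ0 h).1
  -- The error is at most δ' ∫ χ, and ∫ χ < c + 1 for y near y₀ by continuity.
  set δ' : ℝ := δ / (c + 1) with hδ'
  have hδ'0 : 0 < δ' := by positivity
  have hFat : ∀ y h, p y = rng h → ∀ l : Filter {z : Y × H // p z.1 = rng z.2},
      Tendsto (fun z => z.1) l (𝓝 (y, h)) →
      Tendsto (fun z => (⟨q z.1.1, F z.1.1 z.1.2⟩ : Tot A)) l (𝓝 ⟨q y, F y h⟩) :=
    fun y h hyh l hl => (hF.tendsto ⟨(y, h), hyh⟩).comp (tendsto_subtype_rng.2 hl)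
  have key : ∀ h₀ : H, ∃ O ∈ 𝓝 h₀, ∃ M ∈ 𝓝 y₀, ∃ s : ∀ x, A x,
      Continuous (fun x => (⟨x, s x⟩ : Tot A)) ∧
      ∀ y ∈ M, ∀ h ∈ O, p y = rng h → ‖F y h - s (q y)‖ ≤ δ' := by
    intro h₀
    by_cases h0 : p y₀ = rng h₀
    · obtain ⟨s, hs0, hsc⟩ : ∃ f : ∀ x, A x, _ := UscBanachBundle.enough_sections (q y₀) (F y₀ h₀)
      let l : Filter {z : Y × H // p z.1 = rng z.2} := comap Subtype.val (𝓝 (y₀, h₀))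
      have h1 := hFat y₀ h₀ h0 l tendsto_comap
      have h2 : Tendsto (fun z : {z : Y × H // p z.1 = rng z.2} =>
          (⟨q z.1.1, s (q z.1.1)⟩ : Tot A)) l (𝓝 ⟨q y₀, s (q y₀)⟩) :=
        ((hs0.comp (hq.comp continuous_fst)).tendsto (y₀, h₀)).comp tendsto_comap
      rw [hsc] at h2
      have h3 := UscBanachBundle.eventually_norm_lt (UscBanachBundle.tendsto_sub h1 h2)
        (ε := δ') (by simpa using hδ'0)
      rw [eventually_comap, nhds_prod_eq, eventually_prod_iff] at h3
      obtain ⟨P, hP, Q, hQ, hPQ⟩ := h3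
      exact ⟨_, hQ, _, hP, s, hs0, fun y hy h hh hyh => (hPQ hy hh ⟨(y, h), hyh⟩ rfl).le⟩
    -- The pairs with p y = r(h) form a closed set; near a pair outside it the estimate is void and
    -- any section will do.
    · obtain ⟨s, hs0, -⟩ := UscBanachBundle.enough_sections (q y₀) (0 : A (q y₀))
      have h1 : {z : Y × H | p z.1 = rng z.2}ᶜ ∈ 𝓝 (y₀, h₀) :=
        (isClosed_eq (hp.comp continuous_fst) (continuous_rng.comp continuous_snd)).isOpen_compl.mem_nhds h0
      rw [nhds_prod_eq, mem_prod_iff] at h1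
      obtain ⟨M, hM, O, hO, hMO⟩ := h1
      exact ⟨O, hO, M, hM, s, hs0, fun y hy h hh hyh => absurd hyh (hMO (Set.mk_mem_prod hy hh))⟩
  choose O hO M hM s hsc hOM using key
  obtain ⟨t, φ, htK, hφc, hφs, hφ0, hφV, hφ1, hφle⟩ := exists_finite_partition hK
    (fun h => O h ∩ interior K') (fun h hh => inter_mem (hO h) (isOpen_interior.mem_nhds (hKK' hh)))
  have hcont : ∀ i, Continuous fun y => ∫ h, φ i h ∂ν.meas (p y) := fun i =>
    (ν.continuous_integral _ (hφc i) (hφs i)).comp hp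
  have hχcont : Continuous fun y => ∫ h, χ h ∂ν.meas (p y) :=
    (ν.continuous_integral _ χ.continuous hχc).comp hp
  have hint : ∀ (i : t) (y : Y), Integrable (φ i) (ν.meas (p y)) := fun i y =>
    (hφc i).integrable_of_hasCompactSupport (hφs i)
  have hsmul : ∀ y : Y, ∑ i : t, ((∫ h, φ i h ∂ν.meas (p y) : ℝ) : ℂ) • s i (q y)
      = ∫ h, (∑ i : t, ((φ i h : ℝ) : ℂ) • s i (q y)) ∂ν.meas (p y) := by
    intro y
    rw [integral_finsetSum]
    · refine Finset.sum_congr rfl fun i _ => ?_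
      rw [integral_smul_const, integral_complex_ofReal]
    · intro i _
      exact (hint i y).ofReal.smul_const _
  have hest : ∀ y, (∀ i : t, y ∈ M i) → y ∈ N →
      ‖∫ h, F y h ∂ν.meas (p y) - ∑ i : t, ((∫ h, φ i h ∂ν.meas (p y) : ℝ) : ℂ) • s i (q y)‖
        ≤ δ' * ∫ h, χ h ∂ν.meas (p y) := by
    intro y hyM hyN
    have hFy : ContinuousOn (F y) {h | rng h = p y} := by
      rw [continuousOn_iff_continuous_domRestrict, ← UscBanachBundle.continuous_fibre_iff (A := A)]
      exact hF.comp (f := fun h : {h : H | rng h = p y} =>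
        (⟨(y, h.1), h.2.symm⟩ : {z : Y × H // p z.1 = rng z.2})) (by fun_prop)
    have hFi : Integrable (F y) (ν.meas (p y)) :=
      ν.integrable hFy hK fun h hh hk => hNK y hyN h hh.symm hk
    have hsI : Integrable (fun h => ∑ i : t, ((φ i h : ℝ) : ℂ) • s i (q y)) (ν.meas (p y)) :=
      integrable_finsetSum _ fun i _ => (hint i y).ofReal.smul_const _
    rw [hsmul, ← integral_sub hFi hsI, ← integral_const_mul]
    refine norm_integral_le_of_norm_le
      ((χ.continuous.integrable_of_hasCompactSupport hχc).const_mul _) ?_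
    filter_upwards [ν.ae_rng (p y)] with h hh
    have hterm : ∀ i : t, φ i h ≠ 0 → ‖F y h - s i (q y)‖ ≤ δ' := fun i hi =>
      hOM i y (hyM i) h (hφV i h hi).1 hh.symm
    have hbd : ∀ i : t, ‖((φ i h : ℝ) : ℂ) • (F y h - s i (q y))‖ ≤ φ i h * δ' := by
      intro i
      rw [norm_smul, Complex.norm_real, Real.norm_of_nonneg (hφ0 i h)]
      by_cases hi : φ i h = 0
      · simp [hi]
      · exact mul_le_mul_of_nonneg_left (hterm i hi) (hφ0 i h)
    have hF1 : F y h = ∑ i : t, ((φ i h : ℝ) : ℂ) • F y h := by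
      by_cases hhK : h ∈ K
      · rw [← Finset.sum_smul, ← Complex.ofReal_sum, hφ1 h hhK, Complex.ofReal_one, one_smul]
      · simp [hNK y hyN h hh.symm hhK]
    have heq : F y h - ∑ i : t, ((φ i h : ℝ) : ℂ) • s i (q y)
        = ∑ i : t, ((φ i h : ℝ) : ℂ) • (F y h - s i (q y)) := by
      conv_lhs => rw [hF1]
      rw [← Finset.sum_sub_distrib]
      simp only [smul_sub]
    rw [heq]
    refine (norm_sum_le_of_le _ fun i _ => hbd i).trans ?_
    rw [← Finset.sum_mul, mul_comm]
    refine mul_le_mul_of_nonneg_left ?_ hδ'0.le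
    by_cases hhK' : h ∈ K'
    · rw [hχ1 hhK']
      exact hφle h
    · rw [Finset.sum_eq_zero]
      · exact (hχ0 h).1
      · intro i _
        by_contra hi
        exact hhK' (interior_subset (hφV i h hi).2)
  have hδc : δ' * (c + 1) = δ := by rw [hδ']; field_simp
  refine ⟨fun y => ∑ i : t, ((∫ h, φ i h ∂ν.meas (p y) : ℝ) : ℂ) • s i (q y),
    ∑ i : t, ((∫ h, φ i h ∂ν.meas (p y₀) : ℝ) : ℂ) • s i (q y₀), ?_, ?_, ?_⟩
  · exact UscBanachBundle.tendsto_sum _ hq.continuousAt fun i _ => UscBanachBundle.tendsto_smul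
      (Complex.continuous_ofReal.comp (hcont i)).continuousAt ((hsc i).comp hq).continuousAt
  · rw [norm_sub_rev]
    refine (hest y₀ (fun i => mem_of_mem_nhds (hM i)) (mem_of_mem_nhds hN)).trans ?_
    rw [← hδc]
    gcongr
    linarith
  · have h1 : ∀ᶠ y in 𝓝 y₀, ∫ h, χ h ∂ν.meas (p y) < c + 1 :=
      hχcont.continuousAt.eventually_lt continuousAt_const (lt_add_one c)
    have h2 : ∀ᶠ y in 𝓝 y₀, ∀ i : t, y ∈ M i := eventually_all.2 fun i => hM i
    filter_upwards [h1, h2, hN] with y hy1 hy2 hy3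
    refine (hest y hy2 hy3).trans ?_
    rw [← hδc]
    gcongr

end HaarSystem

/-! ### Imprimitivity bimodules: norm estimates and approximate identities -/

namespace IsImprimitivityBimodule

variable {A X C : Type*} [NonUnitalCStarAlgebra A] [NonUnitalCStarAlgebra C]
  [NormedAddCommGroup X] [NormedSpace ℂ X]
  {actL : A → X → X} {actR : X → C → X} {ipL : X → X → A} {ipR : X → X → C}
  (hX : IsImprimitivityBimodule actL actR ipL ipR)

include hX

theorem ipL_add_right (x y z : X) : ipL x (y + z) = ipL x y + ipL x z := by
  rw [← hX.ipL_star, hX.ipL_add, star_add, hX.ipL_star, hX.ipL_star]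

theorem ipL_sub_left (x y z : X) : ipL (x - y) z = ipL x z - ipL y z := by
  rw [eq_sub_iff_add_eq, ← hX.ipL_add, sub_add_cancel]

theorem ipL_sub_right (x y z : X) : ipL x (y - z) = ipL x y - ipL x z := by
  rw [eq_sub_iff_add_eq, ← hX.ipL_add_right, sub_add_cancel]

theorem ipL_actL_right (a : A) (x y : X) : ipL x (actL a y) = ipL x y * star a := by
  rw [← hX.ipL_star, hX.ipL_actL, star_mul, hX.ipL_star]

theorem ipR_actR_left (c : C) (x y : X) : ipR (actR x c) y = star c * ipR x y := by
  rw [← hX.ipR_star, hX.ipR_actR, star_mul, hX.ipR_star]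

theorem norm_actR_le (x : X) (c : C) : ‖actR x c‖ ≤ ‖x‖ * ‖c‖ := by
  rw [← pow_le_pow_iff_left₀ (norm_nonneg _) (by positivity) two_ne_zero, ← hX.ipR_norm,
    hX.ipR_actR, hX.ipR_actR_left]
  calc ‖star c * ipR x x * c‖ ≤ ‖star c‖ * ‖ipR x x‖ * ‖c‖ :=
        (norm_mul_le _ _).trans (by gcongr; exact norm_mul_le _ _)
    _ = (‖x‖ * ‖c‖) ^ 2 := by rw [hX.ipR_norm, norm_star]; ring

/-- If the C-valued inner product of y with itself is d*d, then ⟨x, y⟩⟨x, y⟩* = ⟨xd*, xd*⟩.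
Cauchy–Schwarz thus reduces to the norm bound for the right action. -/
theorem norm_ipL_le (x y : X) : ‖ipL x y‖ ≤ ‖x‖ * ‖y‖ := by
  obtain ⟨d, hd⟩ := hX.ipR_pos y
  have hdn : ‖d‖ ^ 2 = ‖y‖ ^ 2 := by
    rw [← hX.ipR_norm, hd, CStarRing.norm_star_mul_self, sq]
  have h1 : ipL x y * star (ipL x y) = ipL (actR x (star d)) (actR x (star d)) := by
    rw [hX.ipL_star, ← hX.ipL_actL, hX.ipL_ipR, hd, hX.actR_mul, hX.ipL_actR]
  rw [← pow_le_pow_iff_left₀ (norm_nonneg _) (by positivity) two_ne_zero]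
  calc ‖ipL x y‖ ^ 2 = ‖actR x (star d)‖ ^ 2 := by
        rw [← hX.ipL_norm, ← h1, CStarRing.norm_self_mul_star, sq]
    _ ≤ (‖x‖ * ‖star d‖) ^ 2 := by gcongr; exact hX.norm_actR_le _ _
    _ = (‖x‖ * ‖y‖) ^ 2 := by rw [mul_pow, mul_pow, norm_star, hdn]

/-- A finite sum `∑ ⟨ζ x, ζ x⟩` of norm at most `1` that almost fixes given vectors. -/
theorem exists_approx_unit_vectors (s : Finset X) {δ : ℝ} (hδ : 0 < δ) :
    ∃ ζ : X → X, ‖∑ x ∈ s, ipL (ζ x) (ζ x)‖ ≤ 1 ∧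
      ∀ x ∈ s, ‖x - actL (∑ y ∈ s, ipL (ζ y) (ζ y)) x‖ ≤ δ := by
  let _ := CStarAlgebra.spectralOrder A
  have _ := CStarAlgebra.spectralOrderedRing A
  -- Taking ζ x = k · x with k = g(h) turns the sum into e = khk = f(h), where f(s) = s²/(ε + s)²
  -- for s ≥ 0. Moreover ⟨x − ex, x − ex⟩ = (1 − e)⟨x, x⟩(1 − e) ≤ (1 − e)h(1 − e), whose norm is at
  -- most the supremum of s(1 − f(s))² over s ≥ 0. This is at most 4ε = δ².
  set h : A := ∑ x ∈ s, ipL x x with hh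
  have hpos : ∀ x, 0 ≤ ipL x x := fun x => by
    obtain ⟨a, ha⟩ := hX.ipL_pos x
    rw [ha]
    exact star_mul_self_nonneg a
  have h0 : 0 ≤ h := Finset.sum_nonneg fun x _ => hpos x
  have hsa : IsSelfAdjoint h := h0.isSelfAdjoint
  set ε : ℝ := δ ^ 2 / 4 with hε
  have hε0 : 0 < ε := by positivity
  -- The absolute value only makes g continuous on all of ℝ; the quasispectrum of h is nonnegative.
  set g : ℝ → ℝ := fun s => √s / (ε + |s|) with hg
  have hgc : Continuous g := by
    refine Real.continuous_sqrt.div (by fun_prop) fun s => ?_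
    positivity
  have hg0 : g 0 = 0 := by simp [hg]
  set k : A := cfcₙ g h with hk
  have hks : star k = k := IsSelfAdjoint.cfcₙ
  set f : ℝ → ℝ := fun s => g s * s * g s with hf
  have hfc : Continuous f := by fun_prop
  have hf0 : f 0 = 0 := by simp [hf]
  set e : A := cfcₙ f h with he
  have hes : star e = e := IsSelfAdjoint.cfcₙ
  have heq : e = k * h * k := by
    have h1 : cfcₙ (fun s : ℝ => g s * s) h = k * h := by
      rw [cfcₙ_mul g (fun s => s) h hgc.continuousOn hg0 continuous_id.continuousOn rfl]
      congr 1
      exact cfcₙ_id ℝ h hsa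
    rw [he, hf, cfcₙ_mul (fun s => g s * s) g h (by fun_prop) (by simp) hgc.continuousOn hg0, h1]
  have hfs : ∀ s : ℝ, 0 ≤ s → f s = s ^ 2 / (ε + s) ^ 2 := by
    intro s hs
    simp only [hf, hg, abs_of_nonneg hs]
    have : √s * √s = s := Real.mul_self_sqrt hs
    field_simp
    rw [Real.sq_sqrt hs, sq]
  have he1 : ‖e‖ ≤ 1 := by
    refine norm_cfcₙ_le fun s hs => ?_
    have hs0 : 0 ≤ s := quasispectrum_nonneg_of_nonneg h h0 s hs
    rw [hfs s hs0, Real.norm_of_nonneg (by positivity), div_le_one (by positivity)]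
    gcongr
    linarith
  -- This is (1 − e) a (1 − e), multiplied out because A need not have a unit.
  let Q : A → A := fun a => a - e * a - (a * e - e * a * e)
  have hQh : ‖Q h‖ ≤ δ ^ 2 := by
    have hm : cfcₙ (fun s : ℝ => f s * s) h = e * h := by
      rw [cfcₙ_mul f (fun s => s) h hfc.continuousOn hf0 continuous_id.continuousOn rfl]
      congr 1
      exact cfcₙ_id ℝ h hsa
    have hm' : cfcₙ (fun s : ℝ => s * f s) h = h * e := by
      rw [cfcₙ_mul (fun s => s) f h continuous_id.continuousOn rfl hfc.continuousOn hf0]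
      congr 1
      exact cfcₙ_id ℝ h hsa
    have hm2 : cfcₙ (fun s : ℝ => f s * s * f s) h = e * h * e := by
      rw [cfcₙ_mul (fun s => f s * s) f h (by fun_prop) (by simp) hfc.continuousOn hf0, hm]
    have hQ : Q h = cfcₙ (fun s : ℝ => s - f s * s - (s * f s - f s * s * f s)) h := by
      rw [cfcₙ_sub (fun s => s - f s * s) (fun s => s * f s - f s * s * f s) h (by fun_prop)
        (by simp) (by fun_prop) (by simp), cfcₙ_sub (fun s => s) (fun s => f s * s) h
        (by fun_prop) rfl (by fun_prop) (by simp), cfcₙ_sub (fun s => s * f s)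
        (fun s => f s * s * f s) h (by fun_prop) (by simp) (by fun_prop) (by simp), hm, hm', hm2]
      have hid : cfcₙ (fun s : ℝ => s) h = h := cfcₙ_id ℝ h hsa
      rw [hid]
    rw [hQ]
    refine norm_cfcₙ_le fun s hs => ?_
    have hs0 : 0 ≤ s := quasispectrum_nonneg_of_nonneg h h0 s hs
    have h1 : s - f s * s - (s * f s - f s * s * f s) = s * (1 - f s) ^ 2 := by ring
    have h2 : 1 - f s = ε * (ε + 2 * s) / (ε + s) ^ 2 := by
      rw [hfs s hs0]; field_simp; ring
    have h3 : 0 ≤ 1 - f s := by rw [h2]; positivity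
    have h4 : 1 - f s ≤ 2 * ε / (ε + s) := by
      rw [h2, div_le_div_iff₀ (by positivity) (by positivity)]
      nlinarith [mul_nonneg (mul_nonneg hε0.le hε0.le) (by positivity : (0 : ℝ) ≤ ε + s)]
    rw [h1, Real.norm_of_nonneg (by positivity)]
    calc s * (1 - f s) ^ 2 ≤ s * (2 * ε / (ε + s)) ^ 2 := by gcongr
      _ = 4 * ε * (ε * s / (ε + s) ^ 2) := by field_simp; ring
      _ ≤ 4 * ε * 1 := by
        gcongr
        rw [div_le_one (by positivity)]
        nlinarith
      _ = δ ^ 2 := by rw [hε]; ring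
  have hQp : ∀ x, Q (ipL x x) = ipL (x - actL e x) (x - actL e x) := by
    intro x
    simp only [Q, hX.ipL_sub_left, hX.ipL_sub_right, hX.ipL_actL, hX.ipL_actL_right, hes]
    noncomm_ring
  have hQsum : Q h = ∑ x ∈ s, Q (ipL x x) := by
    simp only [Q, hh, Finset.mul_sum, Finset.sum_mul, Finset.sum_sub_distrib]
  have hζ : ∑ x ∈ s, ipL (actL k x) (actL k x) = e := by
    simp only [hX.ipL_actL, hX.ipL_actL_right, hks]
    rw [heq, hh, Finset.mul_sum, Finset.sum_mul]
    exact Finset.sum_congr rfl fun x _ => (mul_assoc _ _ _).symm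
  refine ⟨actL k, by rw [hζ]; exact he1, fun x hx => ?_⟩
  rw [hζ, ← pow_le_pow_iff_left₀ (norm_nonneg _) hδ.le two_ne_zero, ← hX.ipL_norm]
  refine le_trans ?_ hQh
  refine CStarAlgebra.norm_le_norm_of_nonneg_of_le (hpos _) ?_
  rw [← hQp, hQsum]
  exact Finset.single_le_sum (f := fun x => Q (ipL x x)) (fun y _ => by rw [hQp]; exact hpos _) hx

theorem exists_norm_sub_actL_le (x : X) {δ : ℝ} (hδ : 0 < δ) : ∃ a : A, ‖x - actL a x‖ ≤ δ := by
  obtain ⟨ζ, -, h⟩ := hX.exists_approx_unit_vectors {x} hδ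
  exact ⟨_, h x (Finset.mem_singleton_self x)⟩

/-- Since ⟨x, y⟩ − e⟨x, y⟩ = ⟨x − ex, y⟩, an e that almost fixes x almost fixes ⟨x, y⟩; the constant
M collects the norms ‖y‖ and the coefficients of the linear combination. -/
theorem exists_vectors_of_mem_span {a : A}
    (ha : a ∈ Submodule.span ℂ {a : A | ∃ x y, ipL x y = a}) :
    ∃ (s : Finset X) (M : ℝ), 0 ≤ M ∧ ∀ (e : A) (δ : ℝ), (∀ x ∈ s, ‖x - actL e x‖ ≤ δ) →
      0 ≤ δ → ‖a - e * a‖ ≤ M * δ := by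
  classical
  induction ha using Submodule.span_induction with
  | mem a ha =>
    obtain ⟨x, y, rfl⟩ := ha
    refine ⟨{x}, ‖y‖, norm_nonneg _, fun e δ h _ => ?_⟩
    rw [← hX.ipL_actL, ← hX.ipL_sub_left, mul_comm]
    exact (hX.norm_ipL_le _ _).trans
      (mul_le_mul_of_nonneg_right (h x (Finset.mem_singleton_self x)) (norm_nonneg _))
  | zero => exact ⟨∅, 0, le_rfl, fun e δ _ _ => by simp⟩
  | add a b _ _ iha ihb =>
    obtain ⟨s, M, hM, hs⟩ := iha
    obtain ⟨t, N, hN, ht⟩ := ihb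
    refine ⟨s ∪ t, M + N, add_nonneg hM hN, fun e δ h hδ => ?_⟩
    rw [mul_add, add_sub_add_comm, add_mul]
    exact norm_add_le_of_le (hs e δ (fun x hx => h x (Finset.mem_union_left _ hx)) hδ)
      (ht e δ (fun x hx => h x (Finset.mem_union_right _ hx)) hδ)
  | smul k a _ ih =>
    obtain ⟨s, M, hM, hs⟩ := ih
    refine ⟨s, ‖k‖ * M, by positivity, fun e δ h hδ => ?_⟩
    rw [mul_smul_comm, ← smul_sub, norm_smul, mul_assoc]
    gcongr
    exact hs e δ h hδ

/-- A finite sum `∑ ⟨ζ x, ζ x⟩` of norm at most `1` that almost fixes given elements of `A`. -/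
theorem exists_approx_unit (S : Finset A) {δ : ℝ} (hδ : 0 < δ) :
    ∃ (s : Finset X) (ζ : X → X), ‖∑ x ∈ s, ipL (ζ x) (ζ x)‖ ≤ 1 ∧
      ∀ b ∈ S, ‖b - (∑ x ∈ s, ipL (ζ x) (ζ x)) * b‖ ≤ δ := by
  classical
  have key : ∀ b : A, ∃ (s : Finset X) (η : ℝ), 0 < η ∧ ∀ e : A, ‖e‖ ≤ 1 →
      (∀ x ∈ s, ‖x - actL e x‖ ≤ η) → ‖b - e * b‖ ≤ δ := by
    intro b
    obtain ⟨a, ha, hab⟩ := Metric.mem_closure_iff.1 (hX.ipL_full b) (δ / 4) (by positivity)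
    rw [dist_eq_norm] at hab
    obtain ⟨s, M, hM, hs⟩ := hX.exists_vectors_of_mem_span ha
    -- In b − eb = (b − a) + (a − ea) + e(a − b) each term has norm at most δ/4; the last one uses
    -- ‖e‖ ≤ 1.
    refine ⟨s, δ / 4 / (M + 1), by positivity, fun e he hes => ?_⟩
    have h1 := hs e _ hes (by positivity)
    have h2 : M * (δ / 4 / (M + 1)) ≤ δ / 4 := by
      rw [mul_div_assoc', div_le_iff₀ (by positivity)]
      nlinarith
    have h3 : ‖e * (a - b)‖ ≤ 1 * ‖b - a‖ := by
      rw [norm_sub_rev b a]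
      exact (norm_mul_le _ _).trans (by gcongr)
    have h4 : b - e * b = (b - a) + (a - e * a) + e * (a - b) := by noncomm_ring
    rw [h4]
    refine (norm_add₃_le).trans ?_
    linarith
  choose s η hη hs using key
  obtain ⟨η₀, hη₀, hη₀'⟩ : ∃ η₀ : ℝ, 0 < η₀ ∧ ∀ b ∈ S, η₀ ≤ η b := by
    rcases S.eq_empty_or_nonempty with rfl | hS
    · exact ⟨1, one_pos, by simp⟩
    · obtain ⟨b, -, hb⟩ := S.exists_min_image η hS
      exact ⟨η b, hη b, hb⟩
  obtain ⟨ζ, h1, h2⟩ := hX.exists_approx_unit_vectors (S.biUnion s) hη₀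
  exact ⟨_, ζ, h1, fun b hb => hs b _ h1 fun x hx =>
    (h2 x (Finset.mem_biUnion.2 ⟨b, hb, hx⟩)).trans (hη₀' b hb)⟩

end IsImprimitivityBimodule

/-! ### A groupoid as an equivalence with itself -/

namespace TopGroupoid

variable {G : Type*} [TopologicalSpace G] [TopGroupoid G]

theorem tendsto_mul {Y : Type*} {l : Filter Y} {f g : Y → G} {a b : G}
    (h : ∀ y, src (f y) = rng (g y)) (hab : src a = rng b) (hf : Tendsto f l (𝓝 a))
    (hg : Tendsto g l (𝓝 b)) : Tendsto (fun y => f y * g y) l (𝓝 (a * b)) :=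
  ((continuous_mul' (G := G)).tendsto ⟨(a, b), hab⟩).comp
    (f := fun y => ⟨(f y, g y), h y⟩) (tendsto_subtype_rng.2 (hf.prodMk_nhds hg))

theorem mul_inv_cancel_of {x t : G} (h : src x = rng t) : x * t * t⁻¹ = x := by
  rw [mul_assoc' h (rng_inv t).symm, mul_inv_self, ← h, self_mul_src]

theorem inv_mul_cancel_of {x t : G} (h : src x = rng t) : x⁻¹ * (x * t) = t := by
  rw [← mul_assoc' (src_inv x) h, inv_mul_self, h, rng_mul_self]

theorem mul_inv_rev' {x y : G} (h : src x = rng y) : (x * y)⁻¹ = y⁻¹ * x⁻¹ := by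
  have h1 : src y⁻¹ = rng x⁻¹ := by rw [src_inv, rng_inv, h]
  have h2 : src y = rng (y⁻¹ * x⁻¹) := by rw [rng_mul h1, rng_inv]
  refine inv_eq_of (by rw [src_mul h, h2]) ?_
  rw [mul_assoc' h h2, ← mul_assoc' (rng_inv y).symm h1, mul_inv_self, ← h, ← rng_inv x,
    rng_mul_self, mul_inv_self, rng_mul h]

theorem mul_inv_mul_cancel {t t' : G} (h : src t = src t') : t * t'⁻¹ * t' = t := by
  have := mul_inv_cancel_of (x := t) (t := t'⁻¹) (by rw [rng_inv, h])
  rwa [inv_inv'] at this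

theorem eq_mul_inv_of {x t t' : G} (h : src x = rng t') (h' : x * t' = t) : t * t'⁻¹ = x := by
  rw [← h', mul_inv_cancel_of h]

/-- A bump function at x has positive integral for the measure at r(x), hence for the measures at
nearby units by continuity of the Haar system. A positive integral at u forces a point of range u
where the bump function does not vanish. -/
theorem isOpenMap_rng [LocallyCompactSpace G] [T2Space G] [MeasurableSpace G]
    (μ : HaarSystem G) [BorelSpace G] : IsOpenMap (rng : G → unitSpace G) := by
  rw [isOpenMap_iff_nhds_le]
  intro x U hU
  rw [mem_map] at hU
  obtain ⟨W, hWU, hW, hxW⟩ := mem_nhds_iff.1 hU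
  obtain ⟨f, hf1, hf0, hfc, hf⟩ := exists_continuous_one_zero_of_isCompact (isCompact_singleton (x := x))
    hW.isClosed_compl (by simpa using hxW)
  have hpos : 0 < ∫ y, f y ∂μ.meas (rng x) := by
    have hint : Integrable f (μ.meas (rng x)) := f.continuous.integrable_of_hasCompactSupport hfc
    rw [integral_pos_iff_support_of_nonneg (fun y => (hf y).1) hint]
    exact μ.pos (rng x) _ f.continuous.isOpen_support
      ⟨x, by simp [hf1 (Set.mem_singleton x)], rfl⟩
  have := (μ.continuous_integral f f.continuous hfc).continuousAt.eventually_const_lt hpos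
  filter_upwards [this] with u hu
  by_contra hu'
  refine hu.ne' (integral_eq_zero_of_ae ?_)
  filter_upwards [μ.ae_rng u] with y hy
  by_contra hfy
  refine hu' ?_
  rw [← hy]
  exact hWU (by_contra fun hyW => hfy (hf0 hyW))

theorem isOpenMap_src [LocallyCompactSpace G] [T2Space G] [MeasurableSpace G]
    (μ : HaarSystem G) [BorelSpace G] : IsOpenMap (src : G → unitSpace G) := by
  have : (src : G → unitSpace G) = rng ∘ fun x => x⁻¹ := by
    funext x; simp [rng_inv]
  rw [this]
  refine (isOpenMap_rng μ).comp ?_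
  exact (Homeomorph.mk ⟨fun x : G => x⁻¹, fun x => x⁻¹, inv_inv', inv_inv'⟩ continuous_inv'
    continuous_inv').isOpenMap

end TopGroupoid

/-- A groupoid as an equivalence between itself and itself. -/
def GroupoidEquivalence.self {G : Type*} [TopologicalSpace G] [TopGroupoid G] [LocallyCompactSpace G]
    [T2Space G] [MeasurableSpace G] [BorelSpace G] (μ : HaarSystem G) :
    GroupoidEquivalence G G G where
  rng := TopGroupoid.rng
  src := TopGroupoid.src
  lact x t := x * t
  ract t h := t * h
  continuous_rng := TopGroupoid.continuous_rng
  isOpenMap_rng := TopGroupoid.isOpenMap_rng μ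
  continuous_src := TopGroupoid.continuous_src
  isOpenMap_src := TopGroupoid.isOpenMap_src μ
  rng_lact h := rng_mul h
  mul_lact h h' := mul_assoc' h h'
  unit_lact := rng_mul_self
  continuous_lact := continuous_mul'
  free_lact {x t} h h' := by
    have := mul_inv_cancel_of h
    rw [← this, h', mul_inv_self]
  proper_lact := by
    rw [isProperMap_iff_ultrafilter]
    refine ⟨continuous_mul'.prodMk (by fun_prop), fun 𝒰 ⟨a, b⟩ h => ?_⟩
    have ha : Tendsto _ _ _ := (continuous_fst.tendsto _).comp h
    have hb : Tendsto _ _ _ := (continuous_snd.tendsto _).comp h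
    have hab : TopGroupoid.src a = TopGroupoid.src b := by
      refine tendsto_nhds_unique ((TopGroupoid.continuous_src.tendsto a).comp ha) ?_
      refine ((TopGroupoid.continuous_src.tendsto b).comp hb).congr fun p => ?_
      exact (src_mul p.2).symm
    -- The group element is recovered from the convergent pair (xt, t) as (xt)t⁻¹, so it converges
    -- as well.
    have hx := tendsto_mul (fun p => by
      change TopGroupoid.src (p.1.1 * p.1.2) = TopGroupoid.rng p.1.2⁻¹
      rw [src_mul p.2, rng_inv]) (by rw [rng_inv, hab]) ha
      ((continuous_inv'.tendsto b).comp hb)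
    refine ⟨⟨(a * b⁻¹, b), ?_⟩, ?_, ?_⟩
    · rw [src_mul (by rw [rng_inv, hab]), src_inv]
    · simp [mul_inv_mul_cancel hab]
    · refine tendsto_id'.1 (tendsto_subtype_rng.2 (Tendsto.prodMk_nhds (hx.congr fun p => ?_) hb))
      exact mul_inv_cancel_of p.2
  src_ract h := src_mul h
  ract_mul h h' := (mul_assoc' h h').symm
  ract_unit := self_mul_src
  continuous_ract := continuous_mul'
  free_ract {x t} h h' := by
    have := inv_mul_cancel_of h
    rw [← this, h', inv_mul_self]
  proper_ract := by
    rw [isProperMap_iff_ultrafilter]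
    refine ⟨Continuous.prodMk (by fun_prop) continuous_mul', fun 𝒰 ⟨a, b⟩ h => ?_⟩
    have ha : Tendsto _ _ _ := (continuous_fst.tendsto _).comp h
    have hb : Tendsto _ _ _ := (continuous_snd.tendsto _).comp h
    have hab : TopGroupoid.rng a = TopGroupoid.rng b := by
      refine tendsto_nhds_unique ((TopGroupoid.continuous_rng.tendsto a).comp ha) ?_
      refine ((TopGroupoid.continuous_rng.tendsto b).comp hb).congr fun p => ?_
      exact rng_mul p.2
    have hx := tendsto_mul (fun p => by
      change TopGroupoid.src (p.1.1⁻¹) = TopGroupoid.rng (p.1.1 * p.1.2)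
      rw [rng_mul p.2, src_inv]) (by rw [src_inv, hab])
      ((continuous_inv'.tendsto a).comp ha) hb
    refine ⟨⟨(a, a⁻¹ * b), ?_⟩, ?_, ?_⟩
    · exact comp_inv_mul hab
    · simp [mul_inv_mul hab]
    · refine tendsto_id'.1 (tendsto_subtype_rng.2 (Tendsto.prodMk_nhds ha (hx.congr fun p => ?_)))
      exact inv_mul_cancel_of p.2
  src_lact h := src_mul h
  rng_ract h := rng_mul h
  lact_ract h h' := (mul_assoc' h h').symm
  surjective_rng u := ⟨u, rng_unit u⟩
  exists_ract {t t'} h := ⟨t⁻¹ * t', comp_inv_mul h, mul_inv_mul h⟩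
  surjective_src u := ⟨u, src_unit u⟩
  exists_lact {t t'} h := ⟨t * t'⁻¹, by rw [src_mul (by rw [rng_inv, h]), src_inv],
    mul_inv_mul_cancel h⟩

/-! ### A Fell bundle as an equivalence with itself -/

namespace FellBundle

open FellStructure

variable {G : Type*} [TopologicalSpace G] [TopGroupoid G] {B : G → Type*}
    [∀ x, NormedAddCommGroup (B x)] [∀ x, NormedSpace ℂ (B x)] [∀ x, CompleteSpace (B x)]
    [TopologicalSpace (Tot B)] [FellBundle B]

theorem norm_bmul_bstar_self {x x' u : G} (hx : x⁻¹ = x') (h : src x = rng x') (hu : x * x' = u)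
    (a : B x) : ‖bmul h hu a (bstar hx a)‖ = ‖a‖ ^ 2 := by
  subst hx
  obtain rfl : u = (rng x : G) := by rw [← hu, mul_inv_self]
  let := FellStructure.cstarAlgebra B (rng x)
  let := FellStructure.cstarAlgebra B (src x)
  exact (imprimitivity (B := B) x).ipL_norm a

theorem norm_bstar_bmul_self' {x x' u : G} (hx : x⁻¹ = x') (h : src x' = rng x) (hu : x' * x = u)
    (a : B x) : ‖bmul h hu (bstar hx a) a‖ = ‖a‖ ^ 2 := by
  subst hx
  obtain rfl : u = (src x : G) := by rw [← hu, inv_mul_self]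
  let := FellStructure.cstarAlgebra B (rng x)
  let := FellStructure.cstarAlgebra B (src x)
  exact (imprimitivity (B := B) x).ipR_norm a

/-- The element a*a is both the left inner square of a* in B(x⁻¹) and the right inner square of a in
B(x). -/
theorem norm_bstar {x x' : G} (hx : x⁻¹ = x') (a : B x) : ‖bstar hx a‖ = ‖a‖ := by
  have hx' : x'⁻¹ = x := by rw [← hx, inv_inv']
  have h1 := norm_bmul_bstar_self (B := B) hx' (by rw [← hx, src_inv]) rfl (bstar hx a)
  rw [bstar_bstar hx hx', norm_bstar_bmul_self'] at h1
  exact ((pow_left_inj₀ (norm_nonneg _) (norm_nonneg _) two_ne_zero).1 h1).symm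

theorem norm_bmul_unit_le {x : G} {u : unitSpace G} (h : src x = rng (u : G)) (h' : x * u = x)
    (a : B x) (b : B (u : G)) : ‖bmul h h' a b‖ ≤ ‖a‖ * ‖b‖ := by
  obtain rfl : src x = u := by rw [h, rng_unit]
  let := FellStructure.cstarAlgebra B (rng x)
  let := FellStructure.cstarAlgebra B (src x)
  exact (imprimitivity (B := B) x).norm_actR_le a b

/-- Submultiplicativity is an axiom only over units. Writing bb* = d*d in B(r(y)) gives (ab)(ab)* =
(ad*)(ad*)*, and ad* is bounded by the Hilbert module structure of B(x). -/
theorem norm_bmul_le' {x y z : G} (h : src x = rng y) (h' : x * y = z) (a : B x) (b : B y) :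
    ‖bmul h h' a b‖ ≤ ‖a‖ * ‖b‖ := by
  subst h'
  obtain ⟨d, hd⟩ : ∃ d : B (rng y : G), bmul (rng_inv y).symm (mul_inv_self y) b (bstar rfl b) =
      bmul (src_unit_eq_rng (rng y)) (unit_mul_unit (rng y)) (bstar (unit_inv (rng y)) d) d := by
    let := FellStructure.cstarAlgebra B (rng y)
    let := FellStructure.cstarAlgebra B (src y)
    exact (imprimitivity (B := B) y).ipL_pos b
  have hdn : ‖d‖ ^ 2 = ‖b‖ ^ 2 := by
    rw [← norm_bmul_bstar_self rfl (rng_inv y).symm (mul_inv_self y) b, hd, norm_bstar_bmul_self']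
  have hxu : src x = rng (rng y : G) := by rw [rng_unit, h]
  have hxu' : x * (rng y : G) = x := by rw [← h, self_mul_src]
  have hux : src (rng y : G) = rng x⁻¹ := by rw [src_unit, rng_inv, h]
  have hux' : (rng y : G) * x⁻¹ = x⁻¹ := by rw [← h, ← rng_inv, rng_mul_self]
  have hyx : src y⁻¹ = rng x⁻¹ := by rw [src_inv, rng_inv, h]
  have hxy : (x * y)⁻¹ = y⁻¹ * x⁻¹ := mul_inv_rev' h
  have hxyc : src (x * y) = rng (y⁻¹ * x⁻¹) := by rw [rng_mul hyx, rng_inv, src_mul h]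
  have hxyc' : x * y * (y⁻¹ * x⁻¹) = (rng x : G) := by
    rw [← hxy, mul_inv_self, rng_mul h]
  have hyyx : src y = rng (y⁻¹ * x⁻¹) := by rw [rng_mul hyx, rng_inv]
  have hyyx' : y * (y⁻¹ * x⁻¹) = x⁻¹ := by
    rw [← mul_assoc' (rng_inv y).symm hyx, mul_inv_self, hux']
  have key : bmul hxyc hxyc' (bmul h rfl a b) (bstar hxy (bmul h rfl a b)) =
      bmul (rng_inv x).symm (mul_inv_self x) (bmul hxu hxu' a (bstar (unit_inv _) d))
        (bstar rfl (bmul hxu hxu' a (bstar (unit_inv _) d))) := by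
    rw [bstar_bmul h rfl rfl rfl hxy hyx rfl a b,
      bmul_assoc h rfl hyyx hyyx' hxyc hxyc' (rng_inv x).symm (mul_inv_self x),
      ← bmul_assoc (rng_inv y).symm (mul_inv_self y) hyx rfl hux hux' hyyx hyyx' b, hd,
      bstar_bmul hxu hxu' rfl (unit_inv _) rfl hux hux', bstar_bstar,
      bmul_assoc hxu hxu' hux hux' (rng_inv x).symm (mul_inv_self x) (rng_inv x).symm
        (mul_inv_self x),
      bmul_assoc (src_unit_eq_rng (rng y)) (unit_mul_unit (rng y)) hux hux' hux hux' hux hux']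
  rw [← pow_le_pow_iff_left₀ (norm_nonneg _) (by positivity) two_ne_zero,
    ← norm_bmul_bstar_self hxy hxyc hxyc', key, norm_bmul_bstar_self]
  calc _ ≤ (‖a‖ * ‖bstar (unit_inv (rng y)) d‖) ^ 2 := by gcongr; exact norm_bmul_unit_le _ _ _ _
    _ = _ := by rw [norm_bstar, mul_pow, mul_pow, hdn]

/-- The brackets of the self-equivalence are chosen elements, equal to tt'⁻¹ and t⁻¹t' only
propositionally; this moves points of the total space along such equalities. -/
theorem tot_bmul_congr {x y z z' : G} (h : src x = rng y) (hz : x * y = z) (hz' : x * y = z')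
    (a : B x) (b : B y) : (⟨z, bmul h hz a b⟩ : Tot B) = ⟨z', bmul h hz' a b⟩ := by
  subst hz; subst hz'; rfl

variable [LocallyCompactSpace G] [T2Space G] [MeasurableSpace G] [BorelSpace G]

variable (B) in
/-- A Fell bundle as an equivalence between itself and itself. -/
def selfEquivalence (μ : HaarSystem G) : FellEquivalence (GroupoidEquivalence.self μ) B B B where
  lact h h' := bmul h h'
  ract h h' := bmul h h'
  lip {t t' x} h h' := LinearMap.mk₂'ₛₗ (RingHom.id ℂ) (starRingEnd ℂ)
    (fun e f => bmul (by rw [rng_inv, ← h']; exact src_mul h) (eq_mul_inv_of h h') e (bstar rfl f))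
    (by simp) (by simp) (by simp) (by simp)
  rip {t t' x} h h' := LinearMap.mk₂'ₛₗ (starRingEnd ℂ) (RingHom.id ℂ)
    (fun e f => bmul (by rw [src_inv, ← h']; exact (rng_mul h).symm)
      (by rw [← h']; exact inv_mul_cancel_of h) (bstar rfl e) f)
    (by simp) (by simp) (by simp) (by simp)
  continuous_lact := continuous_bmul
  continuous_ract := continuous_bmul
  continuous_lip := by
    have h1 : Continuous fun p : {p : Tot B × Tot B // src p.1.base = src p.2.base} =>
        (⟨p.1.1.base * p.1.2.base⁻¹, bmul (by rw [rng_inv, p.2]) rfl p.1.1.val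
          (bstar rfl p.1.2.val)⟩ : Tot B) := by
      let m : {p : Tot B × Tot B // src p.1.base = src p.2.base} →
          {p : Tot B × Tot B // src p.1.base = rng p.2.base} := fun p =>
        ⟨(p.1.1, ⟨p.1.2.base⁻¹, bstar rfl p.1.2.val⟩), by simp [rng_inv, p.2]⟩
      have hm : Continuous m := ((continuous_fst.comp continuous_subtype_val).prodMk
        ((continuous_bstar (B := B)).comp (continuous_snd.comp continuous_subtype_val))).subtype_mk _
      exact (continuous_bmul (B := B)).comp hm
    refine h1.congr fun p => ?_
    exact tot_bmul_congr _ _ _ _ _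
  continuous_rip := by
    have h1 : Continuous fun p : {p : Tot B × Tot B // rng p.1.base = rng p.2.base} =>
        (⟨p.1.1.base⁻¹ * p.1.2.base, bmul (by rw [src_inv, p.2]) rfl
          (bstar rfl p.1.1.val) p.1.2.val⟩ : Tot B) := by
      let m : {p : Tot B × Tot B // rng p.1.base = rng p.2.base} →
          {p : Tot B × Tot B // src p.1.base = rng p.2.base} := fun p =>
        ⟨(⟨p.1.1.base⁻¹, bstar rfl p.1.1.val⟩, p.1.2), by simp [src_inv, p.2]⟩
      have hm : Continuous m :=
        (((continuous_bstar (B := B)).comp (continuous_fst.comp continuous_subtype_val)).prodMk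
          (continuous_snd.comp continuous_subtype_val)).subtype_mk _
      exact (continuous_bmul (B := B)).comp hm
    refine h1.congr fun p => ?_
    exact tot_bmul_congr _ _ _ _ _
  lact_lact h₁ h₁' h₂ h₂' h₃ h₃' h₄ h₄' a b e := (bmul_assoc _ _ _ _ _ _ _ _ a b e).symm
  norm_lact_le h h' b e := norm_bmul_le' _ _ b e
  ract_ract h₁ h₁' h₂ h₂' h₃ h₃' h₄ h₄' a b e := bmul_assoc _ _ _ _ _ _ _ _ a b e
  norm_ract_le h h' b e := norm_bmul_le' _ _ b e
  lact_ract h₁ h₁' h₂ h₂' h₃ h₃' h₄ h₄' a b e := (bmul_assoc _ _ _ _ _ _ _ _ a b e).symm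
  bstar_lip {t t' x y} h h' k k' hxy e f := by
    have h2 : src t = src t' := by rw [← h']; exact src_mul h
    change bstar hxy (bmul _ _ e (bstar rfl f)) = bmul _ _ f (bstar rfl e)
    rw [bstar_bmul _ _ rfl (inv_inv' t') hxy (by rw [rng_inv, h2]) (eq_mul_inv_of k k'),
      bstar_bstar]
  bstar_rip {t t' x y} h h' k k' hxy e f := by
    have h2 : rng t = rng t' := by rw [← h']; exact (rng_mul h).symm
    change bstar hxy (bmul _ _ (bstar rfl e) f) = bmul _ _ (bstar rfl f) e
    rw [bstar_bmul _ _ (inv_inv' t) rfl hxy (by rw [src_inv, h2])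
      (by rw [← k']; exact inv_mul_cancel_of k), bstar_bstar]
  lip_lact h₁ h₁' h₂ h₂' h₃ h₃' h₄ h₄' b e f := bmul_assoc _ _ _ _ _ _ _ _ b e (bstar rfl f)
  rip_ract h₁ h₁' h₂ h₂' h₃ h₃' h₄ h₄' e f c :=
    (bmul_assoc _ _ _ _ _ _ _ _ (bstar rfl e) f c).symm
  lip_lact_eq_ract_rip {t t' t'' w x h} h₁ h₁' h₂ h₂' h₃ h₃' h₄ h₄' e f g :=
    bmul_assoc _ _ _ _ _ _ _ _ e (bstar rfl f) g
  imprimitivity t := imprimitivity (B := B) t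

end FellBundle

/-! ### Topology of groupoid equivalences -/

namespace GroupoidEquivalence

variable {G H T : Type*} [TopologicalSpace G] [TopGroupoid G]
  [TopologicalSpace H] [TopGroupoid H] [TopologicalSpace T] (Z : GroupoidEquivalence G H T)

section Convergence

variable {Y : Type*} {l : Filter Y}

theorem tendsto_lact {f : Y → G} {g : Y → T} {x : G} {t : T}
    (h : ∀ y, TopGroupoid.src (f y) = Z.rng (g y)) (hxt : TopGroupoid.src x = Z.rng t)
    (hf : Tendsto f l (𝓝 x)) (hg : Tendsto g l (𝓝 t)) :
    Tendsto (fun y => Z.lact (f y) (g y)) l (𝓝 (Z.lact x t)) :=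
  (Z.continuous_lact.tendsto ⟨(x, t), hxt⟩).comp
    (f := fun y => ⟨(f y, g y), h y⟩) (tendsto_subtype_rng.2 (hf.prodMk_nhds hg))

theorem continuous_lact' [TopologicalSpace Y] {f : Y → G} {g : Y → T}
    (h : ∀ y, TopGroupoid.src (f y) = Z.rng (g y)) (hf : Continuous f) (hg : Continuous g) :
    Continuous fun y => Z.lact (f y) (g y) :=
  Z.continuous_lact.comp ((hf.prodMk hg).subtype_mk h)

theorem continuous_ract' [TopologicalSpace Y] {f : Y → T} {g : Y → H}
    (h : ∀ y, Z.src (f y) = TopGroupoid.rng (g y)) (hf : Continuous f) (hg : Continuous g) :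
    Continuous fun y => Z.ract (f y) (g y) :=
  Z.continuous_ract.comp ((hf.prodMk hg).subtype_mk h)

/-- By freeness and properness, `x` is close to a unit when `t` and `x · t` are close to each
other. -/
theorem tendsto_unit_of_tendsto {f : Y → G} {g : Y → T} {t : T}
    (h : ∀ y, TopGroupoid.src (f y) = Z.rng (g y)) (hg : Tendsto g l (𝓝 t))
    (hfg : Tendsto (fun y => Z.lact (f y) (g y)) l (𝓝 t)) :
    Tendsto f l (𝓝 (Z.rng t : G)) := by
  rw [tendsto_iff_ultrafilter]
  intro 𝒰 h𝒰
  let m : Y → {p : G × T // TopGroupoid.src p.1 = Z.rng p.2} := fun y => ⟨(f y, g y), h y⟩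
  -- Properness yields a limit x along the ultrafilter with x · t = t, and freeness identifies x
  -- with the unit r(t).
  obtain ⟨⟨⟨x, t'⟩, hx⟩, h1, h2⟩ := (isProperMap_iff_ultrafilter.1 Z.proper_lact).2
    (𝒰 := 𝒰.map m) (y := (t, t))
    ((hfg.mono_left h𝒰).prodMk_nhds (hg.mono_left h𝒰))
  simp only [Prod.mk.injEq] at h1
  obtain ⟨h3, rfl⟩ := h1
  rw [show (Z.rng t' : G) = x from (Z.free_lact hx h3).symm]
  exact (continuous_fst.comp continuous_subtype_val).continuousAt.tendsto.comp
    (show Tendsto m 𝒰 _ from h2)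

/-- This will force inner products of sections supported near t to be supported near the units. -/
theorem exists_nhds_lact {t : T} {N : Set G} (hN : N ∈ 𝓝 (Z.rng t : G)) :
    ∃ V ∈ 𝓝 t, ∀ x : G, ∀ t' : T, TopGroupoid.src x = Z.rng t' → t' ∈ V → Z.lact x t' ∈ V →
      x ∈ N := by
  let D := {p : G × T // TopGroupoid.src p.1 = Z.rng p.2}
  let m : D → T × T := fun p => (p.1.2, Z.lact p.1.1 p.1.2)
  have h := Z.tendsto_unit_of_tendsto (l := comap m (𝓝 t ×ˢ 𝓝 t)) (f := fun p : D => p.1.1)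
    (g := fun p => p.1.2) (t := t) (fun p => p.2) (tendsto_fst.comp tendsto_comap)
    (tendsto_snd.comp tendsto_comap) hN
  rw [mem_map, mem_comap] at h
  obtain ⟨s, hs, hsN⟩ := h
  obtain ⟨V, hV, hVs⟩ := mem_prod_self_iff.1 hs
  exact ⟨V, hV, fun x t' hx ht hxt => hsN (a := (⟨(x, t'), hx⟩ : D)) (hVs ⟨ht, hxt⟩)⟩

end Convergence

theorem isCompact_leftBracket {K L : Set T} (hK : IsCompact K) (hL : IsCompact L) :
    IsCompact {x : G | ∃ t ∈ L, TopGroupoid.src x = Z.rng t ∧ Z.lact x t ∈ K} := by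
  have h := (Z.proper_lact.isCompact_preimage (hK.prod hL)).image
    (continuous_fst.comp continuous_subtype_val)
  convert h using 1
  ext x
  constructor
  · rintro ⟨t, ht, hxt, hK⟩
    exact ⟨⟨(x, t), hxt⟩, ⟨hK, ht⟩, rfl⟩
  · rintro ⟨⟨⟨y, t⟩, hxt⟩, ⟨hK, ht⟩, rfl⟩
    exact ⟨t, ht, hxt, hK⟩

theorem isCompact_rightBracket {K L : Set T} (hK : IsCompact K) (hL : IsCompact L) :
    IsCompact {h : H | ∃ t ∈ K, Z.src t = TopGroupoid.rng h ∧ Z.ract t h ∈ L} := by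
  have h := (Z.proper_ract.isCompact_preimage (hK.prod hL)).image
    (continuous_snd.comp continuous_subtype_val)
  convert h using 1
  ext x
  constructor
  · rintro ⟨t, ht, hxt, hK⟩
    exact ⟨⟨(t, x), hxt⟩, ⟨ht, hK⟩, rfl⟩
  · rintro ⟨⟨⟨t, y⟩, hxt⟩, ⟨ht, hK⟩, rfl⟩
    exact ⟨t, ht, hxt, hK⟩

theorem isCompact_lact_image [T2Space G] {K : Set G} {L : Set T} (hK : IsCompact K)
    (hL : IsCompact L) :
    IsCompact {t : T | ∃ x ∈ K, ∃ t' ∈ L, TopGroupoid.src x = Z.rng t' ∧ Z.lact x t' = t} := by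
  have hc : IsClosed {p : G × T | TopGroupoid.src p.1 = Z.rng p.2} :=
    isClosed_eq (TopGroupoid.continuous_src.comp continuous_fst)
      (Z.continuous_rng.comp continuous_snd)
  have h := ((hc.isClosedEmbedding_subtypeVal.isCompact_preimage (hK.prod hL)).image
    Z.continuous_lact)
  convert h using 1
  ext t
  constructor
  · rintro ⟨x, hx, t', ht', hxt, rfl⟩
    exact ⟨⟨(x, t'), hxt⟩, ⟨hx, ht'⟩, rfl⟩
  · rintro ⟨⟨⟨x, t'⟩, hxt⟩, ⟨hx, ht'⟩, rfl⟩
    exact ⟨x, hx, t', ht', hxt, rfl⟩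

theorem exists_compact_lift [LocallyCompactSpace T] {K : Set (unitSpace G)} (hK : IsCompact K) :
    ∃ L : Set T, IsCompact L ∧ K ⊆ Z.rng '' L := by
  choose τ hτ using Z.surjective_rng
  choose C hC hCτ using fun u => exists_compact_mem_nhds (τ u)
  obtain ⟨s, -, hs⟩ := hK.elim_nhds_subcover (fun u => Z.rng '' C u) fun u _ => by
    have := Z.isOpenMap_rng.image_mem_nhds (hCτ u)
    rwa [hτ] at this
  refine ⟨⋃ u ∈ s, C u, s.isCompact_biUnion fun u _ => hC u, fun u hu => ?_⟩
  obtain ⟨v, hv, t, ht, rfl⟩ := Set.mem_iUnion₂.1 (hs hu)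
  exact ⟨t, Set.mem_biUnion hv ht, rfl⟩

theorem continuousOn_ract (t : T) :
    ContinuousOn (fun h => Z.ract t h) {h : H | TopGroupoid.rng h = Z.src t} := by
  rw [continuousOn_iff_continuous_domRestrict]
  exact Z.continuous_ract.comp (f := fun h : {h : H | TopGroupoid.rng h = Z.src t} =>
    ⟨(t, h.1), h.2.symm⟩) (by fun_prop)

theorem continuousOn_lact_inv (t : T) :
    ContinuousOn (fun x => Z.lact x⁻¹ t) {x : G | TopGroupoid.rng x = Z.rng t} := by
  rw [continuousOn_iff_continuous_domRestrict]
  exact Z.continuous_lact.comp (f := fun x : {x : G | TopGroupoid.rng x = Z.rng t} =>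
    ⟨(x.1⁻¹, t), by rw [TopGroupoid.src_inv]; exact x.2⟩)
    (((continuous_inv'.comp continuous_subtype_val).prodMk continuous_const).subtype_mk _)

theorem lact_inv_ract {x : G} {t : T} {h : H} (hx : TopGroupoid.rng x = Z.rng t)
    (hh : TopGroupoid.rng h = Z.src t) :
    Z.lact x⁻¹ (Z.ract t h) = Z.ract (Z.lact x⁻¹ t) h :=
  Z.lact_ract (by rw [TopGroupoid.src_inv, hx]) hh.symm

theorem continuousOn_lact_inv_ract (t : T) :
    ContinuousOn (fun p : G × H => Z.lact p.1⁻¹ (Z.ract t p.2))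
      ({x : G | TopGroupoid.rng x = Z.rng t} ×ˢ {h : H | TopGroupoid.rng h = Z.src t}) := by
  rw [continuousOn_iff_continuous_domRestrict]
  have h1 : Continuous fun p : ({x : G | TopGroupoid.rng x = Z.rng t} ×ˢ
      {h : H | TopGroupoid.rng h = Z.src t} : Set (G × H)) => Z.ract t p.1.2 :=
    (Z.continuousOn_ract t).comp_continuous (by fun_prop) fun p => p.2.2
  exact Z.continuous_lact.comp (f := fun p : ({x : G | TopGroupoid.rng x = Z.rng t} ×ˢ
      {h : H | TopGroupoid.rng h = Z.src t} : Set (G × H)) =>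
      ⟨(p.1.1⁻¹, Z.ract t p.1.2), by
        rw [TopGroupoid.src_inv, Z.rng_ract p.2.2.symm]; exact p.2.1⟩)
    (((continuous_inv'.comp (continuous_fst.comp continuous_subtype_val)).prodMk h1).subtype_mk _)

end GroupoidEquivalence

/-! ### Parametrized integrals of scalar functions -/

namespace HaarSystem

variable {H : Type*} [TopologicalSpace H] [TopGroupoid H] [MeasurableSpace H] (ν : HaarSystem H)

theorem integral_pos_of_pos {u : unitSpace H} {F : H → ℝ} (hF : ContinuousOn F {h | rng h = u})
    (hint : Integrable F (ν.meas u)) (h0 : ∀ h, 0 ≤ F h) {k : H} (hk : rng k = u) (hFk : 0 < F k) :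
    0 < ∫ h, F h ∂ν.meas u := by
  rw [integral_pos_iff_support_of_nonneg h0 hint]
  have := hF.continuousWithinAt hk (Ioi_mem_nhds hFk)
  rw [mem_map, mem_nhdsWithin] at this
  obtain ⟨U, hU, hkU, hUF⟩ := this
  refine (ν.pos u U hU ⟨k, hkU, hk⟩).trans_le (measure_mono_ae ?_)
  filter_upwards [ν.ae_rng u] with h hh hhU
  exact (hUF ⟨hhU, hh⟩ : 0 < F h).ne'

variable [T2Space H] [BorelSpace H] [LocallyCompactSpace H] [SecondCountableTopology H]

/-- A scalar function is a family of vectors in the line bundle ℂ over a one-point space, so the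
bundle version applies. -/
theorem continuous_integral_param {Y : Type*} [TopologicalSpace Y]
    {p : Y → unitSpace H} (hp : Continuous p) {F : Y → H → ℝ}
    (hF : Continuous fun z : {z : Y × H // p z.1 = rng z.2} => F z.1.1 z.1.2)
    (hs : ∀ y₀, ∃ N ∈ 𝓝 y₀, ∃ K : Set H, IsCompact K ∧
      ∀ y ∈ N, ∀ h, p y = rng h → h ∉ K → F y h = 0) :
    Continuous fun y => ∫ h, F y h ∂ν.meas (p y) := by
  let A : PUnit.{1} → Type := fun _ => ℂ
  let _ : ∀ x, NormedAddCommGroup (A x) := fun _ => inferInstanceAs (NormedAddCommGroup ℂ)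
  let _ : ∀ x, NormedSpace ℂ (A x) := fun _ => inferInstanceAs (NormedSpace ℂ ℂ)
  have _ : ∀ x, CompleteSpace (A x) := fun _ => inferInstanceAs (CompleteSpace ℂ)
  let v : Tot A → ℂ := fun a => a.val
  let _ : TopologicalSpace (Tot A) := TopologicalSpace.induced v inferInstance
  have hv : Continuous v := continuous_induced_dom
  have _ : UscBanachBundle A :=
    { continuous_base := continuous_of_const fun _ _ => rfl
      isOpenMap_base := fun _ _ => isOpen_discrete _
      isClosed_le_norm := fun ε _ => isClosed_le continuous_const (continuous_norm.comp hv)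
      continuous_add := continuous_induced_rng.2
        ((hv.comp (continuous_fst.comp continuous_subtype_val)).add
          (hv.comp (continuous_snd.comp continuous_subtype_val)))
      continuous_smul := fun c => continuous_induced_rng.2 (hv.const_smul c)
      tendsto_zero := fun x l _ hl => by
        rw [nhds_induced]
        exact map_le_iff_le_comap.1 (tendsto_zero_iff_norm_tendsto_zero.2 hl)
      enough_sections := fun x a => ⟨fun _ => a, continuous_of_const fun _ _ => rfl, rfl⟩ }
  have h := ν.continuous_integral_bundle (A := A) hp (q := fun _ => PUnit.unit) continuous_const
    (F := fun y h => ((F y h : ℝ) : ℂ))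
    (continuous_induced_rng.2 (Complex.continuous_ofReal.comp hF)) (by
      intro y₀
      obtain ⟨N, hN, K, hK, h⟩ := hs y₀
      exact ⟨N, hN, K, hK, fun y hy k hk hkK => by rw [h y hy k hk hkK]; rfl⟩)
  refine (Complex.continuous_re.comp (hv.comp h)).congr fun y => ?_
  change (∫ h, ((F y h : ℝ) : ℂ) ∂ν.meas (p y)).re = _
  rw [integral_complex_ofReal, Complex.ofReal_re]

end HaarSystem

/-! ### Scalar kernels -/

/-- An elementary estimate used to normalise cut-off functions. -/
theorem exists_mul_le_mul_add {T : Type*} [TopologicalSpace T] {φ F : T → ℝ} (hφ : Continuous φ)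
    (hφc : HasCompactSupport φ) (hφ0 : ∀ t, 0 ≤ φ t) (hF : Continuous F) (hF0 : ∀ t, 0 ≤ F t)
    (hφF : ∀ t, 0 < φ t → 0 < F t) {δ : ℝ} (hδ : 0 < δ) :
    ∃ ε : ℝ, 0 < ε ∧ ∀ t, φ t * ε ≤ δ * (F t + ε) := by
  have hc : IsCompact {t | δ ≤ φ t} := by
    refine hφc.isCompact.of_isClosed_subset (isClosed_le continuous_const hφ) fun t ht => ?_
    exact subset_closure (hδ.trans_le ht).ne'
  obtain ⟨M, hM⟩ : ∃ M, ∀ t, φ t ≤ M := by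
    obtain ⟨M, hM⟩ := hφc.exists_bound_of_continuous hφ
    exact ⟨M, fun t => (le_abs_self _).trans (hM t)⟩
  rcases Set.eq_empty_or_nonempty {t | δ ≤ φ t} with h | h
  · refine ⟨1, one_pos, fun t => ?_⟩
    have : φ t < δ := by
      by_contra h'
      exact (h ▸ (not_lt.1 h' : t ∈ {t | δ ≤ φ t}) : t ∈ (∅ : Set T))
    nlinarith [hF0 t]
  · obtain ⟨t₀, ht₀, hmin⟩ := hc.exists_isMinOn h hF.continuousOn
    have hc0 : 0 < F t₀ := hφF t₀ (hδ.trans_le ht₀)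
    have hM0 : 0 ≤ M := (hφ0 t₀).trans (hM t₀)
    -- Where φ ≥ δ one has φε ≤ δ F(t₀) ≤ δ F; where φ < δ the summand δε already suffices.
    refine ⟨δ * F t₀ / (M + 1), by positivity, fun t => ?_⟩
    by_cases ht : δ ≤ φ t
    · have h1 : F t₀ ≤ F t := hmin ht
      have h2 : φ t * (δ * F t₀ / (M + 1)) ≤ δ * F t₀ := by
        rw [mul_div_assoc', div_le_iff₀ (by positivity)]
        have := hM t
        nlinarith [mul_pos hδ hc0]
      have h3 : 0 < δ * F t₀ / (M + 1) := by positivity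
      nlinarith
    · have h3 : 0 < δ * F t₀ / (M + 1) := by positivity
      nlinarith [hF0 t, not_le.1 ht]

namespace GroupoidEquivalence

variable {G H T : Type*} [TopologicalSpace G] [LocallyCompactSpace G] [T2Space G]
  [SecondCountableTopology G] [TopGroupoid G] [MeasurableSpace G] [BorelSpace G]
  [TopologicalSpace H] [LocallyCompactSpace H] [T2Space H]
  [SecondCountableTopology H] [TopGroupoid H] [MeasurableSpace H] [BorelSpace H]
  [TopologicalSpace T] [LocallyCompactSpace T] [T2Space T] (Z : GroupoidEquivalence G H T)
  (μ : HaarSystem G) (ν : HaarSystem H)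

theorem continuous_integral_ract {φ : T → ℝ} (hφ : Continuous φ) (hφc : HasCompactSupport φ) :
    Continuous fun t => ∫ h, φ (Z.ract t h) ∂ν.meas (Z.src t) := by
  refine ν.continuous_integral_param Z.continuous_src (hφ.comp Z.continuous_ract) fun t₀ => ?_
  obtain ⟨N, hN, hNt⟩ := exists_compact_mem_nhds t₀
  refine ⟨N, hNt, _, Z.isCompact_rightBracket hN hφc, fun t ht h hh hhK => ?_⟩
  by_contra hne
  exact hhK ⟨t, ht, hh, subset_closure hne⟩

theorem integrable_ract {φ : T → ℝ} (hφ : Continuous φ) (hφc : HasCompactSupport φ) (t : T) :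
    Integrable (fun h => φ (Z.ract t h)) (ν.meas (Z.src t)) := by
  refine ν.integrable (hφ.comp_continuousOn (Z.continuousOn_ract t))
    (Z.isCompact_rightBracket (isCompact_singleton (x := t)) hφc) fun h hh hhK => ?_
  by_contra hne
  exact hhK ⟨t, rfl, hh.symm, subset_closure hne⟩

/-- Points with the same range lie in one H-orbit, and left invariance absorbs the translating
element. -/
theorem integral_ract_eq {φ : T → ℝ} (hφ : Continuous φ) {t t' : T} (h : Z.rng t = Z.rng t') :
    ∫ h, φ (Z.ract t' h) ∂ν.meas (Z.src t') = ∫ h, φ (Z.ract t h) ∂ν.meas (Z.src t) := by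
  obtain ⟨k, hk, rfl⟩ := Z.exists_ract h
  rw [Z.src_ract hk]
  have := ν.integral_mul_left k (F := fun h => φ (Z.ract t h))
    (by rw [← hk]; exact hφ.comp_continuousOn (Z.continuousOn_ract t))
  rw [← hk] at this
  rw [← this]
  refine integral_congr_ae ?_
  filter_upwards [ν.ae_rng (TopGroupoid.src k)] with h hh
  rw [Z.ract_mul hk hh.symm]

theorem continuous_integral_lact {φ : T → ℝ} (hφ : Continuous φ) (hφc : HasCompactSupport φ) :
    Continuous fun t => ∫ x, φ (Z.lact x⁻¹ t) ∂μ.meas (Z.rng t) := by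
  have hc : Continuous fun z : {z : T × G // Z.rng z.1 = TopGroupoid.rng z.2} =>
      Z.lact z.1.2⁻¹ z.1.1 :=
    Z.continuous_lact' (fun z => by rw [TopGroupoid.src_inv]; exact z.2.symm)
      (continuous_inv'.comp (continuous_snd.comp continuous_subtype_val))
      (continuous_fst.comp continuous_subtype_val)
  refine μ.continuous_integral_param Z.continuous_rng (hφ.comp hc) fun t₀ => ?_
  obtain ⟨N, hN, hNt⟩ := exists_compact_mem_nhds t₀
  refine ⟨N, hNt, _, (Z.isCompact_leftBracket hN hφc), fun t ht x hx hxK => ?_⟩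
  by_contra hne
  exact hxK ⟨Z.lact x⁻¹ t, subset_closure hne, Z.comp_inv_lact hx.symm,
    by rwa [Z.lact_inv_lact hx.symm]⟩

theorem integrable_lact {φ : T → ℝ} (hφ : Continuous φ) (hφc : HasCompactSupport φ) (t : T) :
    Integrable (fun x => φ (Z.lact x⁻¹ t)) (μ.meas (Z.rng t)) := by
  refine μ.integrable (hφ.comp_continuousOn (Z.continuousOn_lact_inv t))
    (Z.isCompact_leftBracket (isCompact_singleton (x := t)) hφc) fun x hx hxK => ?_
  by_contra hne
  exact hxK ⟨Z.lact x⁻¹ t, subset_closure hne, Z.comp_inv_lact hx, Z.lact_inv_lact hx⟩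

theorem integral_lact_eq {φ : T → ℝ} (hφ : Continuous φ) {y : G} {t : T}
    (hy : TopGroupoid.src y = Z.rng t) :
    ∫ x, φ (Z.lact x⁻¹ (Z.lact y t)) ∂μ.meas (Z.rng (Z.lact y t)) =
      ∫ x, φ (Z.lact x⁻¹ t) ∂μ.meas (Z.rng t) := by
  have h1 := hφ.comp_continuousOn (Z.continuousOn_lact_inv (Z.lact y t))
  rw [Z.rng_lact hy] at h1 ⊢
  rw [← hy]
  refine (μ.integral_mul_left y h1).symm.trans ?_
  refine integral_congr_ae ?_
  filter_upwards [μ.ae_rng (TopGroupoid.src y)] with x hx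
  have h2 : TopGroupoid.src x⁻¹ = TopGroupoid.rng y⁻¹ := by
    rw [TopGroupoid.src_inv, TopGroupoid.rng_inv, hx]
  have h3 : TopGroupoid.src y⁻¹ = Z.rng (Z.lact y t) := by
    rw [Z.rng_lact hy, TopGroupoid.src_inv]
  simp only [Function.comp_apply]
  rw [mul_inv_rev' hx.symm, Z.mul_lact h2 h3, ← Z.mul_lact (TopGroupoid.src_inv y) hy,
    inv_mul_self, hy, Z.unit_lact]

/-- The product measure is carried by the product of two closed fibres, on which the kernel is
continuous and, by properness of both actions, zero off a compact set. This is what Fubini needs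
later. -/
theorem integrable_kernel {φ ψ : T → ℝ} (hφ : Continuous φ) (hφc : HasCompactSupport φ)
    (hψ : Continuous ψ) (hψc : HasCompactSupport ψ) (t : T) :
    Integrable (fun p : G × H => φ (Z.ract t p.2) * ψ (Z.lact p.1⁻¹ (Z.ract t p.2)))
      ((μ.meas (Z.rng t)).prod (ν.meas (Z.src t))) := by
  set S : Set (G × H) :=
    {x : G | TopGroupoid.rng x = Z.rng t} ×ˢ {h : H | TopGroupoid.rng h = Z.src t} with hS
  have hSc : IsClosed S := (isClosed_fibre _).prod (isClosed_fibre _)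
  have hcont : ContinuousOn
      (fun p : G × H => φ (Z.ract t p.2) * ψ (Z.lact p.1⁻¹ (Z.ract t p.2))) S :=
    (hφ.comp_continuousOn ((Z.continuousOn_ract t).comp continuousOn_snd fun p hp => hp.2)).mul
      (hψ.comp_continuousOn (Z.continuousOn_lact_inv_ract t))
  have hK := (Z.isCompact_leftBracket hφc hψc).prod
    (Z.isCompact_rightBracket (isCompact_singleton (x := t)) hφc)
  have h1 := (hcont.mono Set.inter_subset_right).integrableOn_compact (hK.inter_right hSc)
    (μ := (μ.meas (Z.rng t)).prod (ν.meas (Z.src t)))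
  refine IntegrableOn.integrable_of_ae_notMem_eq_zero h1 ?_
  have h2 : ∀ᵐ p ∂(μ.meas (Z.rng t)).prod (ν.meas (Z.src t)), p ∈ S := by
    rw [hS]
    refine (Measure.ae_prod_mem_iff_ae_ae_mem (hSc.measurableSet)).2 ?_
    filter_upwards [μ.ae_rng (Z.rng t)] with x hx
    filter_upwards [ν.ae_rng (Z.src t)] with h hh
    exact ⟨hx, hh⟩
  filter_upwards [h2] with ⟨x, h⟩ hp hn
  by_contra hne
  have hx : TopGroupoid.rng x = Z.rng (Z.ract t h) := by rw [Z.rng_ract hp.2.symm]; exact hp.1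
  refine hn ⟨⟨⟨Z.lact x⁻¹ (Z.ract t h), subset_closure (right_ne_zero_of_mul hne),
    Z.comp_inv_lact hx, ?_⟩, ⟨t, rfl, hp.2.symm, subset_closure (left_ne_zero_of_mul hne)⟩⟩, hp⟩
  rw [Z.lact_inv_lact hx]
  exact subset_closure (left_ne_zero_of_mul hne)

end GroupoidEquivalence

/-! ### Normalised cut-off functions and kernels near the diagonal. -/

namespace GroupoidEquivalence

variable {G H T : Type*} [TopologicalSpace G] [LocallyCompactSpace G] [T2Space G]
  [SecondCountableTopology G] [TopGroupoid G] [MeasurableSpace G] [BorelSpace G]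
  [TopologicalSpace H] [LocallyCompactSpace H] [T2Space H]
  [SecondCountableTopology H] [TopGroupoid H] [MeasurableSpace H] [BorelSpace H]
  [TopologicalSpace T] [LocallyCompactSpace T] [T2Space T] (Z : GroupoidEquivalence G H T)
  (μ : HaarSystem G) (ν : HaarSystem H)

/-- A cut-off function whose square has integral `1` along the `H`-orbits over `K₀`. -/
theorem exists_cutoff {K₀ : Set (unitSpace G)} (hK₀ : IsCompact K₀) :
    ∃ ρ : T → ℝ, Continuous ρ ∧ HasCompactSupport ρ ∧ (∀ t, 0 ≤ ρ t) ∧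
      (∀ t, ∫ h, ρ (Z.ract t h) * ρ (Z.ract t h) ∂ν.meas (Z.src t) ≤ 1) ∧
      ∀ t, Z.rng t ∈ K₀ → ∫ h, ρ (Z.ract t h) * ρ (Z.ract t h) ∂ν.meas (Z.src t) = 1 := by
  obtain ⟨L, hL, hKL⟩ := Z.exists_compact_lift hK₀
  obtain ⟨χ, hχ1, -, hχc, hχ⟩ := exists_continuous_one_zero_of_isCompact hL isClosed_empty
    (Set.disjoint_empty L)
  set Ψ : T → ℝ := fun t => ∫ h, χ (Z.ract t h) ∂ν.meas (Z.src t) with hΨ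
  have hΨc : Continuous Ψ := Z.continuous_integral_ract ν χ.continuous hχc
  have hΨ0 : ∀ t, 0 ≤ Ψ t := fun t => integral_nonneg fun h => (hχ _).1
  have hΨinv : ∀ t t', Z.rng t = Z.rng t' → Ψ t' = Ψ t := fun t t' h =>
    Z.integral_ract_eq ν χ.continuous h
  have hΨpos : ∀ t ∈ L, 0 < Ψ t := by
    intro t ht
    refine ν.integral_pos_of_pos (χ.continuous.comp_continuousOn (Z.continuousOn_ract t))
      (Z.integrable_ract ν χ.continuous hχc t) (fun h => (hχ _).1) (k := (Z.src t : H))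
      (rng_unit _) ?_
    rw [Z.ract_unit, hχ1 ht]
    exact one_pos
  -- Ψ may vanish off the orbits of L, so ρ² is taken to be χ / max(Ψ, c). The denominator is
  -- H-invariant and equals Ψ over K₀, so the orbit integral Ψ / max(Ψ, c) is 1 there and at most 1
  -- everywhere.
  obtain ⟨c, hc0, hc⟩ : ∃ c : ℝ, 0 < c ∧ ∀ t ∈ L, c ≤ Ψ t := by
    rcases L.eq_empty_or_nonempty with rfl | hne
    · exact ⟨1, one_pos, by simp⟩
    · obtain ⟨t₀, ht₀, hmin⟩ := hL.exists_isMinOn hne hΨc.continuousOn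
      exact ⟨Ψ t₀, hΨpos t₀ ht₀, fun t ht => hmin ht⟩
  have hm : ∀ t, 0 < max (Ψ t) c := fun t => hc0.trans_le (le_max_right _ _)
  have hint : ∀ t, ∫ h, √(χ (Z.ract t h) / max (Ψ (Z.ract t h)) c) *
      √(χ (Z.ract t h) / max (Ψ (Z.ract t h)) c) ∂ν.meas (Z.src t) = Ψ t / max (Ψ t) c := by
    intro t
    rw [hΨ, ← integral_div]
    refine integral_congr_ae ?_
    filter_upwards [ν.ae_rng (Z.src t)] with h hh
    rw [Real.mul_self_sqrt (div_nonneg (hχ _).1 (hm _).le),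
      ← hΨinv (Z.ract t h) t (Z.rng_ract hh.symm)]
  refine ⟨fun t => √(χ t / max (Ψ t) c), ?_, ?_, fun t => Real.sqrt_nonneg _, fun t => ?_,
    fun t ht => ?_⟩
  · exact Real.continuous_sqrt.comp
      (χ.continuous.div (hΨc.max continuous_const) fun t => (hm t).ne')
  · refine hχc.mono fun t ht h => ht ?_
    simp [h]
  · rw [hint, div_le_one (hm t)]
    exact le_max_left _ _
  · obtain ⟨t', ht', htt'⟩ := hKL ht
    rw [hint, max_eq_left, div_self]
    · rw [hΨinv t' t htt']
      exact (hΨpos t' ht').ne'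
    · rw [hΨinv t' t htt']
      exact hc t' ht'

/-- The integral is constant on H-orbits and vanishes on orbits where φ does, so a bound on the
compact support is a global one. -/
theorem exists_integral_ract_le {φ : T → ℝ} (hφ : Continuous φ) (hφc : HasCompactSupport φ) :
    ∃ C : ℝ, 0 ≤ C ∧ ∀ t, ∫ h, φ (Z.ract t h) ∂ν.meas (Z.src t) ≤ C := by
  obtain ⟨C, hC⟩ := hφc.isCompact.exists_bound_of_continuousOn
    (Z.continuous_integral_ract ν hφ hφc).continuousOn
  refine ⟨max C 0, le_max_right _ _, fun t => ?_⟩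
  by_cases h : ∃ h, Z.src t = TopGroupoid.rng h ∧ φ (Z.ract t h) ≠ 0
  · obtain ⟨k, hk, hne⟩ := h
    have := hC (Z.ract t k) (subset_closure hne)
    rw [Z.integral_ract_eq ν hφ (Z.rng_ract hk).symm] at this
    exact (le_abs_self _).trans (this.trans (le_max_left _ _))
  · push Not at h
    rw [integral_eq_zero_of_ae]
    · exact le_max_right _ _
    · filter_upwards [ν.ae_rng (Z.src t)] with k hk
      exact h k hk.symm

/-- Positive kernels of total mass almost `1`, concentrated near the diagonal. -/
theorem exists_kernel {K₀ : Set (unitSpace G)} (hK₀ : IsCompact K₀) (V : T → Set T)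
    (hV : ∀ t, V t ∈ 𝓝 t) {δ : ℝ} (hδ : 0 < δ) :
    ∃ (s : Finset T) (w : s → T → ℝ), (∀ i, Continuous (w i)) ∧
      (∀ i, HasCompactSupport (w i)) ∧ (∀ i t, 0 ≤ w i t) ∧ (∀ i t, w i t ≠ 0 → t ∈ V i) ∧
      (∀ t, ∫ x, ∫ h, ∑ i, w i (Z.ract t h) * w i (Z.lact x⁻¹ (Z.ract t h)) ∂ν.meas (Z.src t)
        ∂μ.meas (Z.rng t) ≤ 1 + δ) ∧
      ∀ t, Z.rng t ∈ K₀ → |1 - ∫ x, ∫ h, ∑ i, w i (Z.ract t h) * w i (Z.lact x⁻¹ (Z.ract t h))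
        ∂ν.meas (Z.src t) ∂μ.meas (Z.rng t)| ≤ δ := by
  obtain ⟨ρ, hρ, hρc, hρ0, hρ1, hρK⟩ := Z.exists_cutoff ν hK₀
  obtain ⟨C, hC0, hC⟩ := Z.exists_integral_ract_le ν hρ hρc
  -- The pointwise error δ₁(ρ + ρ²) integrates along an orbit to at most δ₁(C + 1) = δ.
  set δ₁ : ℝ := δ / (C + 1) with hδ₁
  have hδ₁0 : 0 < δ₁ := by positivity
  have hδ₁C : δ₁ * C + δ₁ * 1 = δ := by rw [hδ₁]; field_simp
  -- On each of these smaller neighbourhoods ρ varies by less than δ₁, so it can be pulled out of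
  -- integrals against φ i.
  have hV' : ∀ t, V t ∩ {t' | |ρ t' - ρ t| < δ₁ / 2} ∈ 𝓝 t := fun t =>
    inter_mem (hV t) ((hρ.sub continuous_const).abs.continuousAt.eventually_lt continuousAt_const
      (by simpa using hδ₁0))
  obtain ⟨s, φ, -, hφ, hφc, hφ0, hφV, hφ1, hφle⟩ := exists_finite_partition hρc.isCompact _
    (fun t _ => hV' t)
  -- F i is constant on G-orbits. Dividing both factors of the kernel by √(F i + ε i) therefore
  -- divides the kernel by F i t + ε i, and its integral over x is close to ρ(t)² φ i t.
  set F : s → T → ℝ := fun i t => ∫ x, φ i (Z.lact x⁻¹ t) ∂μ.meas (Z.rng t) with hF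
  have hFc : ∀ i, Continuous (F i) := fun i => Z.continuous_integral_lact μ (hφ i) (hφc i)
  have hF0 : ∀ i t, 0 ≤ F i t := fun i t => integral_nonneg fun x => hφ0 i _
  have hFinv : ∀ i x t, TopGroupoid.src x = Z.rng t → F i (Z.lact x t) = F i t :=
    fun i x t h => Z.integral_lact_eq μ (hφ i) h
  have hFpos : ∀ i t, 0 < φ i t → 0 < F i t := by
    intro i t ht
    refine μ.integral_pos_of_pos ((hφ i).comp_continuousOn (Z.continuousOn_lact_inv t))
      (Z.integrable_lact μ (hφ i) (hφc i) t) (fun h => hφ0 i _) (k := (Z.rng t : G))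
      (rng_unit _) ?_
    rwa [unit_inv, Z.unit_lact]
  have hN : (0 : ℝ) < δ₁ / (s.card + 1) := by positivity
  -- The regularisation ε i, needed because F i may vanish, costs at most δ₁ / (|s| + 1) for each
  -- index, hence at most δ₁ in the sum.
  choose ε hε0 hε using fun i =>
    exists_mul_le_mul_add (hφ i) (hφc i) (hφ0 i) (hFc i) (hF0 i) (hFpos i) hN
  have hFε : ∀ i t, 0 < F i t + ε i := fun i t => add_pos_of_nonneg_of_pos (hF0 i t) (hε0 i)
  set w : s → T → ℝ := fun i t => ρ t * φ i t / √(F i t + ε i) with hw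
  have hwc : ∀ i, Continuous (w i) := fun i => (hρ.mul (hφ i)).div
    (Real.continuous_sqrt.comp ((hFc i).add continuous_const))
    fun t => (Real.sqrt_pos.2 (hFε i t)).ne'
  have hws : ∀ i, HasCompactSupport (w i) := fun i => hρc.mono fun t ht h => ht (by simp [hw, h])
  have hw0 : ∀ i t, 0 ≤ w i t := fun i t =>
    div_nonneg (mul_nonneg (hρ0 t) (hφ0 i t)) (Real.sqrt_nonneg _)
  have hwφ : ∀ i t, w i t ≠ 0 → φ i t ≠ 0 := fun i t h h' => h (by simp [hw, h'])
  -- the mass of the kernel in the `G`-direction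
  have hA : ∀ t, |∫ x, ∑ i, w i t * w i (Z.lact x⁻¹ t) ∂μ.meas (Z.rng t) - ρ t * ρ t|
      ≤ δ₁ * ρ t + δ₁ * (ρ t * ρ t) := by
    intro t
    have hint : ∀ i, Integrable (fun x => φ i (Z.lact x⁻¹ t)) (μ.meas (Z.rng t)) := fun i =>
      Z.integrable_lact μ (hφ i) (hφc i) t
    have hintρ : ∀ i, Integrable (fun x => ρ (Z.lact x⁻¹ t) * φ i (Z.lact x⁻¹ t))
        (μ.meas (Z.rng t)) := fun i =>
      Z.integrable_lact μ (hρ.mul (hφ i)) (hφc i).mul_left t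
    have hwint : ∀ i, ∫ x, w i t * w i (Z.lact x⁻¹ t) ∂μ.meas (Z.rng t) =
        ρ t * φ i t / (F i t + ε i) * ∫ x, ρ (Z.lact x⁻¹ t) * φ i (Z.lact x⁻¹ t)
          ∂μ.meas (Z.rng t) := by
      intro i
      rw [← integral_const_mul]
      refine integral_congr_ae ?_
      filter_upwards [μ.ae_rng (Z.rng t)] with x hx
      simp only [hw]
      rw [hFinv i x⁻¹ t (by rw [TopGroupoid.src_inv, hx]), div_mul_div_comm,
        Real.mul_self_sqrt (hFε i t).le]
      ring
    have hφd : ∀ i, |∫ x, ρ (Z.lact x⁻¹ t) * φ i (Z.lact x⁻¹ t) ∂μ.meas (Z.rng t) - ρ t * F i t|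
        * φ i t ≤ δ₁ * F i t * φ i t := by
      intro i
      by_cases hi : φ i t = 0
      · simp [hi]
      refine mul_le_mul_of_nonneg_right ?_ (hφ0 i t)
      rw [hF, ← integral_const_mul, ← integral_const_mul, ← integral_sub (hintρ i)
        ((hint i).const_mul _), ← Real.norm_eq_abs]
      refine norm_integral_le_of_norm_le ((hint i).const_mul _) (.of_forall fun x => ?_)
      rw [← sub_mul, norm_mul, Real.norm_of_nonneg (hφ0 i _), Real.norm_eq_abs]
      by_cases hx : φ i (Z.lact x⁻¹ t) = 0
      · simp [hx]
      refine mul_le_mul_of_nonneg_right ?_ (hφ0 i _)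
      have h1 : |ρ t - ρ i| < δ₁ / 2 := (hφV i _ hi).2
      have h2 : |ρ (Z.lact x⁻¹ t) - ρ i| < δ₁ / 2 := (hφV i _ hx).2
      rw [abs_lt] at h1 h2
      rw [abs_le]
      constructor <;> linarith
    by_cases hρt : ρ t = 0
    · simp [hw, hρt]
    have h1 : ∑ i, φ i t = 1 := hφ1 t (subset_closure hρt)
    rw [integral_finsetSum _ fun i _ => ?_]
    swap
    · exact (Z.integrable_lact μ (hwc i) (hws i) t).const_mul _
    have hterm : ∀ i, |∫ x, w i t * w i (Z.lact x⁻¹ t) ∂μ.meas (Z.rng t) - ρ t * ρ t * φ i t|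
        ≤ δ₁ * ρ t * φ i t + ρ t * ρ t * (δ₁ / (s.card + 1)) := by
      intro i
      rw [hwint]
      set I := ∫ x, ρ (Z.lact x⁻¹ t) * φ i (Z.lact x⁻¹ t) ∂μ.meas (Z.rng t) with hI
      have hp := hFε i t
      -- The first term is the error of replacing ρ(x⁻¹t) by ρ(t), the second the error caused by ε
      -- i in the denominator.
      have e1 : ρ t * φ i t / (F i t + ε i) * I - ρ t * ρ t * φ i t =
          ρ t * (φ i t * (I - ρ t * F i t)) / (F i t + ε i) -
            ρ t * ρ t * (φ i t * ε i / (F i t + ε i)) := by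
        field_simp
        ring
      have e2 : |ρ t * (φ i t * (I - ρ t * F i t)) / (F i t + ε i)| ≤ δ₁ * ρ t * φ i t := by
        rw [abs_div, abs_of_pos hp, div_le_iff₀ hp, abs_mul, abs_mul, abs_of_nonneg (hρ0 t),
          abs_of_nonneg (hφ0 i t)]
        have h2 : ρ t * (φ i t * |I - ρ t * F i t|) ≤ ρ t * (δ₁ * F i t * φ i t) := by
          refine mul_le_mul_of_nonneg_left ?_ (hρ0 t)
          rw [mul_comm]
          exact hφd i
        have h3 : 0 ≤ δ₁ * ρ t * φ i t * ε i :=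
          mul_nonneg (mul_nonneg (mul_nonneg hδ₁0.le (hρ0 t)) (hφ0 i t)) (hε0 i).le
        linarith
      have e3 : φ i t * ε i / (F i t + ε i) ≤ δ₁ / (s.card + 1) := by
        rw [div_le_iff₀ hp]
        exact hε i t
      have e4 : 0 ≤ φ i t * ε i / (F i t + ε i) :=
        div_nonneg (mul_nonneg (hφ0 i t) (hε0 i).le) hp.le
      rw [e1]
      refine (abs_sub _ _).trans (add_le_add e2 ?_)
      rw [abs_of_nonneg (mul_nonneg (mul_self_nonneg _) e4)]
      exact mul_le_mul_of_nonneg_left e3 (mul_self_nonneg _)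
    have hsplit : ρ t * ρ t = ∑ i, ρ t * ρ t * φ i t := by rw [← Finset.mul_sum, h1, mul_one]
    conv_lhs => rw [hsplit]
    rw [← Finset.sum_sub_distrib]
    refine (Finset.abs_sum_le_sum_abs _ _).trans ((Finset.sum_le_sum fun i _ => hterm i).trans ?_)
    rw [Finset.sum_add_distrib, ← Finset.mul_sum, h1, Finset.sum_const, Finset.card_univ,
      Fintype.card_coe, nsmul_eq_mul]
    have h5 : (s.card : ℝ) * (ρ t * ρ t * (δ₁ / (s.card + 1))) ≤ δ₁ * (ρ t * ρ t) := by
      have : (s.card : ℝ) * (δ₁ / (s.card + 1)) ≤ δ₁ := by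
        rw [mul_div_assoc', div_le_iff₀ (Nat.cast_add_one_pos s.card)]
        nlinarith
      nlinarith [mul_self_nonneg (ρ t)]
    linarith
  -- the total mass
  have hmass : ∀ t, |∫ x, ∫ h, ∑ i, w i (Z.ract t h) * w i (Z.lact x⁻¹ (Z.ract t h))
      ∂ν.meas (Z.src t) ∂μ.meas (Z.rng t) -
      ∫ h, ρ (Z.ract t h) * ρ (Z.ract t h) ∂ν.meas (Z.src t)| ≤ δ := by
    intro t
    have hk : Integrable (fun p : G × H =>
        ∑ i, w i (Z.ract t p.2) * w i (Z.lact p.1⁻¹ (Z.ract t p.2)))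
        ((μ.meas (Z.rng t)).prod (ν.meas (Z.src t))) :=
      integrable_finsetSum _ fun i _ => Z.integrable_kernel μ ν (hwc i) (hws i) (hwc i) (hws i) t
    have hρi := Z.integrable_ract ν hρ hρc t
    have hρi2 : Integrable (fun h => ρ (Z.ract t h) * ρ (Z.ract t h)) (ν.meas (Z.src t)) :=
      Z.integrable_ract ν (hρ.mul hρ) hρc.mul_left t
    have hk2 : Integrable (fun h => ∫ x, ∑ i, w i (Z.ract t h) * w i (Z.lact x⁻¹ (Z.ract t h))
        ∂μ.meas (Z.rng t)) (ν.meas (Z.src t)) := hk.integral_prod_right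
    -- With the G-integral taken first, the inner integral at h is governed by `hA` at the point t ·
    -- h.
    rw [integral_integral_swap (f := fun x h =>
      ∑ i, w i (Z.ract t h) * w i (Z.lact x⁻¹ (Z.ract t h))) hk, ← integral_sub
      hk2 hρi2, ← Real.norm_eq_abs]
    refine (norm_integral_le_of_norm_le ((hρi.const_mul δ₁).add (hρi2.const_mul δ₁)) ?_).trans ?_
    · filter_upwards [ν.ae_rng (Z.src t)] with h hh
      have := hA (Z.ract t h)
      rw [Z.rng_ract hh.symm] at this
      exact this
    · change ∫ h, (δ₁ * ρ (Z.ract t h) + δ₁ * (ρ (Z.ract t h) * ρ (Z.ract t h))) ∂_ ≤ _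
      rw [integral_add (hρi.const_mul δ₁) (hρi2.const_mul δ₁), integral_const_mul,
        integral_const_mul, ← hδ₁C]
      gcongr
      · exact hC t
      · exact hρ1 t
  refine ⟨s, w, hwc, hws, hw0, fun i t h => (hφV i t (hwφ i t h)).1, fun t => ?_, fun t ht => ?_⟩
  · have h1 := (abs_le.1 (hmass t)).2
    have h2 := hρ1 t
    linarith
  · have := hmass t
    rwa [hρK t ht, abs_sub_comm] at this

end GroupoidEquivalence

/-! ### Sections of an equivalence of Fell bundles -/

/-- Freeness is applied to y⁻¹x. Consequently the bracket [t, t']_G is unique and continuity of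
`lip`, stated with a chosen bracket, transfers to any other description of it. -/
theorem GroupoidEquivalence.lact_right_injective {G H T : Type*} [TopologicalSpace G]
    [TopGroupoid G] [TopologicalSpace H] [TopGroupoid H] [TopologicalSpace T]
    (Z : GroupoidEquivalence G H T) {x y : G} {t : T} (hx : TopGroupoid.src x = Z.rng t)
    (hy : TopGroupoid.src y = Z.rng t) (h : Z.lact x t = Z.lact y t) : x = y := by
  have hr : TopGroupoid.rng x = TopGroupoid.rng y := by rw [← Z.rng_lact hx, h, Z.rng_lact hy]
  have h1 : TopGroupoid.src y⁻¹ = TopGroupoid.rng x := by rw [TopGroupoid.src_inv, hr]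
  have h2 : Z.lact (y⁻¹ * x) t = t := by
    rw [Z.mul_lact h1 hx, h, ← Z.mul_lact (TopGroupoid.src_inv y) hy, inv_mul_self, hy, Z.unit_lact]
  have h3 := Z.free_lact (by rw [TopGroupoid.src_mul h1, hx]) h2
  rw [← mul_inv_mul hr.symm, h3, ← hy, self_mul_src]

namespace FellEquivalence

section Basic

variable {G H T : Type*} [TopologicalSpace G] [TopGroupoid G]
  [TopologicalSpace H] [TopGroupoid H] [TopologicalSpace T] {Z : GroupoidEquivalence G H T}
  {B : G → Type*} [∀ x, NormedAddCommGroup (B x)] [∀ x, NormedSpace ℂ (B x)]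
  [∀ x, CompleteSpace (B x)] [TopologicalSpace (Tot B)] [FellBundle B]
  {C : H → Type*} [∀ h, NormedAddCommGroup (C h)] [∀ h, NormedSpace ℂ (C h)]
  [∀ h, CompleteSpace (C h)] [TopologicalSpace (Tot C)] [FellBundle C]
  {E : T → Type*} [∀ t, NormedAddCommGroup (E t)] [∀ t, NormedSpace ℂ (E t)]
  [∀ t, CompleteSpace (E t)] [TopologicalSpace (Tot E)] [UscBanachBundle E]
  (X : FellEquivalence Z B C E)

theorem tot_lact_congr {x : G} {t t' t'' : T} (h : src x = Z.rng t) (h' : Z.lact x t = t')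
    (h'' : Z.lact x t = t'') (b : B x) (e : E t) :
    (⟨t', X.lact h h' b e⟩ : Tot E) = ⟨t'', X.lact h h'' b e⟩ := by
  subst h'; subst h''; rfl

theorem tot_lip_congr {x y : G} {t t' : T} (hx : src x = Z.rng t') (hx' : Z.lact x t' = t)
    (hy : src y = Z.rng t') (hy' : Z.lact y t' = t) (e : E t) (f : E t') :
    (⟨x, X.lip hx hx' e f⟩ : Tot B) = ⟨y, X.lip hy hy' e f⟩ := by
  obtain rfl := Z.lact_right_injective hx hy (hx'.trans hy'.symm)
  rfl

theorem lip_section_congr (ξ η : ∀ t, E t) {x : G} {t₁ t₂ s₁ s₂ : T} (ht : t₁ = t₂) (hs : s₁ = s₂)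
    (h₁ : src x = Z.rng t₁) (h₂ : src x = Z.rng t₂) (h₁' : Z.lact x t₁ = s₁)
    (h₂' : Z.lact x t₂ = s₂) : X.lip h₁ h₁' (ξ s₁) (η t₁) = X.lip h₂ h₂' (ξ s₂) (η t₂) := by
  subst ht; subst hs; rfl

variable {Y : Type*} {l : Filter Y}

theorem tendsto_lact {f : Y → G} {g k : Y → T} (h : ∀ y, src (f y) = Z.rng (g y))
    (hk : ∀ y, Z.lact (f y) (g y) = k y) {b : ∀ y, B (f y)} {e : ∀ y, E (g y)} {x : G} {t t' : T}
    (hx : src x = Z.rng t) (hx' : Z.lact x t = t') {b₀ : B x} {e₀ : E t}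
    (hb : Tendsto (fun y => (⟨f y, b y⟩ : Tot B)) l (𝓝 ⟨x, b₀⟩))
    (he : Tendsto (fun y => (⟨g y, e y⟩ : Tot E)) l (𝓝 ⟨t, e₀⟩)) :
    Tendsto (fun y => (⟨k y, X.lact (h y) (hk y) (b y) (e y)⟩ : Tot E)) l
      (𝓝 ⟨t', X.lact hx hx' b₀ e₀⟩) := by
  rw [X.tot_lact_congr hx hx' rfl]
  have h1 := (X.continuous_lact.tendsto ⟨((⟨x, b₀⟩ : Tot B), (⟨t, e₀⟩ : Tot E)), hx⟩).comp
    (f := fun y => ⟨((⟨f y, b y⟩ : Tot B), (⟨g y, e y⟩ : Tot E)), h y⟩)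
    (tendsto_subtype_rng.2 (hb.prodMk_nhds he))
  exact h1.congr fun y => X.tot_lact_congr _ _ _ _ _

theorem tendsto_lip {f g : Y → T} {k : Y → G} (h : ∀ y, src (k y) = Z.rng (g y))
    (hk : ∀ y, Z.lact (k y) (g y) = f y) {e : ∀ y, E (f y)} {e' : ∀ y, E (g y)} {x : G} {t t' : T}
    (hx : src x = Z.rng t') (hx' : Z.lact x t' = t) {e₀ : E t} {e₀' : E t'}
    (he : Tendsto (fun y => (⟨f y, e y⟩ : Tot E)) l (𝓝 ⟨t, e₀⟩))
    (he' : Tendsto (fun y => (⟨g y, e' y⟩ : Tot E)) l (𝓝 ⟨t', e₀'⟩)) :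
    Tendsto (fun y => (⟨k y, X.lip (h y) (hk y) (e y) (e' y)⟩ : Tot B)) l
      (𝓝 ⟨x, X.lip hx hx' e₀ e₀'⟩) := by
  have hs : Z.src t = Z.src t' := by rw [← hx', Z.src_lact hx]
  have hsy : ∀ y, Z.src (f y) = Z.src (g y) := fun y => by rw [← hk y, Z.src_lact (h y)]
  rw [X.tot_lip_congr hx hx' (Z.leftBracket_spec hs).1 (Z.leftBracket_spec hs).2]
  have h1 := (X.continuous_lip.tendsto ⟨((⟨t, e₀⟩ : Tot E), (⟨t', e₀'⟩ : Tot E)), hs⟩).comp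
    (f := fun y => ⟨((⟨f y, e y⟩ : Tot E), (⟨g y, e' y⟩ : Tot E)), hsy y⟩)
    (tendsto_subtype_rng.2 (he.prodMk_nhds he'))
  exact h1.congr fun y => X.tot_lip_congr _ _ _ _ _ _

variable [TopologicalSpace Y]

theorem continuous_lact' {f : Y → G} {g k : Y → T} (h : ∀ y, src (f y) = Z.rng (g y))
    (hk : ∀ y, Z.lact (f y) (g y) = k y) {b : ∀ y, B (f y)} {e : ∀ y, E (g y)}
    (hb : Continuous fun y => (⟨f y, b y⟩ : Tot B))
    (he : Continuous fun y => (⟨g y, e y⟩ : Tot E)) :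
    Continuous fun y => (⟨k y, X.lact (h y) (hk y) (b y) (e y)⟩ : Tot E) :=
  continuous_iff_continuousAt.2 fun y => X.tendsto_lact h hk (h y) (hk y)
    (hb.continuousAt (x := y)) (he.continuousAt (x := y))

theorem continuous_lip' {f g : Y → T} {k : Y → G} (h : ∀ y, src (k y) = Z.rng (g y))
    (hk : ∀ y, Z.lact (k y) (g y) = f y) {e : ∀ y, E (f y)} {e' : ∀ y, E (g y)}
    (he : Continuous fun y => (⟨f y, e y⟩ : Tot E))
    (he' : Continuous fun y => (⟨g y, e' y⟩ : Tot E)) :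
    Continuous fun y => (⟨k y, X.lip (h y) (hk y) (e y) (e' y)⟩ : Tot B) :=
  continuous_iff_continuousAt.2 fun y => X.tendsto_lip h hk (h y) (hk y)
    (he.continuousAt (x := y)) (he'.continuousAt (x := y))

end Basic

variable {G H T : Type*} [TopologicalSpace G] [LocallyCompactSpace G] [T2Space G]
  [SecondCountableTopology G] [TopGroupoid G] [MeasurableSpace G] [BorelSpace G]
  [TopologicalSpace H] [LocallyCompactSpace H] [T2Space H]
  [SecondCountableTopology H] [TopGroupoid H] [MeasurableSpace H] [BorelSpace H]
  [TopologicalSpace T] [LocallyCompactSpace T] [T2Space T] {Z : GroupoidEquivalence G H T}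
  {B : G → Type*} [∀ x, NormedAddCommGroup (B x)] [∀ x, NormedSpace ℂ (B x)]
  [∀ x, CompleteSpace (B x)] [TopologicalSpace (Tot B)] [FellBundle B]
  {C : H → Type*} [∀ h, NormedAddCommGroup (C h)] [∀ h, NormedSpace ℂ (C h)]
  [∀ h, CompleteSpace (C h)] [TopologicalSpace (Tot C)] [FellBundle C]
  {E : T → Type*} [∀ t, NormedAddCommGroup (E t)] [∀ t, NormedSpace ℂ (E t)]
  [∀ t, CompleteSpace (E t)] [TopologicalSpace (Tot E)] [UscBanachBundle E]
  (X : FellEquivalence Z B C E) (μ : HaarSystem G) (ν : HaarSystem H)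

open Classical in
/-- The integrand of `sectionInner`. -/
noncomputable def innerIntegrand (ξ η : ∀ t, E t) (x : G) (t : T) (hxt : src x = Z.rng t) (h : H) :
    B x :=
  if hth : Z.src t = rng h then
    X.lip (Z.src_eq_rng_ract hxt hth) rfl (ξ (Z.lact x (Z.ract t h))) (η (Z.ract t h))
  else 0

theorem sectionInner_eq (ξ η : ∀ t, E t) (x : G) (t : T) (hxt : src x = Z.rng t) :
    X.sectionInner ν ξ η x t hxt = ∫ h, X.innerIntegrand ξ η x t hxt h ∂ν.meas (Z.src t) := rfl

theorem continuous_innerIntegrand (ξ η : SectionsCc E) : Continuous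
    fun z : {z : {p : G × T // src p.1 = Z.rng p.2} × H // Z.src z.1.1.2 = rng z.2} =>
      (⟨z.1.1.1.1, X.innerIntegrand ξ.1 η.1 z.1.1.1.1 z.1.1.1.2 z.1.1.2 z.1.2⟩ : Tot B) := by
  have h1 : Continuous
      fun z : {z : {p : G × T // src p.1 = Z.rng p.2} × H // Z.src z.1.1.2 = rng z.2} =>
        Z.ract z.1.1.1.2 z.1.2 :=
    Z.continuous_ract' (fun z => z.2) (by fun_prop) (by fun_prop)
  have h2 : Continuous
      fun z : {z : {p : G × T // src p.1 = Z.rng p.2} × H // Z.src z.1.1.2 = rng z.2} =>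
        Z.lact z.1.1.1.1 (Z.ract z.1.1.1.2 z.1.2) :=
    Z.continuous_lact' (fun z => Z.src_eq_rng_ract z.1.1.2 z.2) (by fun_prop) h1
  refine (X.continuous_lip' (fun z => Z.src_eq_rng_ract z.1.1.2 z.2) (fun z => rfl)
    (ξ.2.1.comp h2) (η.2.1.comp h1)).congr fun z => ?_
  rw [innerIntegrand, dif_pos z.2]

theorem continuousOn_innerIntegrand (ξ η : SectionsCc E) {x : G} {t : T} (hxt : src x = Z.rng t) :
    ContinuousOn (X.innerIntegrand ξ.1 η.1 x t hxt) {h | rng h = Z.src t} := by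
  rw [continuousOn_iff_continuous_domRestrict, ← UscBanachBundle.continuous_fibre_iff (A := B)]
  exact (X.continuous_innerIntegrand ξ η).comp (f := fun h : {h : H | rng h = Z.src t} =>
    (⟨(⟨(x, t), hxt⟩, h.1), h.2.symm⟩ :
      {z : {p : G × T // src p.1 = Z.rng p.2} × H // Z.src z.1.1.2 = rng z.2})) (by fun_prop)

theorem innerIntegrand_eq_zero (ξ η : ∀ t, E t) {x : G} {t : T} (hxt : src x = Z.rng t) {h : H}
    (hh : η (Z.ract t h) = 0) : X.innerIntegrand ξ η x t hxt h = 0 := by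
  rw [innerIntegrand]
  split_ifs
  · rw [hh, map_zero]
  · rfl

theorem integrable_innerIntegrand (ξ η : SectionsCc E) {x : G} {t : T} (hxt : src x = Z.rng t) :
    Integrable (X.innerIntegrand ξ.1 η.1 x t hxt) (ν.meas (Z.src t)) := by
  refine ν.integrable (X.continuousOn_innerIntegrand ξ η hxt)
    (Z.isCompact_rightBracket (isCompact_singleton (x := t)) η.2.2) fun h hh hhK => ?_
  refine X.innerIntegrand_eq_zero _ _ _ ?_
  by_contra hne
  exact hhK ⟨t, rfl, hh.symm, subset_closure hne⟩

theorem continuous_sectionInner (ξ η : SectionsCc E) : Continuous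
    fun p : {p : G × T // src p.1 = Z.rng p.2} =>
      (⟨p.1.1, X.sectionInner ν ξ.1 η.1 p.1.1 p.1.2 p.2⟩ : Tot B) := by
  refine ν.continuous_integral_bundle (p := fun p : {p : G × T // src p.1 = Z.rng p.2} =>
    Z.src p.1.2) (Z.continuous_src.comp (by fun_prop)) (q := fun p => p.1.1) (by fun_prop)
    (F := fun p h => X.innerIntegrand ξ.1 η.1 p.1.1 p.1.2 p.2 h)
    (X.continuous_innerIntegrand ξ η) fun p₀ => ?_
  obtain ⟨N, hN, hNt⟩ := exists_compact_mem_nhds p₀.1.2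
  refine ⟨{p | p.1.2 ∈ N}, (continuous_snd.comp continuous_subtype_val).continuousAt hNt, _,
    Z.isCompact_rightBracket hN η.2.2, fun p hp h hh hhK => ?_⟩
  refine X.innerIntegrand_eq_zero _ _ _ ?_
  by_contra hne
  exact hhK ⟨p.1.2, hp, hh, subset_closure hne⟩

/-- Moving the base point by k amounts to the translation h ↦ kh in the integral. -/
theorem sectionInner_ract (ξ η : SectionsCc E) {x : G} {t : T} {k : H} (hk : Z.src t = rng k)
    (hxt : src x = Z.rng t) (hxtk : src x = Z.rng (Z.ract t k)) :
    X.sectionInner ν ξ.1 η.1 x (Z.ract t k) hxtk = X.sectionInner ν ξ.1 η.1 x t hxt := by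
  have h1 := X.continuousOn_innerIntegrand ξ η hxt
  rw [hk] at h1
  rw [sectionInner_eq, sectionInner_eq, hk, ← ν.integral_mul_left k h1, Z.src_ract hk]
  refine integral_congr_ae ?_
  filter_upwards [ν.ae_rng (src k)] with h hh
  have h2 : Z.src (Z.ract t k) = rng h := by rw [Z.src_ract hk, hh]
  have h3 : Z.src t = rng (k * h) := by rw [rng_mul hh.symm, hk]
  rw [innerIntegrand, innerIntegrand, dif_pos h2, dif_pos h3]
  have h4 := (Z.ract_mul hk hh.symm).symm
  exact X.lip_section_congr _ _ h4 (by rw [h4]) _ _ _ _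

theorem sectionInner_indep (ξ η : SectionsCc E) {x : G} {t t' : T} (hxt : src x = Z.rng t)
    (hxt' : src x = Z.rng t') :
    X.sectionInner ν ξ.1 η.1 x t hxt = X.sectionInner ν ξ.1 η.1 x t' hxt' := by
  obtain ⟨k, hk, rfl⟩ := Z.exists_ract (hxt.symm.trans hxt')
  exact (X.sectionInner_ract ν ξ η hk hxt hxt').symm

theorem exists_rng_eq (Z : GroupoidEquivalence G H T) (x : G) : ∃ t, src x = Z.rng t :=
  (Z.surjective_rng (src x)).imp fun _ h => h.symm

/-- The section `⟪ξ, η⟫` of `B`. -/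
noncomputable def innerSection (ξ η : SectionsCc E) (x : G) : B x :=
  X.sectionInner ν ξ.1 η.1 x _ (exists_rng_eq Z x).choose_spec

theorem innerSection_eq (ξ η : SectionsCc E) (x : G) (t : T) (hxt : src x = Z.rng t) :
    X.innerSection ν ξ η x = X.sectionInner ν ξ.1 η.1 x t hxt :=
  X.sectionInner_indep ν ξ η _ hxt

theorem innerSection_eq_zero (ξ η : SectionsCc E) {x : G} (h : ∀ t, src x = Z.rng t →
    ξ.1 (Z.lact x t) = 0 ∨ η.1 t = 0) : X.innerSection ν ξ η x = 0 := by
  rw [innerSection, sectionInner_eq]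
  refine integral_eq_zero_of_ae (.of_forall fun k => ?_)
  rw [innerIntegrand]
  split_ifs with hk
  · rcases h _ (Z.src_eq_rng_ract (exists_rng_eq Z x).choose_spec hk) with h0 | h0 <;> simp [h0]
  · rfl

/-- Joint continuity in (x, t) descends to x because r : T → G⁰ is open: for x near x₀ there is a
base point near t₀ over s(x). The support is compact by properness of the G-action. -/
theorem innerSection_mem (ξ η : SectionsCc E) : X.innerSection ν ξ η ∈ SectionsCc B := by
  refine ⟨continuous_iff_continuousAt.2 fun x₀ => ?_, ?_⟩
  · obtain ⟨t₀, ht₀⟩ := exists_rng_eq Z x₀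
    have h1 := (X.continuous_sectionInner ν ξ η).continuousAt (x := ⟨(x₀, t₀), ht₀⟩)
    intro U hU
    simp only [X.innerSection_eq ν ξ η x₀ t₀ ht₀] at hU
    have h2 := h1 hU
    rw [mem_map, nhds_subtype_eq_comap, mem_comap] at h2
    obtain ⟨S, hS, hSU⟩ := h2
    obtain ⟨O, hO, V, hV, hOV⟩ := mem_nhds_prod_iff.1 hS
    have h3 : Z.rng '' V ∈ 𝓝 (src x₀) := by
      rw [ht₀]
      exact Z.isOpenMap_rng.image_mem_nhds hV
    rw [mem_map]
    filter_upwards [hO, TopGroupoid.continuous_src.continuousAt h3] with x hx hxV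
    obtain ⟨t, ht, hxt⟩ := hxV
    change (⟨x, X.innerSection ν ξ η x⟩ : Tot B) ∈ U
    rw [X.innerSection_eq ν ξ η x t hxt.symm]
    exact hSU (a := ⟨(x, t), hxt.symm⟩) (hOV ⟨hx, ht⟩)
  · refine (Z.isCompact_leftBracket ξ.2.2 η.2.2).closure_of_subset fun x hx => ?_
    by_contra hne
    refine hx (X.innerSection_eq_zero ν ξ η fun t ht => ?_)
    by_contra! h
    exact hne ⟨t, subset_closure h.2, ht, subset_closure h.1⟩

open Classical in
/-- The integrand of `sectionAction`. -/
noncomputable def actionIntegrand (f : ∀ x, B x) (ξ : ∀ t, E t) (t : T) (x : G) : E t :=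
  if h : rng x = Z.rng t then
    X.lact (Z.comp_inv_lact h) (Z.lact_inv_lact h) (f x) (ξ (Z.lact x⁻¹ t))
  else 0

theorem sectionAction_eq (f : ∀ x, B x) (ξ : ∀ t, E t) (t : T) :
    X.sectionAction μ f ξ t = ∫ x, X.actionIntegrand f ξ t x ∂μ.meas (Z.rng t) := rfl

theorem actionIntegrand_eq_zero {f : ∀ x, B x} (ξ : ∀ t, E t) (t : T) {x : G} (hx : f x = 0) :
    X.actionIntegrand f ξ t x = 0 := by
  rw [actionIntegrand]
  split_ifs
  · rw [hx, map_zero, LinearMap.zero_apply]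
  · rfl

theorem continuous_actionIntegrand (f : SectionsCc B) (ξ : SectionsCc E) : Continuous
    fun z : {z : T × G // Z.rng z.1 = rng z.2} =>
      (⟨z.1.1, X.actionIntegrand f.1 ξ.1 z.1.1 z.1.2⟩ : Tot E) := by
  have h1 : Continuous fun z : {z : T × G // Z.rng z.1 = rng z.2} => Z.lact z.1.2⁻¹ z.1.1 :=
    Z.continuous_lact' (fun z => by rw [TopGroupoid.src_inv]; exact z.2.symm)
      (continuous_inv'.comp (by fun_prop)) (by fun_prop)
  have h2 : Continuous fun z : {z : T × G // Z.rng z.1 = rng z.2} => z.1.2 := by fun_prop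
  refine (X.continuous_lact' (fun z : {z : T × G // Z.rng z.1 = rng z.2} =>
    Z.comp_inv_lact z.2.symm) (fun z => Z.lact_inv_lact z.2.symm)
    (f.2.1.comp h2) (ξ.2.1.comp h1)).congr fun z => ?_
  rw [actionIntegrand, dif_pos z.2.symm]

theorem continuousOn_actionIntegrand (f : SectionsCc B) (ξ : SectionsCc E) (t : T) :
    ContinuousOn (X.actionIntegrand f.1 ξ.1 t) {x | rng x = Z.rng t} := by
  rw [continuousOn_iff_continuous_domRestrict, ← UscBanachBundle.continuous_fibre_iff (A := E)]
  exact (X.continuous_actionIntegrand f ξ).comp (f := fun x : {x : G | rng x = Z.rng t} =>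
    (⟨(t, x.1), x.2.symm⟩ : {z : T × G // Z.rng z.1 = rng z.2})) (by fun_prop)

theorem integrable_actionIntegrand (f : SectionsCc B) (ξ : SectionsCc E) (t : T) :
    Integrable (X.actionIntegrand f.1 ξ.1 t) (μ.meas (Z.rng t)) :=
  μ.integrable (X.continuousOn_actionIntegrand f ξ t) f.2.2 fun _ _ hxK =>
    X.actionIntegrand_eq_zero _ _ (by_contra fun hne => hxK (subset_closure hne))

theorem sectionAction_eq_zero (f : ∀ x, B x) (ξ : ∀ t, E t) {t : T}
    (h : ∀ x, rng x = Z.rng t → f x = 0 ∨ ξ (Z.lact x⁻¹ t) = 0) :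
    X.sectionAction μ f ξ t = 0 := by
  rw [sectionAction_eq]
  refine integral_eq_zero_of_ae (.of_forall fun x => ?_)
  rw [actionIntegrand]
  split_ifs with hx
  · rcases h x hx with h0 | h0 <;> simp [h0]
  · rfl

theorem sectionAction_mem (f : SectionsCc B) (ξ : SectionsCc E) :
    X.sectionAction μ f.1 ξ.1 ∈ SectionsCc E := by
  constructor
  · refine μ.continuous_integral_bundle Z.continuous_rng (q := fun t => t) continuous_id
      (F := fun t x => X.actionIntegrand f.1 ξ.1 t x) (X.continuous_actionIntegrand f ξ)
      fun t₀ => ⟨Set.univ, univ_mem, _, f.2.2, fun t _ x _ hxK => ?_⟩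
    exact X.actionIntegrand_eq_zero _ _ (by_contra fun hne => hxK (subset_closure hne))
  · refine (Z.isCompact_lact_image f.2.2 ξ.2.2).closure_of_subset fun t ht => ?_
    by_contra hne
    refine ht (X.sectionAction_eq_zero μ f.1 ξ.1 fun x hx => ?_)
    by_contra! h
    exact hne ⟨x, subset_closure h.1, Z.lact x⁻¹ t, subset_closure h.2, Z.comp_inv_lact hx,
      Z.lact_inv_lact hx⟩

end FellEquivalence

/-! ### Local approximate units -/

namespace FellEquivalence

variable {G H T : Type*} [TopologicalSpace G] [T2Space G] [TopGroupoid G]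
  [TopologicalSpace H] [TopGroupoid H] [TopologicalSpace T] [T2Space T]
  {Z : GroupoidEquivalence G H T}
  {B : G → Type*} [∀ x, NormedAddCommGroup (B x)] [∀ x, NormedSpace ℂ (B x)]
  [∀ x, CompleteSpace (B x)] [TopologicalSpace (Tot B)] [FellBundle B]
  {C : H → Type*} [∀ h, NormedAddCommGroup (C h)] [∀ h, NormedSpace ℂ (C h)]
  [∀ h, CompleteSpace (C h)] [TopologicalSpace (Tot C)] [FellBundle C]
  {E : T → Type*} [∀ t, NormedAddCommGroup (E t)] [∀ t, NormedSpace ℂ (E t)]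
  [∀ t, CompleteSpace (E t)] [TopologicalSpace (Tot E)] [UscBanachBundle E]
  (X : FellEquivalence Z B C E)

theorem exists_norm_sub_lact_le (t : T) (e : E t) {δ : ℝ} (hδ : 0 < δ) :
    ∃ b : B (Z.rng t : G), ‖e - X.lact (src_unit (Z.rng t)) (Z.unit_lact t) b e‖ ≤ δ := by
  let := FellStructure.cstarAlgebra B (Z.rng t)
  let := FellStructure.cstarAlgebra C (Z.src t)
  exact (X.imprimitivity t).exists_norm_sub_actL_le e hδ

theorem exists_approx_unit (t : T) (S : Finset (B (Z.rng t : G))) {δ : ℝ} (hδ : 0 < δ) :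
    ∃ (s : Finset (E t)) (ζ : E t → E t),
      ‖∑ e ∈ s, X.lip (src_unit (Z.rng t)) (Z.unit_lact t) (ζ e) (ζ e)‖ ≤ 1 ∧
      ∀ b ∈ S, ‖b - FellStructure.bmul (src_unit_eq_rng (Z.rng t)) (unit_mul_unit (Z.rng t))
        (∑ e ∈ s, X.lip (src_unit (Z.rng t)) (Z.unit_lact t) (ζ e) (ζ e)) b‖ ≤ δ := by
  let := FellStructure.cstarAlgebra B (Z.rng t)
  let := FellStructure.cstarAlgebra C (Z.src t)
  exact (X.imprimitivity t).exists_approx_unit S hδ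

/-- The compactly many values of `η` over a unit `u` are almost fixed by every contraction that
almost fixes a suitable finite subset of `B(u)`. -/
theorem exists_finset_norm_sub_lact_le (η : SectionsCc E) (u : unitSpace G) {δ : ℝ} (hδ : 0 < δ) :
    ∃ (S : Finset (B (u : G))) (δ' : ℝ), 0 < δ' ∧ ∀ a : B (u : G), ‖a‖ ≤ 1 →
      (∀ b ∈ S, ‖b - FellStructure.bmul (src_unit_eq_rng u) (unit_mul_unit u) a b‖ ≤ δ') →
      ∀ (t : T) (h : src (u : G) = Z.rng t) (h' : Z.lact u t = t),
        ‖η.1 t - X.lact h h' a (η.1 t)‖ < δ := by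
  classical
  obtain ⟨M, hM0, hM⟩ := UscBanachBundle.exists_bound η
  let F := {t : T // Z.rng t = u}
  have hF : ∀ t : F, src (u : G) = Z.rng t.1 := fun t => by rw [src_unit, t.2]
  have hF' : ∀ t : F, Z.lact u t.1 = t.1 := fun t => by
    have := Z.unit_lact t.1
    rwa [t.2] at this
  have hcl : IsClosed {t : T | Z.rng t = u} := isClosed_singleton.preimage Z.continuous_rng
  have hK : IsCompact {t : F | t.1 ∈ closure {t | η.1 t ≠ 0}} :=
    hcl.isClosedEmbedding_subtypeVal.isCompact_preimage η.2.2
  -- Some b almost fixes η at t, hence at nearby points over u; compactness of the support over u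
  -- leaves finitely many such b.
  have key : ∀ t : F, ∃ b : B (u : G),
      {t' : F | ‖η.1 t'.1 - X.lact (hF t') (hF' t') b (η.1 t'.1)‖ < δ / 4} ∈ 𝓝 t := by
    rintro ⟨t, ht⟩
    subst ht
    obtain ⟨b, hb⟩ := X.exists_norm_sub_lact_le t (η.1 t) (δ := δ / 8) (by positivity)
    refine ⟨b, ?_⟩
    have h1 : Continuous fun t' : {t' // Z.rng t' = Z.rng t} => (⟨t'.1, η.1 t'.1⟩ : Tot E) :=
      η.2.1.comp continuous_subtype_val
    have h2 : Continuous fun t' : {t' // Z.rng t' = Z.rng t} =>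
        (⟨t'.1, X.lact (hF t') (hF' t') b (η.1 t'.1)⟩ : Tot E) :=
      X.continuous_lact' hF hF' (b := fun _ => b) continuous_const h1
    have h3 := (UscBanachBundle.continuous_sub' h1 h2).continuousAt (x := ⟨t, rfl⟩)
    exact UscBanachBundle.eventually_norm_lt (x₀ := t)
      (a := η.1 t - X.lact (src_unit (Z.rng t)) (Z.unit_lact t) b (η.1 t)) h3
      (hb.trans_lt (by linarith))
  choose b hb using key
  obtain ⟨s, -, hs⟩ := hK.elim_nhds_subcover _ fun t _ => hb t
  -- With b belonging to a neighbourhood of t, η − aη = (η − bη) + (b − ab)η − a(η − bη). The outer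
  -- terms are at most δ/4 since ‖a‖ ≤ 1, the middle one since ‖η‖ ≤ M.
  refine ⟨s.image b, δ / (4 * (M + 1)), by positivity, fun a ha hab t h h' => ?_⟩
  have htu : Z.rng t = u := by rw [← h, src_unit]
  by_cases h0 : η.1 t = 0
  · simpa [h0] using hδ
  obtain ⟨t₁, ht₁, hlt⟩ := Set.mem_iUnion₂.1 (hs (show (⟨t, htu⟩ : F) ∈
    {t : F | t.1 ∈ closure {t | η.1 t ≠ 0}} from subset_closure h0))
  have h1 : ‖η.1 t - X.lact h h' (b t₁) (η.1 t)‖ < δ / 4 := hlt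
  have h2 := hab (b t₁) (Finset.mem_image_of_mem _ ht₁)
  have h3 : η.1 t - X.lact h h' a (η.1 t) = (η.1 t - X.lact h h' (b t₁) (η.1 t)) +
      X.lact h h' (b t₁ - FellStructure.bmul (src_unit_eq_rng u) (unit_mul_unit u) a (b t₁))
        (η.1 t) - X.lact h h' a (η.1 t - X.lact h h' (b t₁) (η.1 t)) := by
    rw [map_sub (X.lact h h' a), X.lact_lact h h' h h' (src_unit_eq_rng u) (unit_mul_unit u) h h',
      map_sub, LinearMap.sub_apply]
    abel
  have h4 : ‖X.lact h h' (b t₁ - FellStructure.bmul (src_unit_eq_rng u) (unit_mul_unit u) a (b t₁))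
        (η.1 t)‖ ≤ δ / 4 := by
    refine (X.norm_lact_le h h' _ _).trans ((mul_le_mul h2 (hM t) (norm_nonneg _)
      (by positivity)).trans ?_)
    rw [div_mul_eq_mul_div, div_le_iff₀ (by positivity)]
    nlinarith
  have h5 : ‖X.lact h h' a (η.1 t - X.lact h h' (b t₁) (η.1 t))‖ ≤ δ / 4 := by
    refine (X.norm_lact_le h h' _ _).trans ((mul_le_mul ha h1.le (norm_nonneg _)
      zero_le_one).trans ?_)
    rw [one_mul]
  rw [h3]
  refine (norm_sub_le _ _).trans_lt ?_
  have := norm_add_le (η.1 t - X.lact h h' (b t₁) (η.1 t)) (X.lact h h' (b t₁ -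
    FellStructure.bmul (src_unit_eq_rng u) (unit_mul_unit u) a (b t₁)) (η.1 t))
  linarith

theorem exists_finset_forall_norm_sub_lact_le (P : Finset (SectionsCc E)) (u : unitSpace G) {δ : ℝ}
    (hδ : 0 < δ) :
    ∃ (S : Finset (B (u : G))) (δ' : ℝ), 0 < δ' ∧ ∀ a : B (u : G), ‖a‖ ≤ 1 →
      (∀ b ∈ S, ‖b - FellStructure.bmul (src_unit_eq_rng u) (unit_mul_unit u) a b‖ ≤ δ') →
      ∀ η ∈ P, ∀ (t : T) (h : src (u : G) = Z.rng t) (h' : Z.lact u t = t),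
        ‖η.1 t - X.lact h h' a (η.1 t)‖ < δ := by
  classical
  choose S δ' hδ' hS using fun η : SectionsCc E => X.exists_finset_norm_sub_lact_le η u hδ
  induction P using Finset.induction_on with
  | empty => exact ⟨∅, 1, one_pos, by simp⟩
  | insert η P _ ih =>
    obtain ⟨S₁, δ₁, hδ₁, h₁⟩ := ih
    refine ⟨S η ∪ S₁, min (δ' η) δ₁, lt_min (hδ' η) hδ₁, fun a ha hab ζ hζ => ?_⟩
    rcases Finset.mem_insert.1 hζ with rfl | hζ
    · exact hS ζ a ha fun b hb =>
        (hab b (Finset.mem_union_left _ hb)).trans (min_le_left _ _)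
    · exact h₁ a ha (fun b hb =>
        (hab b (Finset.mem_union_right _ hb)).trans (min_le_right _ _)) ζ hζ

variable {H' T' : Type*} [TopologicalSpace H'] [TopGroupoid H'] [TopologicalSpace T'] [T2Space T']
  {Z' : GroupoidEquivalence G H' T'}
  {C' : H' → Type*} [∀ h, NormedAddCommGroup (C' h)] [∀ h, NormedSpace ℂ (C' h)]
  [∀ h, CompleteSpace (C' h)] [TopologicalSpace (Tot C')] [FellBundle C']
  {E' : T' → Type*} [∀ t, NormedAddCommGroup (E' t)] [∀ t, NormedSpace ℂ (E' t)]
  [∀ t, CompleteSpace (E' t)] [TopologicalSpace (Tot E')] [UscBanachBundle E']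
  (X' : FellEquivalence Z' B C' E')

/-- The elements `∑ ⟨ζ(x · τ), ζ(τ)⟩` almost fix `η` for `τ` and `x · τ` close to `t₀`, if they do
so for `x · τ = τ = t₀`. -/
theorem exists_nhds_norm_sub_lact_lt {J : Type*} [Fintype J] {t₀ : T} {ζ : J → ∀ t, E t}
    (hζ : ∀ j, Continuous fun t => (⟨t, ζ j t⟩ : Tot E)) (η : SectionsCc E') {δ : ℝ} (hδ : 0 < δ)
    (h₀ : ∀ (t : T') (h : src (Z.rng t₀ : G) = Z'.rng t) (h' : Z'.lact (Z.rng t₀ : G) t = t),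
      ‖η.1 t - X'.lact h h' (∑ j, X.lip (src_unit (Z.rng t₀)) (Z.unit_lact t₀) (ζ j t₀) (ζ j t₀))
        (η.1 t)‖ < δ) :
    ∃ V ∈ 𝓝 t₀, ∀ (x : G) (τ : T) (hτ : src x = Z.rng τ), τ ∈ V → Z.lact x τ ∈ V →
      ∀ (t t' : T') (h : src x = Z'.rng t) (h' : Z'.lact x t = t'),
        ‖η.1 t' - X'.lact h h' (∑ j, X.lip hτ rfl (ζ j (Z.lact x τ)) (ζ j τ)) (η.1 t)‖ < δ := by
  let D := {d : G × T × T' // src d.1 = Z.rng d.2.1 ∧ src d.1 = Z'.rng d.2.2}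
  let m : D → T × T := fun d => (d.1.2.1, Z.lact d.1.1 d.1.2.1)
  let N : D → ℝ := fun d => ‖η.1 (Z'.lact d.1.1 d.1.2.2) - X'.lact d.2.2 rfl
    (∑ j, X.lip d.2.1 rfl (ζ j (Z.lact d.1.1 d.1.2.1)) (ζ j d.1.2.1)) (η.1 d.1.2.2)‖
  suffices h : ∀ᶠ d in comap m (𝓝 t₀ ×ˢ 𝓝 t₀), N d < δ by
    rw [eventually_comap] at h
    obtain ⟨V, hV, hVN⟩ := mem_prod_self_iff.1 h
    refine ⟨V, hV, fun x τ hτ h1 h2 t t' h h' => ?_⟩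
    subst h'
    exact hVN (Set.mk_mem_prod h1 h2) ⟨(x, τ, t), hτ, h⟩ rfl
  -- Along an ultrafilter of counterexamples τ and xτ tend to t₀, so x tends to r(t₀). Failure of
  -- the estimate forces η to be nonzero at t or at xt; compactness of its support makes that point
  -- converge, and hence t converges to some t₁ over r(t₀). There `h₀` and upper semicontinuity of
  -- the norm contradict the failure.
  by_contra hcon
  have hne : NeBot (comap m (𝓝 t₀ ×ˢ 𝓝 t₀) ⊓ 𝓟 {d | ¬ N d < δ}) :=
    frequently_mem_iff_neBot.1 (not_eventually.1 hcon)
  obtain ⟨𝒰, h𝒰₀⟩ := exists_ultrafilter_le (comap m (𝓝 t₀ ×ˢ 𝓝 t₀) ⊓ 𝓟 {d | ¬ N d < δ})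
  have h𝒰 := h𝒰₀.trans inf_le_left
  have hbad : ∀ᶠ d in (𝒰 : Filter D), ¬ N d < δ := le_principal_iff.1 (h𝒰₀.trans inf_le_right)
  have hτ : Tendsto (fun d : D => d.1.2.1) 𝒰 (𝓝 t₀) :=
    (tendsto_fst.comp (tendsto_comap (f := m))).mono_left h𝒰
  have hxτ : Tendsto (fun d : D => Z.lact d.1.1 d.1.2.1) 𝒰 (𝓝 t₀) :=
    (tendsto_snd.comp (tendsto_comap (f := m))).mono_left h𝒰
  have hx : Tendsto (fun d : D => d.1.1) 𝒰 (𝓝 (Z.rng t₀ : G)) :=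
    Z.tendsto_unit_of_tendsto (fun d => d.2.1) hτ hxτ
  have hor : ∀ᶠ d : D in 𝒰, η.1 d.1.2.2 ≠ 0 ∨ η.1 (Z'.lact d.1.1 d.1.2.2) ≠ 0 := by
    filter_upwards [hbad] with d hd
    by_contra! h0
    refine hd ?_
    simp only [N, h0.1, h0.2, map_zero, sub_zero, norm_zero]
    exact hδ
  obtain ⟨t₁, ht₁, ht⟩ : ∃ t₁, Z'.rng t₁ = Z.rng t₀ ∧
      Tendsto (fun d : D => d.1.2.2) 𝒰 (𝓝 t₁) := by
    rcases Ultrafilter.eventually_or.1 hor with h1 | h1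
    · obtain ⟨t₁, -, ht₁⟩ := η.2.2.ultrafilter_le_nhds (𝒰.map fun d : D => d.1.2.2)
        (by
          rw [le_principal_iff, Ultrafilter.coe_map, mem_map]
          filter_upwards [h1] with d hd
          exact subset_closure hd)
      have ht₁' : Tendsto (fun d : D => d.1.2.2) 𝒰 (𝓝 t₁) := ht₁
      refine ⟨t₁, ?_, ht₁'⟩
      refine tendsto_nhds_unique (((Z'.continuous_rng.tendsto t₁).comp ht₁').congr fun d =>
        d.2.2.symm) ?_
      have := (TopGroupoid.continuous_src.tendsto _).comp hx
      rwa [src_unit] at this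
    · obtain ⟨t₁, -, ht₁⟩ := η.2.2.ultrafilter_le_nhds
        (𝒰.map fun d : D => Z'.lact d.1.1 d.1.2.2)
        (by
          rw [le_principal_iff, Ultrafilter.coe_map, mem_map]
          filter_upwards [h1] with d hd
          exact subset_closure hd)
      have ht₁' : Tendsto (fun d : D => Z'.lact d.1.1 d.1.2.2) 𝒰 (𝓝 t₁) := ht₁
      have hr : Z'.rng t₁ = Z.rng t₀ := by
        refine tendsto_nhds_unique (((Z'.continuous_rng.tendsto t₁).comp ht₁').congr fun d =>
          Z'.rng_lact d.2.2) ?_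
        have := (TopGroupoid.continuous_rng.tendsto _).comp hx
        rwa [rng_unit] at this
      have hinv : Tendsto (fun d : D => d.1.1⁻¹) 𝒰 (𝓝 (Z.rng t₀ : G)) := by
        have := (continuous_inv'.tendsto _).comp hx
        rwa [unit_inv] at this
      refine ⟨t₁, hr, ?_⟩
      have := Z'.tendsto_lact (fun d : D => by rw [TopGroupoid.src_inv, Z'.rng_lact d.2.2])
        (by rw [src_unit, hr]) hinv ht₁'
      rw [← hr, Z'.unit_lact] at this
      refine this.congr fun d => ?_
      rw [← Z'.mul_lact (TopGroupoid.src_inv _) d.2.2, inv_mul_self, d.2.2, Z'.unit_lact]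
  have hs₁ : src (Z.rng t₀ : G) = Z'.rng t₁ := by rw [src_unit, ht₁]
  have hu₁ : Z'.lact (Z.rng t₀ : G) t₁ = t₁ := by rw [← ht₁, Z'.unit_lact]
  have hxt : Tendsto (fun d : D => Z'.lact d.1.1 d.1.2.2) 𝒰 (𝓝 t₁) := by
    have := Z'.tendsto_lact (fun d : D => d.2.2) hs₁ hx ht
    rwa [hu₁] at this
  have hlip := UscBanachBundle.tendsto_sum Finset.univ hx fun j _ =>
    X.tendsto_lip (fun d : D => d.2.1) (fun d => rfl) (src_unit (Z.rng t₀)) (Z.unit_lact t₀)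
    (((hζ j).tendsto t₀).comp hxτ) (((hζ j).tendsto t₀).comp hτ)
  have hlact := X'.tendsto_lact (fun d : D => d.2.2) (fun d => rfl) hs₁ hu₁ hlip
    ((η.2.1.tendsto t₁).comp ht)
  have hfin := UscBanachBundle.eventually_norm_lt
    (UscBanachBundle.tendsto_sub ((η.2.1.tendsto t₁).comp hxt) hlact) (h₀ t₁ hs₁ hu₁)
  obtain ⟨d, hd1, hd2⟩ := (hbad.and hfin).exists
  exact hd1 hd2

end FellEquivalence

/-! ### The main estimate -/

/-- The product of a section with a compactly supported scalar function. -/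
def SectionsCc.ofSmul {X : Type*} [TopologicalSpace X] {A : X → Type*}
    [∀ x, NormedAddCommGroup (A x)] [∀ x, NormedSpace ℂ (A x)] [∀ x, CompleteSpace (A x)]
    [TopologicalSpace (Tot A)] [UscBanachBundle A] {w : X → ℝ} (hw : Continuous w)
    (hwc : HasCompactSupport w) {ζ : ∀ x, A x} (hζ : Continuous fun x => (⟨x, ζ x⟩ : Tot A)) :
    SectionsCc A :=
  ⟨fun x => (w x : ℂ) • ζ x, UscBanachBundle.continuous_smul' (Complex.continuous_ofReal.comp hw) hζ,
    hwc.isCompact.of_isClosed_subset isClosed_closure (closure_mono fun x hx h => hx (by simp [h]))⟩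

namespace FellEquivalence

variable {G H T : Type*} [TopologicalSpace G] [LocallyCompactSpace G] [T2Space G]
  [SecondCountableTopology G] [TopGroupoid G] [MeasurableSpace G] [BorelSpace G]
  [TopologicalSpace H] [LocallyCompactSpace H] [T2Space H]
  [SecondCountableTopology H] [TopGroupoid H] [MeasurableSpace H] [BorelSpace H]
  [TopologicalSpace T] [LocallyCompactSpace T] [T2Space T] {Z : GroupoidEquivalence G H T}
  {B : G → Type*} [∀ x, NormedAddCommGroup (B x)] [∀ x, NormedSpace ℂ (B x)]
  [∀ x, CompleteSpace (B x)] [TopologicalSpace (Tot B)] [FellBundle B]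
  {C : H → Type*} [∀ h, NormedAddCommGroup (C h)] [∀ h, NormedSpace ℂ (C h)]
  [∀ h, CompleteSpace (C h)] [TopologicalSpace (Tot C)] [FellBundle C]
  {E : T → Type*} [∀ t, NormedAddCommGroup (E t)] [∀ t, NormedSpace ℂ (E t)]
  [∀ t, CompleteSpace (E t)] [TopologicalSpace (Tot E)] [UscBanachBundle E]
  (X : FellEquivalence Z B C E) (μ : HaarSystem G) (ν : HaarSystem H)
  {H' T' : Type*} [TopologicalSpace H'] [LocallyCompactSpace H'] [T2Space H']
  [SecondCountableTopology H'] [TopGroupoid H'] [MeasurableSpace H'] [BorelSpace H']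
  [TopologicalSpace T'] [LocallyCompactSpace T'] [T2Space T']
  {Z' : GroupoidEquivalence G H' T'}
  {C' : H' → Type*} [∀ h, NormedAddCommGroup (C' h)] [∀ h, NormedSpace ℂ (C' h)]
  [∀ h, CompleteSpace (C' h)] [TopologicalSpace (Tot C')] [FellBundle C']
  {E' : T' → Type*} [∀ t, NormedAddCommGroup (E' t)] [∀ t, NormedSpace ℂ (E' t)]
  [∀ t, CompleteSpace (E' t)] [TopologicalSpace (Tot E')] [UscBanachBundle E']
  (X' : FellEquivalence Z' B C' E')

/-- The action of `B x` on a fixed vector, as a continuous linear map. -/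
noncomputable def lactCLM {x : G} {t t' : T'} (h : src x = Z'.rng t) (h' : Z'.lact x t = t')
    (e : E' t) : B x →L[ℂ] E' t' :=
  LinearMap.mkContinuous ((X'.lact h h').flip e) ‖e‖ fun b => by
    rw [mul_comm]
    exact X'.norm_lact_le h h' b e

variable {I : Type*} [Fintype I] {J : I → Type*} [∀ i, Fintype (J i)] {w : I → T → ℝ}
  (hw : ∀ i, Continuous (w i)) (hwc : ∀ i, HasCompactSupport (w i))
  {ζ : ∀ i, J i → ∀ t, E t} (hζ : ∀ i j, Continuous fun t => (⟨t, ζ i j t⟩ : Tot E))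

/-- The base point x⁻¹t lies over s(x), and with it the first argument of the inner product is th,
independent of x. The real weights come out of both slots without conjugation. -/
theorem innerIntegrand_ofSmul (i : I) (j : J i) {x : G} {t : T} (hx : rng x = Z.rng t) {h : H}
    (hh : rng h = Z.src t) (hxt : src x = Z.rng (Z.lact x⁻¹ t))
    (hτ : src x = Z.rng (Z.lact x⁻¹ (Z.ract t h))) :
    X.innerIntegrand (SectionsCc.ofSmul (hw i) (hwc i) (hζ i j)).1
      (SectionsCc.ofSmul (hw i) (hwc i) (hζ i j)).1 x (Z.lact x⁻¹ t) hxt h =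
    ((w i (Z.ract t h) * w i (Z.lact x⁻¹ (Z.ract t h)) : ℝ) : ℂ) •
      X.lip hτ rfl (ζ i j (Z.lact x (Z.lact x⁻¹ (Z.ract t h)))) (ζ i j (Z.lact x⁻¹ (Z.ract t h))) := by
  have h1 : Z.src (Z.lact x⁻¹ t) = rng h := by
    rw [Z.src_lact (by rw [TopGroupoid.src_inv, hx]), hh]
  have h2 : Z.ract (Z.lact x⁻¹ t) h = Z.lact x⁻¹ (Z.ract t h) := (Z.lact_inv_ract hx hh).symm
  rw [innerIntegrand, dif_pos h1]
  rw [X.lip_section_congr _ _ h2 (by rw [h2]) _ hτ rfl rfl]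
  change X.lip hτ rfl ((w i (Z.lact x (Z.lact x⁻¹ (Z.ract t h))) : ℂ) •
    ζ i j (Z.lact x (Z.lact x⁻¹ (Z.ract t h))))
    ((w i (Z.lact x⁻¹ (Z.ract t h)) : ℂ) • ζ i j (Z.lact x⁻¹ (Z.ract t h))) = _
  have hw' : w i (Z.lact x (Z.lact x⁻¹ (Z.ract t h))) = w i (Z.ract t h) := by
    rw [Z.lact_inv_lact (by rw [Z.rng_ract hh.symm, hx])]
  rw [hw', map_smul (X.lip hτ rfl), LinearMap.smul_apply, LinearMap.map_smulₛₗ, smul_smul,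
    Complex.conj_ofReal, Complex.ofReal_mul]

-- Evaluated with base point x⁻¹τ, the value e(x) is an H-integral of kernel terms times Σ_j
-- ⟨ζ_ij(τh), ζ_ij(x⁻¹τh)⟩. Wherever the i-th kernel term is nonzero, `hδ` says that this sum
-- carries η(x⁻¹t) to within δ of η(t). Integrating over x and h multiplies δ by the mass of the
-- kernel. The spaces T and T' interact only through the common range of τ and t.
include hw hwc hζ in
theorem norm_sectionAction_sub_le (hw0 : ∀ i t, 0 ≤ w i t)
    (e : SectionsCc B) (he : ∀ x, e.1 x = ∑ i, ∑ j, X.innerSection ν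
      (SectionsCc.ofSmul (hw i) (hwc i) (hζ i j)) (SectionsCc.ofSmul (hw i) (hwc i) (hζ i j)) x)
    (η : SectionsCc E') {δ : ℝ}
    (hδ : ∀ i (x : G) (τ : T) (hτ : src x = Z.rng τ), w i τ ≠ 0 → w i (Z.lact x τ) ≠ 0 →
      ∀ (t t' : T') (h : src x = Z'.rng t) (h' : Z'.lact x t = t'),
        ‖η.1 t' - X'.lact h h' (∑ j, X.lip hτ rfl (ζ i j (Z.lact x τ)) (ζ i j τ)) (η.1 t)‖ ≤ δ)
    {t : T'} {τ : T} (ht : Z.rng τ = Z'.rng t) :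
    ‖X'.sectionAction μ e.1 η.1 t -
      ((∫ x, ∫ h, ∑ i, w i (Z.ract τ h) * w i (Z.lact x⁻¹ (Z.ract τ h)) ∂ν.meas (Z.src τ)
        ∂μ.meas (Z.rng τ) : ℝ) : ℂ) • η.1 t‖ ≤
    δ * ∫ x, ∫ h, ∑ i, w i (Z.ract τ h) * w i (Z.lact x⁻¹ (Z.ract τ h)) ∂ν.meas (Z.src τ)
        ∂μ.meas (Z.rng τ) := by
  set k : G → H → ℝ := fun x h => ∑ i, w i (Z.ract τ h) * w i (Z.lact x⁻¹ (Z.ract τ h)) with hk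
  have hkint : Integrable (fun p : G × H => k p.1 p.2)
      ((μ.meas (Z.rng τ)).prod (ν.meas (Z.src τ))) :=
    integrable_finsetSum _ fun i _ => Z.integrable_kernel μ ν (hw i) (hwc i) (hw i) (hwc i) τ
  have hkint1 : Integrable (fun x => ∫ h, k x h ∂ν.meas (Z.src τ)) (μ.meas (Z.rng τ)) :=
    hkint.integral_prod_left
  have hcw : ∀ x, rng x = Z.rng τ → Integrable (k x) (ν.meas (Z.src τ)) := by
    intro x hx
    refine integrable_finsetSum _ fun i _ => ?_
    have hc : ContinuousOn (fun h => w i (Z.ract τ h) * w i (Z.lact x⁻¹ (Z.ract τ h)))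
        {h | rng h = Z.src τ} := by
      refine ((hw i).comp_continuousOn (Z.continuousOn_ract τ)).mul ((hw i).comp_continuousOn ?_)
      exact (Z.continuousOn_lact_inv_ract τ).comp (f := fun h => (x, h)) (by fun_prop)
        fun h hh => ⟨hx, hh⟩
    refine ν.integrable hc (Z.isCompact_rightBracket (isCompact_singleton (x := τ)) (hwc i))
      fun h hh hhK => ?_
    by_contra hne
    exact hhK ⟨τ, rfl, hh.symm, subset_closure (left_ne_zero_of_mul hne)⟩
  have hpt : ∀ x, rng x = Z.rng τ →
      ‖X'.actionIntegrand e.1 η.1 t x - ((∫ h, k x h ∂ν.meas (Z.src τ) : ℝ) : ℂ) • η.1 t‖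
        ≤ δ * ∫ h, k x h ∂ν.meas (Z.src τ) := by
    intro x hx
    have hx' : rng x = Z'.rng t := by rw [hx, ht]
    have hsrc : Z.src (Z.lact x⁻¹ τ) = Z.src τ := Z.src_lact (by rw [TopGroupoid.src_inv, hx])
    -- Being continuous and linear in the element of B(x), the action can be moved inside the
    -- H-integral that defines e(x).
    let L := X'.lactCLM (Z'.comp_inv_lact hx') (Z'.lact_inv_lact hx') (η.1 (Z'.lact x⁻¹ t))
    let Φ : ∀ i, J i → H → B x := fun i j => X.innerIntegrand
      (SectionsCc.ofSmul (hw i) (hwc i) (hζ i j)).1 (SectionsCc.ofSmul (hw i) (hwc i) (hζ i j)).1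
      x (Z.lact x⁻¹ τ) (Z.comp_inv_lact hx)
    have hΦ : ∀ i j, Integrable (Φ i j) (ν.meas (Z.src τ)) := fun i j => by
      have := X.integrable_innerIntegrand ν (SectionsCc.ofSmul (hw i) (hwc i) (hζ i j))
        (SectionsCc.ofSmul (hw i) (hwc i) (hζ i j)) (Z.comp_inv_lact hx)
      rwa [hsrc] at this
    have hex : e.1 x = ∫ h, ∑ i, ∑ j, Φ i j h ∂ν.meas (Z.src τ) := by
      rw [he, integral_finsetSum _ fun i _ => integrable_finsetSum _ fun j _ => hΦ i j]
      refine Finset.sum_congr rfl fun i _ => ?_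
      rw [integral_finsetSum _ fun j _ => hΦ i j]
      refine Finset.sum_congr rfl fun j _ => ?_
      rw [X.innerSection_eq ν _ _ x (Z.lact x⁻¹ τ) (Z.comp_inv_lact hx), sectionInner_eq, hsrc]
    have hact : X'.actionIntegrand e.1 η.1 t x =
        ∫ h, L (∑ i, ∑ j, Φ i j h) ∂ν.meas (Z.src τ) := by
      rw [ContinuousLinearMap.integral_comp_comm L (integrable_finsetSum _ fun i _ =>
        integrable_finsetSum _ fun j _ => hΦ i j), ← hex, actionIntegrand, dif_pos hx']
      rfl
    have hsm : ((∫ h, k x h ∂ν.meas (Z.src τ) : ℝ) : ℂ) • η.1 t =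
        ∫ h, ((k x h : ℝ) : ℂ) • η.1 t ∂ν.meas (Z.src τ) := by
      rw [integral_smul_const, integral_complex_ofReal]
    have hLi : Integrable (fun h => L (∑ i, ∑ j, Φ i j h)) (ν.meas (Z.src τ)) :=
      L.integrable_comp (integrable_finsetSum _ fun i _ => integrable_finsetSum _ fun j _ => hΦ i j)
    have hki : Integrable (fun h => ((k x h : ℝ) : ℂ) • η.1 t) (ν.meas (Z.src τ)) :=
      (hcw x hx).ofReal.smul_const _
    rw [hact, hsm, ← integral_sub hLi hki, ← integral_const_mul]
    refine norm_integral_le_of_norm_le ((hcw x hx).const_mul δ) ?_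
    filter_upwards [ν.ae_rng (Z.src τ)] with h hh
    have hτ : src x = Z.rng (Z.lact x⁻¹ (Z.ract τ h)) :=
      Z.comp_inv_lact (by rw [Z.rng_ract hh.symm, hx])
    have hll : Z.lact x (Z.lact x⁻¹ (Z.ract τ h)) = Z.ract τ h :=
      Z.lact_inv_lact (by rw [Z.rng_ract hh.symm, hx])
    have hsum : L (∑ i, ∑ j, Φ i j h) - ((k x h : ℝ) : ℂ) • η.1 t =
        ∑ i, ((w i (Z.ract τ h) * w i (Z.lact x⁻¹ (Z.ract τ h)) : ℝ) : ℂ) •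
          (L (∑ j, X.lip hτ rfl (ζ i j (Z.lact x (Z.lact x⁻¹ (Z.ract τ h))))
            (ζ i j (Z.lact x⁻¹ (Z.ract τ h)))) - η.1 t) := by
      rw [map_sum, hk]
      simp only [Complex.ofReal_sum, Finset.sum_smul, ← Finset.sum_sub_distrib, smul_sub]
      refine Finset.sum_congr rfl fun i _ => ?_
      congr 1
      rw [← map_smul, Finset.smul_sum]
      congr 1
      refine Finset.sum_congr rfl fun j _ => ?_
      exact X.innerIntegrand_ofSmul hw hwc hζ i j hx hh (Z.comp_inv_lact hx) hτ
    rw [hsum, hk, Finset.mul_sum]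
    refine norm_sum_le_of_le _ fun i _ => ?_
    have hk0 : 0 ≤ w i (Z.ract τ h) * w i (Z.lact x⁻¹ (Z.ract τ h)) := mul_nonneg (hw0 _ _) (hw0 _ _)
    rw [norm_smul, Complex.norm_real, Real.norm_of_nonneg hk0, mul_comm δ]
    by_cases hne : w i (Z.ract τ h) * w i (Z.lact x⁻¹ (Z.ract τ h)) = 0
    · simp [hne]
    · refine mul_le_mul_of_nonneg_left ?_ hk0
      rw [norm_sub_rev]
      exact hδ i x _ hτ (right_ne_zero_of_mul hne) (by rw [hll]; exact left_ne_zero_of_mul hne) _ _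
        (Z'.comp_inv_lact hx') (Z'.lact_inv_lact hx')
  have hai := X'.integrable_actionIntegrand μ e η t
  rw [← ht] at hai
  have hsm : ((∫ x, ∫ h, k x h ∂ν.meas (Z.src τ) ∂μ.meas (Z.rng τ) : ℝ) : ℂ) • η.1 t =
      ∫ x, ((∫ h, k x h ∂ν.meas (Z.src τ) : ℝ) : ℂ) • η.1 t ∂μ.meas (Z.rng τ) := by
    rw [integral_smul_const, integral_complex_ofReal]
  have hki : Integrable (fun x => ((∫ h, k x h ∂ν.meas (Z.src τ) : ℝ) : ℂ) • η.1 t)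
      (μ.meas (Z.rng τ)) := hkint1.ofReal.smul_const _
  rw [hsm, sectionAction_eq, ← ht, ← integral_sub hai hki, ← integral_const_mul]
  refine norm_integral_le_of_norm_le (hkint1.const_mul δ) ?_
  filter_upwards [μ.ae_rng (Z.rng τ)] with x hx
  exact hpt x hx

end FellEquivalence

/-! ### Construction of the approximate identity -/

namespace FellEquivalence

variable {G H T : Type*} [TopologicalSpace G] [LocallyCompactSpace G] [T2Space G]
  [SecondCountableTopology G] [TopGroupoid G] [MeasurableSpace G] [BorelSpace G]
  [TopologicalSpace H] [LocallyCompactSpace H] [T2Space H]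
  [SecondCountableTopology H] [TopGroupoid H] [MeasurableSpace H] [BorelSpace H]
  [TopologicalSpace T] [LocallyCompactSpace T] [T2Space T] {Z : GroupoidEquivalence G H T}
  {B : G → Type*} [∀ x, NormedAddCommGroup (B x)] [∀ x, NormedSpace ℂ (B x)]
  [∀ x, CompleteSpace (B x)] [TopologicalSpace (Tot B)] [FellBundle B]
  {C : H → Type*} [∀ h, NormedAddCommGroup (C h)] [∀ h, NormedSpace ℂ (C h)]
  [∀ h, CompleteSpace (C h)] [TopologicalSpace (Tot C)] [FellBundle C]
  {E : T → Type*} [∀ t, NormedAddCommGroup (E t)] [∀ t, NormedSpace ℂ (E t)]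
  [∀ t, CompleteSpace (E t)] [TopologicalSpace (Tot E)] [UscBanachBundle E]
  (X : FellEquivalence Z B C E) (μ : HaarSystem G) (ν : HaarSystem H)

/-- The support of `f · η` stays in a fixed compact set when the support of `f` is close to the
units. -/
theorem exists_compact_sectionAction_eq_zero (η : SectionsCc E) :
    ∃ K : Set T, IsCompact K ∧ (∀ t ∉ K, η.1 t = 0) ∧ ∃ N : Set G,
      (∀ u : unitSpace G, N ∈ 𝓝 (u : G)) ∧ ∀ f : ∀ x, B x, (∀ x ∉ N, f x = 0) →
        ∀ t ∉ K, X.sectionAction μ f η.1 t = 0 := by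
  obtain ⟨K, hK, hηK⟩ := exists_compact_superset η.2.2
  -- N consists of the x that carry the support of η into its compact neighbourhood K. Near a pair
  -- (u, t) with u = r(t) this holds by continuity of the action; near any other pair nothing is
  -- composable. Compactness of the support makes the neighbourhood of u uniform in t.
  refine ⟨K, hK, fun t ht => ?_, {x | ∀ t ∈ closure {t | η.1 t ≠ 0}, src x = Z.rng t →
    Z.lact x t ∈ K}, fun u => ?_, fun f hf t ht => ?_⟩
  · by_contra hne
    exact ht (interior_subset (hηK (subset_closure hne)))
  · refine η.2.2.eventually_forall_of_forall_eventually fun t ht => ?_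
    by_cases hu : u = Z.rng t
    · subst hu
      have h := Z.tendsto_lact (l := comap Subtype.val (𝓝 ((Z.rng t : G), t)))
        (f := fun p : {p : G × T // src p.1 = Z.rng p.2} => p.1.1) (g := fun p => p.1.2)
        (x := (Z.rng t : G)) (t := t) (fun p => p.2) (src_unit _)
        ((continuous_fst.tendsto _).comp tendsto_comap)
        ((continuous_snd.tendsto _).comp tendsto_comap)
      rw [Z.unit_lact] at h
      have h2 := h (mem_interior_iff_mem_nhds.1 (hηK ht))
      rw [mem_map, mem_comap] at h2
      obtain ⟨U, hU, hUK⟩ := h2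
      filter_upwards [hU] with p hp hs
      exact hUK (a := ⟨p, hs⟩) hp
    · have h1 : Tendsto (fun p : G × T => (src p.1, Z.rng p.2)) (𝓝 ((u : G), t))
          (𝓝 (u, Z.rng t)) := by
        have : Continuous fun p : G × T => (src p.1, Z.rng p.2) :=
          (TopGroupoid.continuous_src.comp continuous_fst).prodMk
            (Z.continuous_rng.comp continuous_snd)
        simpa [src_unit] using this.tendsto ((u : G), t)
      have h2 : {q : unitSpace G × unitSpace G | q.1 ≠ q.2} ∈ 𝓝 (u, Z.rng t) :=
        isClosed_diagonal.isOpen_compl.mem_nhds hu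
      filter_upwards [h1 h2] with p hp hs
      exact absurd hs hp
  · refine X.sectionAction_eq_zero μ f η.1 fun x hx => ?_
    by_contra! h
    refine h.1 (hf x fun hxN => ht ?_)
    have := hxN (Z.lact x⁻¹ t) (subset_closure h.2) (Z.comp_inv_lact hx)
    rwa [Z.lact_inv_lact hx] at this

theorem exists_compact_bound (P : Finset (SectionsCc E)) :
    ∃ K₀ : Set (unitSpace G), IsCompact K₀ ∧ ∃ M : ℝ, 0 ≤ M ∧ ∀ η ∈ P, ∀ t,
      ‖η.1 t‖ ≤ M ∧ (η.1 t ≠ 0 → Z.rng t ∈ K₀) := by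
  classical
  induction P using Finset.induction_on with
  | empty => exact ⟨∅, isCompact_empty, 0, le_rfl, by simp⟩
  | insert η P _ ih =>
    obtain ⟨K, hK, M, hM, h⟩ := ih
    obtain ⟨M', hM', h'⟩ := UscBanachBundle.exists_bound η
    refine ⟨Z.rng '' closure {t | η.1 t ≠ 0} ∪ K, (η.2.2.image Z.continuous_rng).union hK,
      max M' M, hM.trans (le_max_right _ _), fun ζ hζ t => ?_⟩
    rcases Finset.mem_insert.1 hζ with rfl | hζ
    · exact ⟨(h' t).trans (le_max_left _ _), fun h0 => .inl ⟨t, subset_closure h0, rfl⟩⟩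
    · exact ⟨(h ζ hζ t).1.trans (le_max_right _ _), fun h0 => .inr ((h ζ hζ t).2 h0)⟩

variable {H' T' : Type*} [TopologicalSpace H'] [TopGroupoid H'] [TopologicalSpace T'] [T2Space T']
  {Z' : GroupoidEquivalence G H' T'}
  {C' : H' → Type*} [∀ h, NormedAddCommGroup (C' h)] [∀ h, NormedSpace ℂ (C' h)]
  [∀ h, CompleteSpace (C' h)] [TopologicalSpace (Tot C')] [FellBundle C']
  {E' : T' → Type*} [∀ t, NormedAddCommGroup (E' t)] [∀ t, NormedSpace ℂ (E' t)]
  [∀ t, CompleteSpace (E' t)] [TopologicalSpace (Tot E')] [UscBanachBundle E']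
  (X' : FellEquivalence Z' B C' E')

theorem exists_nhds_forall_norm_sub_lact_lt {J : Type*} [Fintype J] {t₀ : T} {ζ : J → ∀ t, E t}
    (hζ : ∀ j, Continuous fun t => (⟨t, ζ j t⟩ : Tot E)) (P : Finset (SectionsCc E')) {δ : ℝ}
    (hδ : 0 < δ)
    (h₀ : ∀ η ∈ P, ∀ (t : T') (h : src (Z.rng t₀ : G) = Z'.rng t)
      (h' : Z'.lact (Z.rng t₀ : G) t = t),
      ‖η.1 t - X'.lact h h' (∑ j, X.lip (src_unit (Z.rng t₀)) (Z.unit_lact t₀) (ζ j t₀) (ζ j t₀))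
        (η.1 t)‖ < δ) :
    ∃ V ∈ 𝓝 t₀, ∀ η ∈ P, ∀ (x : G) (τ : T) (hτ : src x = Z.rng τ), τ ∈ V → Z.lact x τ ∈ V →
      ∀ (t t' : T') (h : src x = Z'.rng t) (h' : Z'.lact x t = t'),
        ‖η.1 t' - X'.lact h h' (∑ j, X.lip hτ rfl (ζ j (Z.lact x τ)) (ζ j τ)) (η.1 t)‖ < δ := by
  choose! V hV hVη using fun η (hη : η ∈ P) =>
    X.exists_nhds_norm_sub_lact_lt X' hζ η hδ (h₀ η hη)
  refine ⟨⋂ η ∈ P, V η, (biInter_finset_mem P).2 hV, fun η hη x τ hτ h1 h2 => ?_⟩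
  exact hVη η hη x τ hτ (Set.mem_iInter₂.1 h1 η hη) (Set.mem_iInter₂.1 h2 η hη)

/-- The approximate identity near a point `t₀`. -/
theorem exists_local_approx (P : Finset (SectionsCc E)) (P' : Finset (SectionsCc E')) {N : Set G}
    (hN : ∀ u : unitSpace G, N ∈ 𝓝 (u : G)) {δ : ℝ} (hδ : 0 < δ) (t₀ : T) :
    ∃ (n : ℕ) (ζ : Fin n → ∀ t, E t), (∀ j, Continuous fun t => (⟨t, ζ j t⟩ : Tot E)) ∧
      ∃ V ∈ 𝓝 t₀, (∀ (x : G) (τ : T), src x = Z.rng τ → τ ∈ V → Z.lact x τ ∈ V → x ∈ N) ∧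
        (∀ η ∈ P, ∀ (x : G) (τ : T) (hτ : src x = Z.rng τ), τ ∈ V → Z.lact x τ ∈ V →
          ∀ (t t' : T) (h : src x = Z.rng t) (h' : Z.lact x t = t'),
            ‖η.1 t' - X.lact h h' (∑ j, X.lip hτ rfl (ζ j (Z.lact x τ)) (ζ j τ)) (η.1 t)‖ < δ) ∧
        ∀ η ∈ P', ∀ (x : G) (τ : T) (hτ : src x = Z.rng τ), τ ∈ V → Z.lact x τ ∈ V →
          ∀ (t t' : T') (h : src x = Z'.rng t) (h' : Z'.lact x t = t'),
            ‖η.1 t' - X'.lact h h' (∑ j, X.lip hτ rfl (ζ j (Z.lact x τ)) (ζ j τ)) (η.1 t)‖ < δ := by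
  classical
  -- Both bundles are tested through finite subsets of the same algebra B(r(t₀)), so one family of
  -- vectors in E(t₀) handles E and E' together.
  obtain ⟨S₁, δ₁, hδ₁, h₁⟩ := X.exists_finset_forall_norm_sub_lact_le P (Z.rng t₀) hδ
  obtain ⟨S₂, δ₂, hδ₂, h₂⟩ := X'.exists_finset_forall_norm_sub_lact_le P' (Z.rng t₀) hδ
  obtain ⟨s, ζ₀, hnorm, happ⟩ := X.exists_approx_unit t₀ (S₁ ∪ S₂) (lt_min hδ₁ hδ₂)
  choose σ hσ hσ₀ using fun e : E t₀ => UscBanachBundle.enough_sections (A := E) t₀ e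
  let ζ : Fin s.card → ∀ t, E t := fun j => σ (ζ₀ (s.equivFin.symm j))
  have hζ : ∀ j, Continuous fun t => (⟨t, ζ j t⟩ : Tot E) := fun j => hσ _
  have hsum : ∑ j, X.lip (src_unit (Z.rng t₀)) (Z.unit_lact t₀) (ζ j t₀) (ζ j t₀) =
      ∑ e ∈ s, X.lip (src_unit (Z.rng t₀)) (Z.unit_lact t₀) (ζ₀ e) (ζ₀ e) := by
    simp only [ζ, hσ₀]
    rw [← Finset.sum_coe_sort s fun e => X.lip (src_unit (Z.rng t₀)) (Z.unit_lact t₀) (ζ₀ e) (ζ₀ e)]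
    exact s.equivFin.symm.sum_comp fun e : s =>
      X.lip (src_unit (Z.rng t₀)) (Z.unit_lact t₀) (ζ₀ e) (ζ₀ e)
  obtain ⟨V₁, hV₁, hV₁P⟩ := X.exists_nhds_forall_norm_sub_lact_lt X hζ P hδ (by
    rw [hsum]
    exact h₁ _ hnorm fun b hb => (happ b (Finset.mem_union_left _ hb)).trans (min_le_left _ _))
  obtain ⟨V₂, hV₂, hV₂P⟩ := X.exists_nhds_forall_norm_sub_lact_lt X' hζ P' hδ (by
    rw [hsum]
    exact h₂ _ hnorm fun b hb => (happ b (Finset.mem_union_right _ hb)).trans (min_le_right _ _))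
  obtain ⟨V₃, hV₃, hV₃N⟩ := Z.exists_nhds_lact (hN (Z.rng t₀))
  refine ⟨s.card, ζ, hζ, V₁ ∩ V₂ ∩ V₃, inter_mem (inter_mem hV₁ hV₂) hV₃,
    fun x τ h h1 h2 => hV₃N x τ h h1.2 h2.2, fun η hη x τ hτ h1 h2 => ?_,
    fun η hη x τ hτ h1 h2 => ?_⟩
  · exact hV₁P η hη x τ hτ h1.1.1 h2.1.1
  · exact hV₂P η hη x τ hτ h1.1.2 h2.1.2

end FellEquivalence

/-! ### Gluing the local approximate units by the scalar kernel. -/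

namespace FellEquivalence

variable {G H T : Type*} [TopologicalSpace G] [LocallyCompactSpace G] [T2Space G]
  [SecondCountableTopology G] [TopGroupoid G] [MeasurableSpace G] [BorelSpace G]
  [TopologicalSpace H] [LocallyCompactSpace H] [T2Space H]
  [SecondCountableTopology H] [TopGroupoid H] [MeasurableSpace H] [BorelSpace H]
  [TopologicalSpace T] [LocallyCompactSpace T] [T2Space T] {Z : GroupoidEquivalence G H T}
  {B : G → Type*} [∀ x, NormedAddCommGroup (B x)] [∀ x, NormedSpace ℂ (B x)]
  [∀ x, CompleteSpace (B x)] [TopologicalSpace (Tot B)] [FellBundle B]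
  {C : H → Type*} [∀ h, NormedAddCommGroup (C h)] [∀ h, NormedSpace ℂ (C h)]
  [∀ h, CompleteSpace (C h)] [TopologicalSpace (Tot C)] [FellBundle C]
  {E : T → Type*} [∀ t, NormedAddCommGroup (E t)] [∀ t, NormedSpace ℂ (E t)]
  [∀ t, CompleteSpace (E t)] [TopologicalSpace (Tot E)] [UscBanachBundle E]
  (X : FellEquivalence Z B C E) (μ : HaarSystem G) (ν : HaarSystem H)
  {H' T' : Type*} [TopologicalSpace H'] [LocallyCompactSpace H'] [T2Space H']
  [SecondCountableTopology H'] [TopGroupoid H'] [MeasurableSpace H'] [BorelSpace H']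
  [TopologicalSpace T'] [LocallyCompactSpace T'] [T2Space T']
  {Z' : GroupoidEquivalence G H' T'}
  {C' : H' → Type*} [∀ h, NormedAddCommGroup (C' h)] [∀ h, NormedSpace ℂ (C' h)]
  [∀ h, CompleteSpace (C' h)] [TopologicalSpace (Tot C')] [FellBundle C']
  {E' : T' → Type*} [∀ t, NormedAddCommGroup (E' t)] [∀ t, NormedSpace ℂ (E' t)]
  [∀ t, CompleteSpace (E' t)] [TopologicalSpace (Tot E')] [UscBanachBundle E']
  (X' : FellEquivalence Z' B C' E')

/-- The mass m has to be close to 1 only where v ≠ 0; elsewhere m ≤ 1 + δ is enough. The errors add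
up to δm + δM ≤ δ(2 + M). -/
theorem norm_sub_le_of_norm_sub_smul_le {F : Type*} [NormedAddCommGroup F] [NormedSpace ℂ F]
    {a v : F} {m δ M ε : ℝ} (hδ0 : 0 ≤ δ) (hδ1 : δ ≤ 1) (hM : ‖v‖ ≤ M) (hε : δ * (M + 2) ≤ ε)
    (ha : ‖a - (m : ℂ) • v‖ ≤ δ * m) (hm : m ≤ 1 + δ) (hv : v ≠ 0 → |1 - m| ≤ δ) :
    ‖a - v‖ ≤ ε := by
  have h1 : ‖v - (m : ℂ) • v‖ ≤ δ * M := by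
    have : v - (m : ℂ) • v = ((1 - m : ℝ) : ℂ) • v := by
      rw [Complex.ofReal_sub, sub_smul, Complex.ofReal_one, one_smul]
    rw [this, norm_smul, Complex.norm_real, Real.norm_eq_abs]
    by_cases h0 : v = 0
    · rw [h0] at hM ⊢
      rw [norm_zero] at hM ⊢
      rw [mul_zero]
      positivity
    · exact mul_le_mul (hv h0) hM (norm_nonneg _) hδ0
  have h2 : a - v = (a - (m : ℂ) • v) - (v - (m : ℂ) • v) := by abel
  have h3 : δ * m ≤ δ * 2 := mul_le_mul_of_nonneg_left (by linarith) hδ0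
  rw [h2]
  refine (norm_sub_le _ _).trans ?_
  linarith

/-- Elements of the required form that are supported near the units and almost act as the identity
on finitely many sections. -/
theorem exists_approx (P : Finset (SectionsCc E)) (P' : Finset (SectionsCc E')) {N : Set G}
    (hN : ∀ u : unitSpace G, N ∈ 𝓝 (u : G)) {ε : ℝ} (hε : 0 < ε) :
    ∃ (n : ℕ) (ξ : Fin n → SectionsCc E) (e : SectionsCc B),
      (∀ x, e.1 x = ∑ k, X.innerSection ν (ξ k) (ξ k) x) ∧ (∀ x ∉ N, e.1 x = 0) ∧
      (∀ η ∈ P, ∀ t, ‖X.sectionAction μ e.1 η.1 t - η.1 t‖ ≤ ε) ∧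
      ∀ η ∈ P', ∀ t, ‖X'.sectionAction μ e.1 η.1 t - η.1 t‖ ≤ ε := by
  classical
  obtain ⟨K₁, hK₁, M₁, hM₁, hP⟩ := exists_compact_bound (Z := Z) P
  obtain ⟨K₂, hK₂, M₂, hM₂, hP'⟩ := exists_compact_bound (Z := Z') P'
  set M := max M₁ M₂
  set δ := min 1 (ε / (M + 2))
  have hM : 0 ≤ M := hM₁.trans (le_max_left _ _)
  have hδ : 0 < δ := lt_min one_pos (by positivity)
  have hδε : δ * (M + 2) ≤ ε := by
    rw [← le_div_iff₀ (by positivity)]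
    exact min_le_right _ _
  choose m ζ hζ V hV hVN hVP hVP' using fun t₀ => X.exists_local_approx X' P P' hN hδ t₀
  -- K₁ ∪ K₂ contains the range of every point where one of the given sections is nonzero, so the
  -- mass is almost 1 wherever it matters.
  obtain ⟨s, w, hw, hwc, hw0, hwV, hle, habs⟩ := Z.exists_kernel μ ν (hK₁.union hK₂) V hV hδ
  have hζs : ∀ (i : s) (j : Fin (m i)), Continuous fun t => (⟨t, ζ i j t⟩ : Tot E) := fun i => hζ i
  let Ξ : ∀ p : (Σ i : s, Fin (m i)), SectionsCc E := fun p =>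
    SectionsCc.ofSmul (hw p.1) (hwc p.1) (hζ p.1 p.2)
  let e : SectionsCc B := ∑ p, ⟨X.innerSection ν (Ξ p) (Ξ p), X.innerSection_mem ν _ _⟩
  have he : ∀ x, e.1 x = ∑ p, X.innerSection ν (Ξ p) (Ξ p) x := fun x => by
    simp only [e, AddSubmonoidClass.coe_finsetSum, Finset.sum_apply]
  have he' : ∀ x, e.1 x = ∑ i, ∑ j, X.innerSection ν
      (SectionsCc.ofSmul (hw i) (hwc i) (hζ i j)) (SectionsCc.ofSmul (hw i) (hwc i) (hζ i j)) x :=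
    fun x => by rw [he, Fintype.sum_sigma]
  let q := Fintype.equivFin (Σ i : s, Fin (m i))
  refine ⟨_, fun k => Ξ (q.symm k), e, fun x => ?_, fun x hx => ?_, fun η hη t => ?_,
    fun η hη t => ?_⟩
  · rw [he]
    exact (q.symm.sum_comp fun p => X.innerSection ν (Ξ p) (Ξ p) x).symm
  · rw [he]
    refine Finset.sum_eq_zero fun p _ => X.innerSection_eq_zero ν _ _ fun t ht => ?_
    by_contra! h
    have h1 : ∀ t, (Ξ p).1 t ≠ 0 → t ∈ V p.1 := fun t ht => hwV p.1 t fun h0 => ht (by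
      change (w p.1 t : ℂ) • ζ p.1 p.2 t = 0
      rw [h0, Complex.ofReal_zero, zero_smul])
    exact hx (hVN p.1 x t ht (h1 _ h.2) (h1 _ h.1))
  · refine norm_sub_le_of_norm_sub_smul_le hδ.le (min_le_left _ _)
      ((hP η hη t).1.trans (le_max_left _ _)) hδε
      (X.norm_sectionAction_sub_le μ ν X hw hwc hζs hw0 e he' η
        (fun i x τ hτ h1 h2 t t' h h' =>
          (hVP i η hη x τ hτ (hwV i _ h1) (hwV i _ h2) t t' h h').le) rfl) (hle t) fun h0 => ?_
    exact habs t (.inl ((hP η hη t).2 h0))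
  -- The kernel lives on T, so it is evaluated at an auxiliary point of T over the same unit as t ∈
  -- T'.
  · obtain ⟨τ, hτ⟩ := Z.surjective_rng (Z'.rng t)
    refine norm_sub_le_of_norm_sub_smul_le hδ.le (min_le_left _ _)
      ((hP' η hη t).1.trans (le_max_right _ _)) hδε
      (X.norm_sectionAction_sub_le μ ν X' hw hwc hζs hw0 e he' η
        (fun i x τ hτ h1 h2 t t' h h' =>
          (hVP' i η hη x τ hτ (hwV i _ h1) (hwV i _ h2) t t' h h').le) hτ) (hle τ) fun h0 => ?_
    exact habs τ (.inr (hτ ▸ (hP' η hη t).2 h0))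

end FellEquivalence

/-! ### The involution -/

section Involution

variable {G : Type*} [TopologicalSpace G] [LocallyCompactSpace G] [T2Space G]
  [SecondCountableTopology G] [TopGroupoid G] [MeasurableSpace G] [BorelSpace G]
  {B : G → Type*} [∀ x, NormedAddCommGroup (B x)] [∀ x, NormedSpace ℂ (B x)]
  [∀ x, CompleteSpace (B x)] [TopologicalSpace (Tot B)] [FellBundle B]

open FellStructure

namespace FellBundle

theorem bstar_section_congr (f : ∀ x, B x) {x y z : G} (h : x = y) (hx : x⁻¹ = z)
    (hy : y⁻¹ = z) : bstar hx (f x) = bstar hy (f y) := by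
  subst h; rfl

theorem tot_bstar_congr {x z z' : G} (hz : x⁻¹ = z) (hz' : x⁻¹ = z') (b : B x) :
    (⟨z, bstar hz b⟩ : Tot B) = ⟨z', bstar hz' b⟩ := by
  subst hz; subst hz'; rfl

theorem bstar_bstar_section (f : ∀ x, B x) {x y z : G} (h : x⁻¹ = y) (h' : y⁻¹ = z) :
    bstar h' (bstar h (f x)) = f z := by
  obtain rfl : x = z := by rw [← h', ← h, inv_inv']
  exact bstar_bstar _ _ _

theorem bstar_integral {α : Type*} [MeasurableSpace α] {m : Measure α} {x z : G} (h : x⁻¹ = z)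
    {F : α → B x} (hF : Integrable F m) : bstar h (∫ a, F a ∂m) = ∫ a, bstar h (F a) ∂m :=
  (ContinuousLinearMap.integral_comp_commSL (σ := starRingEnd ℂ) (by simp)
    (LinearMap.mkContinuous (bstar h) 1 fun b => by rw [norm_bstar, one_mul]) hF).symm

/-- The involution `f ↦ f^*` of `Γ_c(G; B)`. -/
def starSection (f : SectionsCc B) : SectionsCc B := by
  refine ⟨fun x => bstar (inv_inv' x) (f.1 x⁻¹), ?_, ?_⟩
  · refine ((continuous_bstar (B := B)).comp (f.2.1.comp continuous_inv')).congr fun x => ?_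
    change (⟨x⁻¹⁻¹, bstar rfl (f.1 x⁻¹)⟩ : Tot B) = ⟨x, bstar (inv_inv' x) (f.1 x⁻¹)⟩
    exact tot_bstar_congr _ _ _
  · refine (f.2.2.image continuous_inv').closure_of_subset fun x hx => ?_
    refine ⟨x⁻¹, subset_closure fun h0 => hx ?_, inv_inv' x⟩
    change bstar (inv_inv' x) (f.1 x⁻¹) = 0
    rw [h0, map_zero]

end FellBundle

open FellBundle

/-- This is f * e = (e * f^*)^* for self-adjoint e. The substitution y ↦ xy gives the integrand
f(xy) e(y⁻¹), which is the adjoint of e(y) f^*(y⁻¹x⁻¹). -/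
theorem fellConvolution_eq_bstar (μ : HaarSystem G) (f e : SectionsCc B)
    (he : ∀ x, bstar (inv_inv' x) (e.1 x⁻¹) = e.1 x) (x : G) :
    fellConvolution μ f.1 e.1 x =
      bstar (inv_inv' x) (fellConvolution μ e.1 (starSection f).1 x⁻¹) := by
  let X := selfEquivalence B μ
  have h1 : fellConvolution μ f.1 e.1 x = ∫ y, X.actionIntegrand f.1 e.1 x y ∂μ.meas (rng x) := rfl
  have h2 : fellConvolution μ e.1 (starSection f).1 x⁻¹ =
    ∫ y, X.actionIntegrand e.1 (starSection f).1 x⁻¹ y ∂μ.meas (rng x⁻¹) := rfl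
  have h3 : Integrable (X.actionIntegrand e.1 (starSection f).1 x⁻¹) (μ.meas (rng x⁻¹)) :=
    X.integrable_actionIntegrand μ e (starSection f) x⁻¹
  rw [h1, h2, bstar_integral _ h3, ← μ.integral_mul_left x
    (X.continuousOn_actionIntegrand f e x), rng_inv]
  refine integral_congr_ae ?_
  filter_upwards [μ.ae_rng (src x)] with y hy
  have hy' : rng y = (GroupoidEquivalence.self μ).rng x⁻¹ := by
    change rng y = rng x⁻¹
    rw [rng_inv, hy]
  have hxy : rng (x * y) = (GroupoidEquivalence.self μ).rng x := rng_mul hy.symm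
  rw [FellEquivalence.actionIntegrand, FellEquivalence.actionIntegrand, dif_pos hxy, dif_pos hy']
  change bmul (comp_inv_mul hxy) (mul_inv_mul hxy) (f.1 (x * y)) (e.1 ((x * y)⁻¹ * x)) =
    bstar (inv_inv' x) (bmul (comp_inv_mul hy') (mul_inv_mul hy') (e.1 y)
      (bstar (inv_inv' _) (f.1 (y⁻¹ * x⁻¹)⁻¹)))
  have h4 : (y⁻¹ * x⁻¹)⁻¹ = x * y := by rw [← mul_inv_rev' hy.symm, inv_inv']
  have h5 : (x * y)⁻¹ * x = y⁻¹ := by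
    rw [mul_inv_rev' hy.symm, TopGroupoid.mul_inv_mul_cancel (by rw [src_inv, hy])]
  rw [bstar_bmul _ _ h5.symm h4 (inv_inv' x) (comp_inv_mul hxy) (mul_inv_mul hxy),
    bstar_bstar_section f.1, ← he ((x * y)⁻¹ * x)]
  congr 1
  exact bstar_section_congr e.1 (by rw [h5, inv_inv']) _ _

end Involution

/-! ### Hermitian symmetry of the section-valued inner product. -/

namespace FellEquivalence

variable {G H T : Type*} [TopologicalSpace G] [LocallyCompactSpace G] [T2Space G]
  [SecondCountableTopology G] [TopGroupoid G] [MeasurableSpace G] [BorelSpace G]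
  [TopologicalSpace H] [LocallyCompactSpace H] [T2Space H]
  [SecondCountableTopology H] [TopGroupoid H] [MeasurableSpace H] [BorelSpace H]
  [TopologicalSpace T] [LocallyCompactSpace T] [T2Space T] {Z : GroupoidEquivalence G H T}
  {B : G → Type*} [∀ x, NormedAddCommGroup (B x)] [∀ x, NormedSpace ℂ (B x)]
  [∀ x, CompleteSpace (B x)] [TopologicalSpace (Tot B)] [FellBundle B]
  {C : H → Type*} [∀ h, NormedAddCommGroup (C h)] [∀ h, NormedSpace ℂ (C h)]
  [∀ h, CompleteSpace (C h)] [TopologicalSpace (Tot C)] [FellBundle C]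
  {E : T → Type*} [∀ t, NormedAddCommGroup (E t)] [∀ t, NormedSpace ℂ (E t)]
  [∀ t, CompleteSpace (E t)] [TopologicalSpace (Tot E)] [UscBanachBundle E]
  (X : FellEquivalence Z B C E) (ν : HaarSystem H)

/-- With base point xt for x⁻¹ and base point t for x, the two integrands are pointwise adjoint and
the H-integrals are over the same measure. For ξ = η this makes the approximate identity
self-adjoint. -/
theorem bstar_innerSection (ξ η : SectionsCc E) (x : G) :
    FellStructure.bstar (inv_inv' x) (X.innerSection ν ξ η x⁻¹) = X.innerSection ν η ξ x := by
  obtain ⟨t, ht⟩ := exists_rng_eq Z x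
  have ht' : src x⁻¹ = Z.rng (Z.lact x t) := by rw [TopGroupoid.src_inv, Z.rng_lact ht]
  rw [X.innerSection_eq ν ξ η x⁻¹ _ ht', X.innerSection_eq ν η ξ x t ht, sectionInner_eq,
    sectionInner_eq, FellBundle.bstar_integral _ (X.integrable_innerIntegrand ν ξ η ht'),
    Z.src_lact ht]
  refine integral_congr_ae ?_
  filter_upwards [ν.ae_rng (Z.src t)] with h hh
  have h1 : Z.src (Z.lact x t) = rng h := by rw [Z.src_lact ht, hh]
  rw [innerIntegrand, innerIntegrand, dif_pos h1, dif_pos hh.symm]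
  have h2 : Z.ract (Z.lact x t) h = Z.lact x (Z.ract t h) := (Z.lact_ract ht hh.symm).symm
  have h3 : src x = Z.rng (Z.ract t h) := Z.src_eq_rng_ract ht hh.symm
  have h4 : Z.lact x⁻¹ (Z.lact x (Z.ract t h)) = Z.ract t h := by
    have := Z.lact_inv_lact (x := x⁻¹) (t := Z.ract t h) (by rw [TopGroupoid.rng_inv, h3])
    rwa [inv_inv'] at this
  rw [X.lip_section_congr _ _ h2 (by rw [h2, h4]) _ (by rw [← h2]; exact Z.src_eq_rng_ract ht' h1)
    rfl h4]
  exact X.bstar_lip _ h4 h3 rfl _ _ _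

end FellEquivalence

/-! ### The net -/

/-- Uniform convergence with supports in a common compact set. -/
def TendstoUniformlyCc {X : Type*} [TopologicalSpace X] {A : X → Type*}
    [∀ x, NormedAddCommGroup (A x)] [∀ x, NormedSpace ℂ (A x)] [∀ x, CompleteSpace (A x)]
    [TopologicalSpace (Tot A)] [UscBanachBundle A] {ι : Type*} (l : Filter ι) (F : ι → ∀ x, A x)
    (f : SectionsCc A) : Prop :=
  (∃ K : Set X, IsCompact K ∧ (∀ x ∉ K, f.1 x = 0) ∧ ∀ᶠ i in l, ∀ x ∉ K, F i x = 0) ∧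
    ∀ ε : ℝ, 0 < ε → ∀ᶠ i in l, ∀ x, ‖F i x - f.1 x‖ ≤ ε

theorem TendstoUniformlyCc.tendstoILT {X : Type*} [TopologicalSpace X] {A : X → Type*}
    [∀ x, NormedAddCommGroup (A x)] [∀ x, NormedSpace ℂ (A x)] [∀ x, CompleteSpace (A x)]
    [TopologicalSpace (Tot A)] [UscBanachBundle A] {ι : Type*} {l : Filter ι} {F : ι → ∀ x, A x}
    {f : SectionsCc A} (h : TendstoUniformlyCc l F f) (hF : ∀ i, F i ∈ SectionsCc A) :
    TendstoILT l F f := by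
  obtain ⟨⟨K, hK, hfK, hFK⟩, h⟩ := h
  exact UscBanachBundle.tendstoILT_of_uniform hF K hK hFK hfK h

namespace FellEquivalence

variable {G H T : Type*} [TopologicalSpace G] [LocallyCompactSpace G] [T2Space G]
  [SecondCountableTopology G] [TopGroupoid G] [MeasurableSpace G] [BorelSpace G]
  [TopologicalSpace H] [LocallyCompactSpace H] [T2Space H]
  [SecondCountableTopology H] [TopGroupoid H] [MeasurableSpace H] [BorelSpace H]
  [TopologicalSpace T] [LocallyCompactSpace T] [T2Space T] {Z : GroupoidEquivalence G H T}
  {B : G → Type*} [∀ x, NormedAddCommGroup (B x)] [∀ x, NormedSpace ℂ (B x)]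
  [∀ x, CompleteSpace (B x)] [TopologicalSpace (Tot B)] [FellBundle B]
  {C : H → Type*} [∀ h, NormedAddCommGroup (C h)] [∀ h, NormedSpace ℂ (C h)]
  [∀ h, CompleteSpace (C h)] [TopologicalSpace (Tot C)] [FellBundle C]
  {E : T → Type*} [∀ t, NormedAddCommGroup (E t)] [∀ t, NormedSpace ℂ (E t)]
  [∀ t, CompleteSpace (E t)] [TopologicalSpace (Tot E)] [UscBanachBundle E]
  (X : FellEquivalence Z B C E) (μ : HaarSystem G) (ν : HaarSystem H)

/-- The index set of the approximate identity. -/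
abbrev ApproxIndex (B : G → Type*) [∀ x, NormedAddCommGroup (B x)] [∀ x, NormedSpace ℂ (B x)]
    [∀ x, CompleteSpace (B x)] [TopologicalSpace (Tot B)] [UscBanachBundle B]
    (E : T → Type*) [∀ t, NormedAddCommGroup (E t)] [∀ t, NormedSpace ℂ (E t)]
    [∀ t, CompleteSpace (E t)] [TopologicalSpace (Tot E)] [UscBanachBundle E] : Type _ :=
  Finset (SectionsCc B) × Finset (SectionsCc E) × ℕ

/-- An index consists of the sections to be treated and an m for the error 1/(m + 1). The support of
e i is also kept in neighbourhoods of the units attached to these sections, so that e * f and e · η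
eventually vanish off fixed compact sets, as the inductive limit topology demands. -/
theorem exists_net_approx :
    ∃ (e : ApproxIndex B E → SectionsCc B) (n : ApproxIndex B E → ℕ)
      (ξ : ∀ i, Fin (n i) → SectionsCc E),
      (∀ i x, (e i).1 x = ∑ k, X.innerSection ν (ξ i k) (ξ i k) x) ∧
      (∀ f : SectionsCc B,
        TendstoUniformlyCc atTop (fun i => fellConvolution μ (e i).1 f.1) f) ∧
      ∀ η : SectionsCc E, TendstoUniformlyCc atTop (fun i => X.sectionAction μ (e i).1 η.1) η := by
  classical
  let Y := FellBundle.selfEquivalence B μ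
  choose K hK hK0 N hN hNK using fun η => X.exists_compact_sectionAction_eq_zero μ η
  choose L hL hL0 M hM hML using fun f => Y.exists_compact_sectionAction_eq_zero μ f
  have hmem : ∀ i : ApproxIndex B E, ∀ u : unitSpace G,
      (⋂ f ∈ i.1, M f) ∩ ⋂ η ∈ i.2.1, N η ∈ 𝓝 (u : G) := fun i u =>
    inter_mem ((biInter_finset_mem _).2 fun f _ => hM f u)
      ((biInter_finset_mem _).2 fun η _ => hN η u)
  choose n ξ e he he0 hη hf using fun i : ApproxIndex B E =>
    X.exists_approx μ ν Y i.2.1 i.1 (hmem i) (Nat.one_div_pos_of_nat (α := ℝ) (n := i.2.2))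
  refine ⟨e, n, ξ, he, fun f => ⟨⟨L f, hL f, hL0 f, ?_⟩, fun ε hε => ?_⟩,
    fun η => ⟨⟨K η, hK η, hK0 η, ?_⟩, fun ε hε => ?_⟩⟩
  · filter_upwards [eventually_ge_atTop (({f}, ∅, 0) : ApproxIndex B E)] with i hi
    refine hML f (e i).1 fun x hx => he0 i x fun hxi => hx ?_
    exact Set.mem_iInter₂.1 hxi.1 f (Finset.singleton_subset_iff.1 hi.1)
  · obtain ⟨m, hm⟩ := exists_nat_one_div_lt hε
    filter_upwards [eventually_ge_atTop (({f}, ∅, m) : ApproxIndex B E)] with i hi x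
    refine (hf i f (Finset.singleton_subset_iff.1 hi.1) x).trans (le_trans ?_ hm.le)
    exact Nat.one_div_le_one_div hi.2.2
  · filter_upwards [eventually_ge_atTop ((∅, {η}, 0) : ApproxIndex B E)] with i hi
    refine hNK η (e i).1 fun x hx => he0 i x fun hxi => hx ?_
    exact Set.mem_iInter₂.1 hxi.2 η (Finset.singleton_subset_iff.1 hi.2.1)
  · obtain ⟨m, hm⟩ := exists_nat_one_div_lt hε
    filter_upwards [eventually_ge_atTop ((∅, {η}, m) : ApproxIndex B E)] with i hi t
    refine (hη i η (Finset.singleton_subset_iff.1 hi.2.1) t).trans (le_trans ?_ hm.le)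
    exact Nat.one_div_le_one_div hi.2.2

end FellEquivalence

/-- The involution is isometric and replaces supports by their inverses, so left convergence at f^*
becomes right convergence at f. -/
theorem TendstoUniformlyCc.fellConvolution_right {G : Type*} [TopologicalSpace G]
    [LocallyCompactSpace G] [T2Space G] [SecondCountableTopology G] [TopGroupoid G]
    [MeasurableSpace G] [BorelSpace G] {B : G → Type*} [∀ x, NormedAddCommGroup (B x)]
    [∀ x, NormedSpace ℂ (B x)] [∀ x, CompleteSpace (B x)] [TopologicalSpace (Tot B)]
    [FellBundle B] {μ : HaarSystem G} {ι : Type*} {l : Filter ι} {e : ι → SectionsCc B}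
    (he : ∀ i x, FellStructure.bstar (inv_inv' x) ((e i).1 x⁻¹) = (e i).1 x) {f : SectionsCc B}
    (h : TendstoUniformlyCc l (fun i => fellConvolution μ (e i).1 (FellBundle.starSection f).1)
      (FellBundle.starSection f)) :
    TendstoUniformlyCc l (fun i => fellConvolution μ f.1 (e i).1) f := by
  have hf : ∀ x, f.1 x =
      FellStructure.bstar (inv_inv' x) ((FellBundle.starSection f).1 x⁻¹) := fun x =>
    (FellBundle.bstar_bstar_section f.1 _ _).symm
  obtain ⟨⟨K, hK, hfK, hFK⟩, h⟩ := h
  have hinv : ∀ x ∉ (fun x : G => x⁻¹) '' K, x⁻¹ ∉ K := fun x hx hxK => hx ⟨_, hxK, inv_inv' x⟩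
  refine ⟨⟨(fun x => x⁻¹) '' K, hK.image continuous_inv', fun x hx => ?_, ?_⟩, fun ε hε => ?_⟩
  · rw [hf, hfK _ (hinv x hx), map_zero]
  · filter_upwards [hFK] with i hi x hx
    rw [fellConvolution_eq_bstar μ f (e i) (he i), hi _ (hinv x hx), map_zero]
  · filter_upwards [h ε hε] with i hi x
    rw [fellConvolution_eq_bstar μ f (e i) (he i), hf x, ← map_sub, FellBundle.norm_bstar]
    exact hi x⁻¹

theorem mainTheorem4
    {G : Type uG} [TopologicalSpace G] [LocallyCompactSpace G] [T2Space G]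
    [SecondCountableTopology G] [TopGroupoid G] [MeasurableSpace G] [BorelSpace G]
    (μ : HaarSystem G)
    {B : G → Type uB} [∀ x, NormedAddCommGroup (B x)] [∀ x, NormedSpace ℂ (B x)]
    [∀ x, CompleteSpace (B x)] [TopologicalSpace (Tot B)] [FellBundle B] :
    -- for every equivalence, the approximate identity of the special form
    (∀ {H : Type uH} [TopologicalSpace H] [LocallyCompactSpace H] [T2Space H]
      [SecondCountableTopology H] [TopGroupoid H] [MeasurableSpace H] [BorelSpace H]
      (ν : HaarSystem H)
      {C : H → Type uC} [∀ h, NormedAddCommGroup (C h)] [∀ h, NormedSpace ℂ (C h)]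
      [∀ h, CompleteSpace (C h)] [TopologicalSpace (Tot C)] [FellBundle C]
      {T : Type uT} [TopologicalSpace T] [LocallyCompactSpace T] [T2Space T]
      (Z : GroupoidEquivalence G H T)
      {E : T → Type uE} [∀ t, NormedAddCommGroup (E t)] [∀ t, NormedSpace ℂ (E t)]
      [∀ t, CompleteSpace (E t)] [TopologicalSpace (Tot E)] [UscBanachBundle E]
      (X : FellEquivalence Z B C E),
      ∃ (ι : Type (max uG uB uT uE)) (_ : Preorder ι) (_ : IsDirectedOrder ι) (_ : Nonempty ι)
        (e : ι → SectionsCc B) (n : ι → ℕ) (ξ : ∀ i, Fin (n i) → SectionsCc E),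
        (∀ (i : ι) (x : G) (t : T) (hxt : TopGroupoid.src x = Z.rng t),
          (e i).1 x = ∑ k, X.sectionInner ν (ξ i k).1 (ξ i k).1 x t hxt) ∧
        (∀ f : SectionsCc B,
          TendstoILT atTop (fun i => fellConvolution μ (e i).1 f.1) f) ∧
        (∀ η : SectionsCc E,
          TendstoILT atTop (fun i => X.sectionAction μ (e i).1 η.1) η)) ∧
    -- a self-adjoint two-sided approximate identity
    (∃ (ι : Type (max uG uB)) (_ : Preorder ι) (_ : IsDirectedOrder ι) (_ : Nonempty ι)
      (e : ι → SectionsCc B),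
      (∀ (i : ι) (x : G), FellStructure.bstar (TopGroupoid.inv_inv' x) ((e i).1 x⁻¹) = (e i).1 x) ∧
      (∀ f : SectionsCc B, TendstoILT atTop (fun i => fellConvolution μ (e i).1 f.1) f) ∧
      (∀ f : SectionsCc B, TendstoILT atTop (fun i => fellConvolution μ f.1 (e i).1) f)) := by
  -- Convolution is, by definition, the section action in the equivalence of B with itself.
  have hconv : ∀ e f : SectionsCc B, fellConvolution μ e.1 f.1 ∈ SectionsCc B :=
    (FellBundle.selfEquivalence B μ).sectionAction_mem μ
  refine ⟨?_, ?_⟩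
  · intro H _ _ _ _ _ _ _ ν C _ _ _ _ _ T _ _ _ Z E _ _ _ _ _ X
    classical
    obtain ⟨e, n, ξ, he, hf, hη⟩ := X.exists_net_approx μ ν
    refine ⟨FellEquivalence.ApproxIndex B E, inferInstance, inferInstance, inferInstance,
      e, n, ξ, fun i x t hxt => ?_, fun f => (hf f).tendstoILT fun i => hconv _ _,
      fun η => (hη η).tendstoILT fun i => X.sectionAction_mem μ _ _⟩
    rw [he]
    exact Finset.sum_congr rfl fun k _ => X.innerSection_eq ν _ _ x t hxt
  · classical
    -- With E = B and ν = μ the elements are sums of ⟪ξ, ξ⟫, hence self-adjoint, and left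
    -- convergence implies right convergence.
    let X := FellBundle.selfEquivalence B μ
    obtain ⟨e, n, ξ, he, hf, -⟩ := X.exists_net_approx μ μ
    have hstar : ∀ i x, FellStructure.bstar (inv_inv' x) ((e i).1 x⁻¹) = (e i).1 x := by
      intro i x
      rw [he, he, map_sum]
      exact Finset.sum_congr rfl fun k _ => X.bstar_innerSection μ _ _ x
    exact ⟨FellEquivalence.ApproxIndex B B, inferInstance, inferInstance, inferInstance, e, hstar,
      fun f => (hf f).tendstoILT fun i => hconv _ _, fun f =>
      (TendstoUniformlyCc.fellConvolution_right hstar (hf _)).tendstoILT fun i => hconv _ _⟩
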